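/- All graphs are finite and simple. A graph is $K_{1,t}$-free if it has no induced subgraph isomorphic to the star $K_{1,t}$. An induced packing of $k$ cycles in a graph $G$ is a set of $k$ pairwise vertex-disjoint cycles of $G$ such that no edge of $G$ joins two distinct cycles of the set. A tree-decomposition of $G$ is a pair $(T,\beta)$ of a tree $T$ and a map $\beta\colon V(T)\to 2^{V(G)}$ such that $\bigcup_{a\in V(T)}\beta(a)=V(G)$, every edge of $G$ has both ends in some bag $\beta(a)$, and for every $v\in V(G)$ the set $\{a\in V(T): v\in\beta(a)\}$ induces a (nonempty) subtree of $T$. Its independence number is $\max_{a\in V(T)}\alpha(G[\beta(a)])$, where $\alpha$ denotes the maximum size of an independent set. Theorem. There are a constant $C$ and an algorithm that, given positive integers $t$ and $k$ (written in binary) and a $K_{1,t}$-free graph $G$ (given by its adjacency matrix), outputs, in time polynomial in $|V(G)|+\log t+\log k$, either an induced packing of $k$ cycles in $G$ or a tree-decomposition of $G$ with independence number at most $C\,t\,k\log(k+1)$. Running time is counted as the number of steps of a random access machine with addition and truncated subtraction as its arithmetic operations (a model that is polynomially equivalent to Turing machines). -/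

import Mathlib

/-! ### A random access machine

Programs are structured programs for a random access machine whose cells hold natural numbers of
arbitrary size. The only arithmetic operations are addition and truncated subtraction, so counting
one step per operation is polynomially equivalent to counting steps of a Turing machine (there is
no multiplication, hence `T` steps lengthen numbers by at most `O(T)` bits). -/

/-- The memory of the machine: scalar registers and one-dimensional arrays, both named by natural
numbers. A program mentions only finitely many of these names. -/
structure Store where
  var : ℕ → ℕ
  arr : ℕ → ℕ → ℕ

/-- Write the value `v` into register `x`. -/
def Store.setVar (s : Store) (x v : ℕ) : Store where
  var := Function.update s.var x v
  arr := s.arr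

/-- Write the value `v` into cell `i` of array `a`. -/
def Store.setArr (s : Store) (a i v : ℕ) : Store where
  var := s.var
  arr := Function.update s.arr a (Function.update (s.arr a) i v)

/-- Expressions: constants, registers, array cells with a computed index (indirect addressing),
sums and truncated differences. -/
inductive Expr where
  | const (c : ℕ)
  | var (x : ℕ)
  | get (a : ℕ) (i : Expr)
  | add (e f : Expr)
  | sub (e f : Expr)

/-- The value of an expression in a given memory. -/
def Expr.eval (s : Store) : Expr → ℕ
  | .const c => c
  | .var x => s.var x
  | .get a i => s.arr a (i.eval s)
  | .add e f => e.eval s + f.eval s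
  | .sub e f => e.eval s - f.eval s

/-- The number of steps needed to evaluate an expression: one for every node. -/
def Expr.cost : Expr → ℕ
  | .const _ => 1
  | .var _ => 1
  | .get _ i => i.cost + 1
  | .add e f => e.cost + f.cost + 1
  | .sub e f => e.cost + f.cost + 1

/-- Programs. A test `e` counts as true when the value of `e` is not zero. -/
inductive Prog where
  | skip
  | assign (x : ℕ) (e : Expr)
  | store (a : ℕ) (i e : Expr)
  | seq (p q : Prog)
  | ite (e : Expr) (p q : Prog)
  | loop (e : Expr) (p : Prog)

/-- `Prog.Exec p s c s'`: started with memory `s`, the program `p` halts with memory `s'` after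
exactly `c` steps. `Prog.loop e p` repeats `p` as long as `e` is not zero. -/
inductive Prog.Exec : Prog → Store → ℕ → Store → Prop
  | skip (s : Store) : Prog.Exec .skip s 1 s
  | assign (s : Store) (x : ℕ) (e : Expr) :
      Prog.Exec (.assign x e) s (e.cost + 1) (s.setVar x (e.eval s))
  | store (s : Store) (a : ℕ) (i e : Expr) :
      Prog.Exec (.store a i e) s (i.cost + e.cost + 1) (s.setArr a (i.eval s) (e.eval s))
  | seq {p q : Prog} {s s₁ s₂ : Store} {c₁ c₂ : ℕ} :
      Prog.Exec p s c₁ s₁ → Prog.Exec q s₁ c₂ s₂ → Prog.Exec (.seq p q) s (c₁ + c₂) s₂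
  | ite_true {e : Expr} {p q : Prog} {s s₁ : Store} {c : ℕ} :
      e.eval s ≠ 0 → Prog.Exec p s c s₁ → Prog.Exec (.ite e p q) s (e.cost + 1 + c) s₁
  | ite_false {e : Expr} {p q : Prog} {s s₁ : Store} {c : ℕ} :
      e.eval s = 0 → Prog.Exec q s c s₁ → Prog.Exec (.ite e p q) s (e.cost + 1 + c) s₁
  | loop_done {e : Expr} {p : Prog} {s : Store} :
      e.eval s = 0 → Prog.Exec (.loop e p) s (e.cost + 1) s
  | loop_step {e : Expr} {p : Prog} {s s₁ s₂ : Store} {c₁ c₂ : ℕ} :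
      e.eval s ≠ 0 → Prog.Exec p s c₁ s₁ → Prog.Exec (.loop e p) s₁ c₂ s₂ →
        Prog.Exec (.loop e p) s (e.cost + 1 + c₁ + c₂) s₂

/-- The machine is deterministic: the step count and the final memory are determined by the
program and the initial memory. -/
theorem Prog.Exec.deterministic {p : Prog} {s s₁ s₂ : Store} {c₁ c₂ : ℕ}
    (h₁ : Prog.Exec p s c₁ s₁) (h₂ : Prog.Exec p s c₂ s₂) : c₁ = c₂ ∧ s₁ = s₂ := by
  induction h₁ generalizing c₂ s₂ with
  | skip => cases h₂; exact ⟨rfl, rfl⟩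
  | assign => cases h₂; exact ⟨rfl, rfl⟩
  | store => cases h₂; exact ⟨rfl, rfl⟩
  | seq _ _ ih₁ ih₂ =>
    cases h₂ with
    | seq hp hq =>
      obtain ⟨rfl, rfl⟩ := ih₁ hp
      obtain ⟨rfl, rfl⟩ := ih₂ hq
      exact ⟨rfl, rfl⟩
  | ite_true he _ ih =>
    cases h₂ with
    | ite_true _ hp => obtain ⟨rfl, rfl⟩ := ih hp; exact ⟨rfl, rfl⟩
    | ite_false he₂ _ => exact absurd he₂ he
  | ite_false he _ ih =>
    cases h₂ with
    | ite_true he₂ _ => exact absurd he he₂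
    | ite_false _ hq => obtain ⟨rfl, rfl⟩ := ih hq; exact ⟨rfl, rfl⟩
  | loop_done he =>
    cases h₂ with
    | loop_done _ => exact ⟨rfl, rfl⟩
    | loop_step he₂ _ _ => exact absurd he he₂
  | loop_step he _ _ ih₁ ih₂ =>
    cases h₂ with
    | loop_done he₂ => exact absurd he₂ he
    | loop_step _ hp hq =>
      obtain ⟨rfl, rfl⟩ := ih₁ hp
      obtain ⟨rfl, rfl⟩ := ih₂ hq
      exact ⟨rfl, rfl⟩

/-! ### Induced packings of cycles and tree-decompositions -/

/-- A family of `k` cycles of `G` forming an induced packing: distinct members of the family have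
no common vertex, and `G` has no edge between them. -/
structure IsInducedCyclePacking {V : Type*} (G : SimpleGraph V) {k : ℕ} (root : Fin k → V)
    (cyc : ∀ i, G.Walk (root i) (root i)) : Prop where
  isCycle : ∀ i, (cyc i).IsCycle
  disjoint : ∀ i j, i ≠ j → ∀ u ∈ (cyc i).support, u ∉ (cyc j).support
  no_edge : ∀ i j, i ≠ j → ∀ u ∈ (cyc i).support, ∀ v ∈ (cyc j).support, ¬ G.Adj u v

/-- A tree-decomposition of `G` whose tree has the node set `ι`. -/
structure TreeDecomposition {V : Type*} (G : SimpleGraph V) (ι : Type*) where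
  tree : SimpleGraph ι
  bag : ι → Set V
  isTree : tree.IsTree
  cover : ⋃ a, bag a = Set.univ
  edge : ∀ u v, G.Adj u v → ∃ a, {u, v} ⊆ bag a
  subtree : ∀ v, (tree.induce {a | v ∈ bag a}).Connected

/-- The independence number of a tree-decomposition: the maximum over all nodes of the
independence number of the subgraph induced by the bag. -/
noncomputable def TreeDecomposition.independenceNumber {V ι : Type*} [Fintype ι]
    {G : SimpleGraph V} (D : TreeDecomposition G ι) : ℕ :=
  Finset.univ.sup fun a => (G.induce (D.bag a)).indepNum

/-! ### Input and output formats -/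

open Classical in
/-- The initial memory on input `(G, t, k)`: the registers 0, 1, 2 hold `n`, `t`, `k`, and array 0
holds the adjacency matrix of `G`, row by row. Everything else is zero. -/
noncomputable def inputStore {n : ℕ} (G : SimpleGraph (Fin n)) (t k : ℕ) : Store where
  var x := if x = 0 then n else if x = 1 then t else if x = 2 then k else 0
  arr a i := if a = 0 ∧ ∃ u v : Fin n, i = u * n + v ∧ G.Adj u v then 1 else 0

/-- The size of the input `(G, t, k)`: the number of vertices of `G` plus the numbers of binary
digits of `t` and of `k`. -/
def inputSize (n t k : ℕ) : ℕ := n + Nat.size t + Nat.size k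

/-- The memory presents a family of `k` closed walks: register 3 holds 1, cell `i` of array 1 holds
the length of walk `i`, and the `i`-th row, of width `n`, of array 2 starts with the
successive vertices of walk `i` (the return to the first vertex is not repeated). -/
def Store.PresentsCycles {n : ℕ} {G : SimpleGraph (Fin n)} (s : Store) {k : ℕ}
    {root : Fin k → Fin n} (cyc : ∀ i, G.Walk (root i) (root i)) : Prop :=
  s.var 3 = 1 ∧
  ∀ i : Fin k, s.arr 1 i = (cyc i).length ∧
    ∀ j < (cyc i).length, s.arr 2 (i * n + j) = (cyc i).getVert j

open Classical in
/-- The memory presents a tree-decomposition with node set `{0, ..., m - 1}`: register 3 holds 2,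
register 4 holds `m`, array 3 holds the adjacency matrix of the tree row by row, and array 4 holds,
row by row, the incidence matrix of nodes and vertices of `G` that records the bags. -/
def Store.PresentsTreeDecomposition {n : ℕ} {G : SimpleGraph (Fin n)} (s : Store) {m : ℕ}
    (D : TreeDecomposition G (Fin m)) : Prop :=
  s.var 3 = 2 ∧ s.var 4 = m ∧
  (∀ a b : Fin m, s.arr 3 (a * m + b) = if D.tree.Adj a b then 1 else 0) ∧
  (∀ (a : Fin m) (v : Fin n), s.arr 4 (a * n + v) = if v ∈ D.bag a then 1 else 0)

/-!
The algorithm dismantles `G` in at most `n` rounds. A vertex with at most one remaining neighbour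
is deleted, and that neighbour is recorded as its parent. If there is no such vertex, a cycle with
as few branch vertices as possible is recorded, where a branch vertex is one with at least three
remaining neighbours; then one vertex of the cycle and all its branch vertices are deleted
together with their neighbours. What is left of the cycle are paths without further neighbours,
which no later cycle can meet or touch, so the recorded cycles form an induced packing.

Suppose that fewer than `k` cycles were recorded. Let `X` be the set of the centres of the deleted
stars and `Z` the set of the vertices deleted with them. Outside `Z` the parents describe a
forest, so the bags `Z ∪ {v, parent v}` form a tree-decomposition. In a `K_{1,t}`-free graph an
independent set has at most `t` vertices in a closed neighbourhood, so the independence number of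
the decomposition is at most `t |X| + 2`.

It remains to see that `|X| = O(k log (k + 1))`. Suppose that every cycle of the graph that
remains at some time has more than `O(log |X|)` branch vertices. Regions grown around a vertex
through the later stars then span at most as many edges as a tree. After `O(log |X|)` steps such a
region grows only by a small factor, and then removing it makes the rest denser, which cannot go
on forever. Hence every recorded cycle contributes `O(log |X|)` centres, and `|X| = O(k log |X|)`.
-/

namespace CyclePacking

open Finset

variable {V : Type*}

/-! ### Walks that meet few branch vertices -/

section Cost

variable [DecidableEq V] {H H' : SimpleGraph V}

/-- The cost of a walk relative to a set `β` of vertices: the number of vertices of `β` on it. The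
vertices of degree two of a graph cost nothing when `β` is the set of its branch vertices. -/
def cost (β : Finset V) {u v : V} (w : H.Walk u v) : ℕ :=
  #(w.support.toFinset ∩ β)

variable (β : Finset V) {u v x y : V}

theorem cost_le_of_subset {w : H.Walk u v} {w' : H'.Walk x y} (h : w.support ⊆ w'.support) :
    cost β w ≤ cost β w' :=
  card_le_card <| inter_subset_inter_right fun a ha => by
    rw [List.mem_toFinset] at *
    exact h ha

theorem cost_concat_le (w : H.Walk u v) (h : H.Adj v x) : cost β (w.concat h) ≤ cost β w + 1 := by
  refine (card_le_card ?_).trans (card_insert_le x (w.support.toFinset ∩ β))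
  intro a
  simp only [SimpleGraph.Walk.support_concat, mem_inter, List.mem_toFinset, List.mem_append,
    List.mem_singleton, mem_insert]
  tauto

variable {β}

theorem cost_concat_of_notMem (w : H.Walk u v) (h : H.Adj v x) (hx : x ∉ β) :
    cost β (w.concat h) = cost β w := by
  refine congrArg card (Finset.ext fun a => ?_)
  simp only [SimpleGraph.Walk.support_concat, mem_inter, List.mem_toFinset, List.mem_append,
    List.mem_singleton]
  grind

/-- Two different paths with the same ends contain a cycle, which costs at most their total. -/
theorem eq_of_isPath_of_cost_add_cost_le {L : ℕ}
    (hcyc : ∀ u (c : H.Walk u u), c.IsCycle → L < cost β c) {p q : H.Walk u v}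
    (hp : p.IsPath) (hq : q.IsPath) (h : cost β p + cost β q ≤ L) : p = q := by
  let T : SimpleGraph V := (p.toSubgraph ⊔ q.toSubgraph).spanningCoe
  have hTH : T ≤ H := (p.toSubgraph ⊔ q.toSubgraph).spanningCoe_le
  have hpT : ∀ e ∈ p.edges, e ∈ T.edgeSet := by
    intro e he
    simp [T, he]
  have hqT : ∀ e ∈ q.edges, e ∈ T.edgeSet := by
    intro e he
    simp [T, he]
  have hac : T.IsAcyclic := by
    intro a c hc
    have hsub : c.support.toFinset ∩ β ⊆ p.support.toFinset ∩ β ∪ q.support.toFinset ∩ β := by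
      rw [← union_inter_distrib_right]
      refine inter_subset_inter_right fun x hx => ?_
      obtain ⟨e, he, hxe⟩ := (SimpleGraph.Walk.mem_support_iff_exists_mem_edges_of_not_nil
        hc.not_nil).1 (List.mem_toFinset.1 hx)
      have he' : e ∈ p.edges ∨ e ∈ q.edges := by
        simpa [T] using c.edges_subset_edgeSet he
      rw [mem_union, List.mem_toFinset, List.mem_toFinset]
      exact he'.imp (SimpleGraph.Walk.mem_support_of_mem_edges · hxe)
        (SimpleGraph.Walk.mem_support_of_mem_edges · hxe)
    have hle : cost β c ≤ cost β p + cost β q := (card_le_card hsub).trans (card_union_le _ _)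
    have hlt : L < cost β (c.mapLe hTH) := hcyc a _ (hc.mapLe hTH)
    rw [cost, SimpleGraph.Walk.support_mapLe_eq_support, ← cost] at hlt
    omega
  have heq : (⟨p.transfer T hpT, hp.transfer _⟩ : T.Path u v) = ⟨q.transfer T hqT, hq.transfer _⟩ :=
    (hac.subsingleton_path u v).elim _ _
  have hsupp := congrArg (fun x : T.Path u v => x.1.support) heq
  simp only [SimpleGraph.Walk.support_transfer] at hsupp
  exact SimpleGraph.Walk.ext_support hsupp

end Cost

/-! ### Sparse graphs have no cheap cycle -/

section Interedges

variable [DecidableEq V] (H : SimpleGraph V) [DecidableRel H.Adj] {S S' : Finset V}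

omit [DecidableEq V] in
theorem card_interedges_comm (S T : Finset V) : #(H.interedges S T) = #(H.interedges T S) :=
  have : Std.Symm H.Adj := ⟨fun _ _ => .symm⟩
  Rel.card_interedges_comm S T

theorem card_interedges_union_left (h : Disjoint S S') (T : Finset V) :
    #(H.interedges (S ∪ S') T) = #(H.interedges S T) + #(H.interedges S' T) := by
  rw [← card_union_of_disjoint (H.interedges_disjoint_left h T)]
  refine congrArg card (Finset.ext fun e => ?_)
  simp only [SimpleGraph.mem_interedges_iff, mem_union]
  tauto

theorem card_interedges_union_self (h : Disjoint S S') :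
    #(H.interedges (S ∪ S') (S ∪ S')) =
      #(H.interedges S S) + 2 * #(H.interedges S S') + #(H.interedges S' S') := by
  rw [card_interedges_union_left H h, card_interedges_comm H S, card_interedges_comm H S',
    card_interedges_union_left H h, card_interedges_union_left H h, card_interedges_comm H S' S]
  ring

/-- If all cycles are expensive, then cheap paths are unique, so every edge between vertices that
are cheap to reach from a root is the last edge of such a path. -/
theorem penultimate_eq_of_cost_le {H : SimpleGraph V} {β : Finset V} {D : ℕ}
    (hcyc : ∀ u (c : H.Walk u u), c.IsCycle → 2 * D + 1 < cost β c) {root u v : V}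
    {p : H.Walk root u} (hp : p.IsPath) (hpD : cost β p ≤ D) {q : H.Walk root v} (hq : q.IsPath)
    (hqD : cost β q ≤ D) (huv : H.Adj u v) : q.penultimate = u ∨ p.penultimate = v := by
  by_cases hvp : v ∈ p.support
  · by_cases huq : u ∈ q.support
    · have hpq : p.takeUntil v hvp = q :=
        eq_of_isPath_of_cost_add_cost_le hcyc (hp.takeUntil hvp) hq (by
          have := cost_le_of_subset β (p.support_takeUntil_subset_support hvp)
          omega)
      rw [← hpq] at huq
      exact absurd huq (SimpleGraph.Walk.endpoint_notMem_support_takeUntil hp hvp huv.ne)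
    · have hqp : q.concat huv.symm = p :=
        eq_of_isPath_of_cost_add_cost_le hcyc (hq.concat huq _) hp (by
          have := cost_concat_le β q huv.symm
          omega)
      exact Or.inr (by rw [← hqp, SimpleGraph.Walk.penultimate_concat])
  · have hpq : p.concat huv = q :=
      eq_of_isPath_of_cost_add_cost_le hcyc (hp.concat hvp _) hq (by
        have := cost_concat_le β p huv
        omega)
    exact Or.inl (by rw [← hpq, SimpleGraph.Walk.penultimate_concat])

omit [DecidableEq V] in
theorem card_interedges_add_two_le_of_forall_adj {H : SimpleGraph V} [DecidableRel H.Adj]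
    {A : Finset V} {root : V} (hroot : root ∈ A) {par : V → V} (hpar : par root = root)
    (hadj : ∀ u ∈ A, ∀ v ∈ A, H.Adj u v → par v = u ∨ par u = v) :
    #(H.interedges A A) + 2 ≤ 2 * #A := by
  classical
  have hsub : H.interedges A A ⊆
      (A.erase root).image (fun v => (par v, v)) ∪ (A.erase root).image (fun v => (v, par v)) := by
    rintro ⟨u, v⟩ huv
    obtain ⟨hu, hv, h⟩ := H.mem_interedges_iff.1 huv
    simp only [mem_union, mem_image, mem_erase, Prod.mk.injEq]
    rcases hadj u hu v hv h with hvu | huv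
    · refine Or.inl ⟨v, ⟨?_, hv⟩, hvu, rfl⟩
      rintro rfl
      exact h.ne (hvu.symm.trans hpar)
    · refine Or.inr ⟨u, ⟨?_, hu⟩, rfl, huv⟩
      rintro rfl
      exact h.ne (hpar.symm.trans huv)
  have hcard := (card_le_card hsub).trans (card_union_le _ _)
  have himage (f : V → V × V) : #((A.erase root).image f) ≤ #A - 1 :=
    card_image_le.trans (card_erase_of_mem hroot).le
  have hpos : 0 < #A := card_pos.2 ⟨_, hroot⟩
  have := himage fun v => (par v, v)
  have := himage fun v => (v, par v)
  omega

theorem card_interedges_add_two_le_of_cost_le {H : SimpleGraph V} [DecidableRel H.Adj]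
    {β : Finset V} {D : ℕ}
    (hcyc : ∀ u (c : H.Walk u u), c.IsCycle → 2 * D + 1 < cost β c) {root : V} {A : Finset V}
    (hroot : root ∈ A) (hA : ∀ v ∈ A, ∃ w : H.Walk root v, cost β w ≤ D) :
    #(H.interedges A A) + 2 ≤ 2 * #A := by
  have hpath : ∀ v ∈ A, ∃ x, ∃ p : H.Walk root v, p.IsPath ∧ cost β p ≤ D ∧ p.penultimate = x := by
    intro v hv
    obtain ⟨w, hw⟩ := hA v hv
    exact ⟨_, w.bypass, w.bypass_isPath,
      (cost_le_of_subset β w.support_bypass_subset_support).trans hw, rfl⟩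
  choose! pen hpen using hpath
  refine card_interedges_add_two_le_of_forall_adj hroot (par := pen) ?_ fun u hu v hv huv => ?_
  · obtain ⟨p, hp, -, hx⟩ := hpen root hroot
    rw [← hx, (SimpleGraph.Walk.isPath_iff_nil.1 hp).eq_nil, SimpleGraph.Walk.penultimate_nil]
  · obtain ⟨p, hp, hpD, hpu⟩ := hpen u hu
    obtain ⟨q, hq, hqD, hqv⟩ := hpen v hv
    simpa only [hpu, hqv] using penultimate_eq_of_cost_le hcyc hp hpD hq hqD huv

end Interedges

/-! ### Region growing -/

theorem exists_slow_growth {f : ℕ → ℕ} {R : ℕ} (h : f (R + 1) * 4 ^ R < 5 ^ R) :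
    ∃ r ≤ R, 4 * f (r + 1) ≤ 5 * f r := by
  by_contra! hfast
  have hpow : ∀ r ≤ R, 5 ^ r ≤ f (r + 1) * 4 ^ r := by
    intro r hr
    induction r with
    | zero =>
      have := hfast 0 hr
      simp only [pow_zero, mul_one]
      omega
    | succ r ih =>
      calc 5 ^ (r + 1) = 5 * 5 ^ r := by ring
        _ ≤ 5 * (f (r + 1) * 4 ^ r) := by gcongr; exact ih (by omega)
        _ = 5 * f (r + 1) * 4 ^ r := by ring
        _ ≤ 4 * f (r + 1 + 1) * 4 ^ r := Nat.mul_le_mul_right _ (hfast (r + 1) hr).le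
        _ = f (r + 1 + 1) * 4 ^ (r + 1) := by ring
  exact (hpow R le_rfl).not_gt h

section Clustering

/-- `κ` sends every vertex to the centre of its cluster, where the clusters are disjoint stars
of `H`; only the stars centred in `W` may have more than one vertex. -/
structure IsStarClustering (H : SimpleGraph V) (W : Finset V) (κ : V → V) : Prop where
  adj_of_ne : ∀ v, κ v ≠ v → H.Adj v (κ v)
  map_map : ∀ v, κ (κ v) = κ v
  eq_of_notMem : ∀ v, κ v ∉ W → κ v = v

/-- `S` is a union of clusters, that is, of fibres of `κ`. -/
def IsSaturated (κ : V → V) (S : Finset V) : Prop :=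
  ∀ ⦃u v⦄, u ∈ S → κ v = κ u → v ∈ S

/-- The vertices that can be reached from `root` inside `S` through at most `r` clusters centred
in `W`, not counting the cluster of `root`; the remaining single vertices are passed for free. -/
inductive Reach (H : SimpleGraph V) (W : Finset V) (κ : V → V) (S : Finset V) (root : V) :
    ℕ → V → Prop
  | base {v : V} : κ v = κ root → Reach H W κ S root 0 v
  | succ {r : ℕ} {v : V} : Reach H W κ S root r v → Reach H W κ S root (r + 1) v
  | light {r : ℕ} {u v : V} : Reach H W κ S root r u → H.Adj u v → v ∈ S → κ v ∉ W →
      Reach H W κ S root r v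
  | heavy {r : ℕ} {u v w : V} : Reach H W κ S root r u → H.Adj u v → v ∈ S → κ w = κ v →
      Reach H W κ S root (r + 1) w

variable {H : SimpleGraph V} {W : Finset V} {κ : V → V} {S : Finset V} {root : V} {r : ℕ}

theorem IsStarClustering.eq_of_map_eq (hκ : IsStarClustering H W κ) {u v : V} (hv : κ v ∉ W)
    (h : κ u = κ v) : u = v := by
  rw [← hκ.eq_of_notMem v hv, ← h, hκ.eq_of_notMem u (h ▸ hv)]

theorem Reach.mem (hS : IsSaturated κ S) (hroot : root ∈ S) {v : V}
    (h : Reach H W κ S root r v) : v ∈ S := by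
  induction h with
  | base h => exact hS hroot h
  | succ _ ih => exact ih
  | light _ _ h _ _ => exact h
  | heavy _ _ hv h _ => exact hS hv h

theorem Reach.congr (hκ : IsStarClustering H W κ) {u v : V}
    (h : Reach H W κ S root r v) (huv : κ u = κ v) : Reach H W κ S root r u := by
  induction h with
  | base h => exact Reach.base (huv.trans h)
  | succ _ ih => exact Reach.succ (ih huv)
  | light hx hxv hvS hvW _ =>
    rw [hκ.eq_of_map_eq hvW huv]
    exact Reach.light hx hxv hvS hvW
  | heavy hx hxv hvS hwv _ => exact Reach.heavy hx hxv hvS (huv.trans hwv)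

open Classical in
/-- The vertices within distance `r` of `root`, in the sense of `Reach`. -/
noncomputable def ball (H : SimpleGraph V) (W : Finset V) (κ : V → V) (S : Finset V) (root : V)
    (r : ℕ) : Finset V :=
  S.filter (Reach H W κ S root r)

open Classical in
/-- The clusters of `S` outside `B` that have a neighbour in `B`. -/
noncomputable def frontier (H : SimpleGraph V) (κ : V → V) (S B : Finset V) : Finset V :=
  S.filter fun w => w ∉ B ∧ ∃ u ∈ B, ∃ v ∈ S, H.Adj u v ∧ κ w = κ v

theorem ball_subset : ball H W κ S root r ⊆ S := by
  classical exact filter_subset _ _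

theorem mem_ball (hS : IsSaturated κ S) (hroot : root ∈ S) {v : V} :
    v ∈ ball H W κ S root r ↔ Reach H W κ S root r v := by
  classical rw [ball, mem_filter, and_iff_right_iff_imp]
  exact fun h => h.mem hS hroot

theorem root_mem_ball (hS : IsSaturated κ S) (hroot : root ∈ S) : root ∈ ball H W κ S root r := by
  rw [mem_ball hS hroot]
  induction r with
  | zero => exact Reach.base rfl
  | succ r ih => exact Reach.succ ih

theorem isSaturated_ball (hκ : IsStarClustering H W κ) (hS : IsSaturated κ S) (hroot : root ∈ S) :
    IsSaturated κ (ball H W κ S root r) := by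
  intro u v hu huv
  rw [mem_ball hS hroot] at hu ⊢
  exact hu.congr hκ huv

theorem mem_frontier {B : Finset V} {w : V} : w ∈ frontier H κ S B ↔
    w ∈ S ∧ w ∉ B ∧ ∃ u ∈ B, ∃ v ∈ S, H.Adj u v ∧ κ w = κ v := by
  classical exact mem_filter

theorem disjoint_frontier {B : Finset V} : Disjoint B (frontier H κ S B) :=
  disjoint_left.2 fun _ hB hF => (mem_frontier.1 hF).2.1 hB

theorem isSaturated_frontier {B : Finset V} (hS : IsSaturated κ S) (hB : IsSaturated κ B) :
    IsSaturated κ (frontier H κ S B) := by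
  intro u v hu huv
  obtain ⟨huS, huB, x, hx, y, hy, hxy, huy⟩ := mem_frontier.1 hu
  exact mem_frontier.2 ⟨hS huS huv, fun hv => huB (hB hv huv.symm), x, hx, y, hy, hxy,
    huv.trans huy⟩

theorem map_mem_of_mem_frontier_ball (hκ : IsStarClustering H W κ) (hS : IsSaturated κ S)
    (hroot : root ∈ S) {w : V} (hw : w ∈ frontier H κ S (ball H W κ S root r)) : κ w ∈ W := by
  obtain ⟨hwS, hwB, u, hu, v, -, huv, hwv⟩ := mem_frontier.1 hw
  by_contra hwW
  have hvw : v = w := hκ.eq_of_map_eq hwW hwv.symm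
  subst hvw
  exact hwB <| (mem_ball hS hroot).2 <|
    Reach.light ((mem_ball hS hroot).1 hu) huv hwS hwW

variable [DecidableEq V]

theorem IsSaturated.sdiff {S T : Finset V} (hS : IsSaturated κ S) (hT : IsSaturated κ T) :
    IsSaturated κ (S \ T) := by
  intro u v hu huv
  rw [mem_sdiff] at hu ⊢
  exact ⟨hS hu.1 huv, fun hv => hu.2 (hT hv huv.symm)⟩

theorem ball_union_frontier_subset (hS : IsSaturated κ S) (hroot : root ∈ S) :
    ball H W κ S root r ∪ frontier H κ S (ball H W κ S root r) ⊆ ball H W κ S root (r + 1) := by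
  intro v hv
  rw [mem_ball hS hroot]
  rcases mem_union.1 hv with hv | hv
  · exact Reach.succ ((mem_ball hS hroot).1 hv)
  · obtain ⟨-, -, u, hu, x, hx, hux, hvx⟩ := mem_frontier.1 hv
    exact Reach.heavy ((mem_ball hS hroot).1 hu) hux hx hvx

variable {β : Finset V}

theorem IsStarClustering.exists_walk (hκ : IsStarClustering H W κ) (β : Finset V) {v w x : V}
    (p : H.Walk x v) (h : κ w = κ v) : ∃ q : H.Walk x w, cost β q ≤ cost β p + 2 := by
  obtain ⟨q, hq⟩ : ∃ q : H.Walk x (κ v), cost β q ≤ cost β p + 1 := by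
    by_cases hv : κ v = v
    · exact ⟨p.copy rfl hv.symm, by simp [cost]⟩
    · exact ⟨p.concat (hκ.adj_of_ne v hv), cost_concat_le β p _⟩
  by_cases hw : κ w = w
  · exact ⟨q.copy rfl (h.symm.trans hw), by
      rw [cost, SimpleGraph.Walk.support_copy, ← cost]; omega⟩
  · have hadj : H.Adj (κ v) w := (h ▸ hκ.adj_of_ne w hw).symm
    have := cost_concat_le β q hadj
    exact ⟨q.concat hadj, by omega⟩

theorem Reach.exists_walk (hκ : IsStarClustering H W κ) (hβ : ∀ v ∈ S, κ v ∉ W → v ∉ β) {v : V}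
    (h : Reach H W κ S root r v) : ∃ p : H.Walk root v, cost β p ≤ 3 * (r + 1) := by
  induction h with
  | base h =>
    have hnil : cost β (SimpleGraph.Walk.nil : H.Walk root root) ≤ 1 :=
      (card_le_card inter_subset_left).trans (by simp)
    obtain ⟨q, hq⟩ := hκ.exists_walk β SimpleGraph.Walk.nil h
    exact ⟨q, by omega⟩
  | succ _ ih =>
    obtain ⟨p, hp⟩ := ih
    exact ⟨p, by omega⟩
  | light _ hxv hvS hvW ih =>
    obtain ⟨p, hp⟩ := ih
    exact ⟨p.concat hxv, (cost_concat_of_notMem p hxv (hβ _ hvS hvW)).le.trans hp⟩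
  | heavy _ hxv _ hwv ih =>
    obtain ⟨p, hp⟩ := ih
    obtain ⟨q, hq⟩ := hκ.exists_walk β (p.concat hxv) hwv
    have := cost_concat_le β p hxv
    exact ⟨q, by omega⟩

theorem card_inter_union_of_disjoint {B D : Finset V} (h : Disjoint B D) (W : Finset V) :
    #((B ∪ D) ∩ W) = #(B ∩ W) + #(D ∩ W) := by
  rw [union_inter_distrib_right, card_union_of_disjoint]
  exact h.mono inter_subset_left inter_subset_left

theorem exists_small_frontier (hS : IsSaturated κ S) (hroot : root ∈ S) {R : ℕ}
    (hR : #W * 4 ^ R < 5 ^ R) : ∃ r ≤ R,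
      4 * #(frontier H κ S (ball H W κ S root r) ∩ W) ≤ #(ball H W κ S root r ∩ W) := by
  obtain ⟨r, hr, hslow⟩ := exists_slow_growth (f := fun r => #(ball H W κ S root r ∩ W))
    ((Nat.mul_le_mul_right _ (card_le_card inter_subset_right)).trans_lt hR)
  refine ⟨r, hr, ?_⟩
  have hunion := card_inter_union_of_disjoint
    (disjoint_frontier (H := H) (κ := κ) (S := S) (B := ball H W κ S root r)) W
  have hmono := card_le_card
    (inter_subset_inter_right (u := W)
      (ball_union_frontier_subset (H := H) (W := W) (r := r) hS hroot))
  omega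

variable [DecidableRel H.Adj]

omit [DecidableEq V] in
theorem two_mul_card_le_card_interedges_add_of_stars {X Z : Finset V}
    (hmem : ∀ z ∈ Z, κ z ∈ X) (hadj : ∀ z ∈ Z, κ z ≠ z → H.Adj z (κ z)) (hXZ : X ⊆ Z) :
    2 * #Z ≤ #(H.interedges Z Z) + 2 * #X := by
  classical
  have hleaf : ∀ v ∈ Z \ X, v ∈ Z ∧ v ∉ X ∧ κ v ∈ X ∧ H.Adj v (κ v) := by
    intro v hv
    obtain ⟨hvZ, hvX⟩ := mem_sdiff.1 hv
    exact ⟨hvZ, hvX, hmem v hvZ, hadj v hvZ fun h => hvX (h ▸ hmem v hvZ)⟩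
  have hout : (Z \ X).image (fun v => (v, κ v)) ⊆ H.interedges Z Z := by
    refine image_subset_iff.2 fun v hv => ?_
    obtain ⟨hvZ, -, hκX, h⟩ := hleaf v hv
    exact H.mk_mem_interedges_iff.2 ⟨hvZ, hXZ hκX, h⟩
  have hin : (Z \ X).image (fun v => (κ v, v)) ⊆ H.interedges Z Z := by
    refine image_subset_iff.2 fun v hv => ?_
    obtain ⟨hvZ, -, hκX, h⟩ := hleaf v hv
    exact H.mk_mem_interedges_iff.2 ⟨hXZ hκX, hvZ, h.symm⟩
  have hdisj : Disjoint ((Z \ X).image fun v => (v, κ v)) ((Z \ X).image fun v => (κ v, v)) := by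
    rw [disjoint_left]
    intro e he he'
    obtain ⟨v, hv, rfl⟩ := mem_image.1 he
    obtain ⟨u, hu, h⟩ := mem_image.1 he'
    exact (hleaf v hv).2.1 ((Prod.mk.inj h).1 ▸ (hleaf u hu).2.2.1)
  have hcard := card_le_card (union_subset hout hin)
  rw [card_union_of_disjoint hdisj, card_image_of_injective _ fun _ _ h => (Prod.mk.inj h).1,
    card_image_of_injective _ fun _ _ h => (Prod.mk.inj h).2, card_sdiff_of_subset hXZ] at hcard
  have := card_le_card hXZ
  omega

theorem interedges_sdiff_eq_interedges_frontier {B : Finset V} :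
    H.interedges B (S \ B) = H.interedges B (frontier H κ S B) := by
  ext ⟨u, v⟩
  simp only [SimpleGraph.mk_mem_interedges_iff, mem_sdiff, mem_frontier]
  constructor
  · rintro ⟨hu, ⟨hvS, hvB⟩, h⟩
    exact ⟨hu, ⟨hvS, hvB, u, hu, v, hvS, h, rfl⟩, h⟩
  · rintro ⟨hu, ⟨hvS, hvB, -⟩, h⟩
    exact ⟨hu, ⟨hvS, hvB⟩, h⟩

/-- The ball and its frontier span at most a tree whereas the frontier is spanned by stars, so few
edges are lost together with the ball, and what remains is at least as dense as before. -/
theorem density_sdiff_of_small_frontier {B : Finset V} (hBS : B ⊆ S) (hB : IsSaturated κ B)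
    (hS : IsSaturated κ S) (hκ : IsStarClustering H W κ)
    (hW : ∀ w ∈ frontier H κ S B, κ w ∈ W)
    (hsmall : 4 * #(frontier H κ S B ∩ W) ≤ #(B ∩ W))
    (htree : #(H.interedges (B ∪ frontier H κ S B) (B ∪ frontier H κ S B)) + 2 ≤
      2 * #(B ∪ frontier H κ S B))
    (hdense : 4 * #S + #(S ∩ W) ≤ 2 * #(H.interedges S S)) :
    4 * #(S \ B) + #((S \ B) ∩ W) < 2 * #(H.interedges (S \ B) (S \ B)) := by
  have hD := isSaturated_frontier (H := H) hS hB
  have hstars : 2 * #(frontier H κ S B) ≤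
      #(H.interedges (frontier H κ S B) (frontier H κ S B)) + 2 * #(frontier H κ S B ∩ W) :=
    two_mul_card_le_card_interedges_add_of_stars
      (fun z hz => mem_inter.2 ⟨hD hz (hκ.map_map z), hW z hz⟩) (fun z _ => hκ.adj_of_ne z)
      inter_subset_left
  have hSB : B ∪ S \ B = S := union_sdiff_of_subset hBS
  have hedges := card_interedges_union_self H (disjoint_sdiff (s := B) (t := S))
  rw [hSB, interedges_sdiff_eq_interedges_frontier (κ := κ)] at hedges
  have hedges' := card_interedges_union_self H
    (disjoint_frontier (H := H) (κ := κ) (S := S) (B := B))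
  have hcard := card_union_of_disjoint (disjoint_frontier (H := H) (κ := κ) (S := S) (B := B))
  have hcard' := card_sdiff_add_card_eq_card hBS
  have hcardW := card_inter_union_of_disjoint (disjoint_sdiff (s := B) (t := S)) W
  rw [hSB] at hcardW
  omega

/-- Region growing: around any root some ball has a small frontier. If there were no cheap cycle,
the ball could be removed without loss of density, and nothing would be left in the end. -/
theorem exists_cheap_cycle_of_dense (hκ : IsStarClustering H W κ) {R : ℕ}
    (hR : #W * 4 ^ R < 5 ^ R) (hβ : ∀ v ∈ S, κ v ∉ W → v ∉ β) (hne : S.Nonempty)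
    (hS : IsSaturated κ S) (hdense : 4 * #S + #(S ∩ W) ≤ 2 * #(H.interedges S S)) :
    ∃ u, ∃ c : H.Walk u u, c.IsCycle ∧ cost β c ≤ 6 * (R + 2) + 1 := by
  by_contra! hno
  induction S using Finset.strongInduction with
  | H S ih =>
  obtain ⟨root, hroot⟩ := hne
  obtain ⟨r, hrR, hsmall⟩ := exists_small_frontier (H := H) hS hroot hR
  have htree := card_interedges_add_two_le_of_cost_le (H := H) (β := β) (D := 3 * (R + 2))
    (fun u c hc => by have := hno u c hc; omega)
    (mem_union_left (frontier H κ S (ball H W κ S root r)) (root_mem_ball hS hroot))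
    (fun v hv => by
      obtain ⟨p, hp⟩ := ((mem_ball hS hroot).1
        (ball_union_frontier_subset hS hroot hv)).exists_walk hκ hβ
      exact ⟨p, by omega⟩)
  have hdense' := density_sdiff_of_small_frontier ball_subset (isSaturated_ball hκ hS hroot) hS hκ
    (fun w hw => map_mem_of_mem_frontier_ball hκ hS hroot hw) hsmall htree hdense
  have hlt : S \ ball H W κ S root r ⊂ S :=
    sdiff_ssubset ball_subset ⟨root, root_mem_ball hS hroot⟩
  refine ih _ hlt (fun v hv => hβ v (mem_sdiff.1 hv).1) ?_
    (hS.sdiff (isSaturated_ball hκ hS hroot)) hdense'.le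
  rw [nonempty_iff_ne_empty]
  intro hempty
  simp [hempty] at hdense'

end Clustering

/-! ### Graphs dismantled by deleting stars and vertices of degree at most one -/

theorem exists_eq_of_le_add_one {f : ℕ → ℕ} {m N : ℕ} (h0 : f 0 ≤ m)
    (hstep : ∀ i, f (i + 1) ≤ f i + 1) (hN : m ≤ f N) : ∃ i, f i = m := by
  induction N with
  | zero => exact ⟨0, h0.antisymm hN⟩
  | succ N ih =>
    by_cases h : m ≤ f N
    · exact ih h
    · have := hstep N
      exact ⟨N + 1, by omega⟩

theorem exists_card_filter_lt_eq {S : Finset V} {τ : V → ℕ} (hτ : Set.InjOn τ S) {m : ℕ}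
    (hm : m ≤ #S) : ∃ T, #{v ∈ S | τ v < T} = m := by
  classical
  refine exists_eq_of_le_add_one (N := S.sup τ + 1) (by simp) (fun T => ?_) ?_
  · have hone : #{v ∈ S | τ v = T} ≤ 1 := by
      rw [card_le_one]
      intro a ha b hb
      rw [mem_filter] at ha hb
      exact hτ ha.1 hb.1 (ha.2.trans hb.2.symm)
    have hsub : {v ∈ S | τ v < T + 1} ⊆ {v ∈ S | τ v < T} ∪ {v ∈ S | τ v = T} := by
      intro v hv
      simp only [mem_union, mem_filter] at hv ⊢
      grind
    have := (card_le_card hsub).trans (card_union_le _ _)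
    omega
  · rw [filter_true_of_mem fun v hv => Nat.lt_succ_of_le (le_sup (f := τ) hv)]
    exact hm

section Elimination

variable {H : SimpleGraph V} {A F S W X Z β : Finset V} {κ : V → V} {τ : V → ℕ}

theorem IsStarClustering.mono (hκ : IsStarClustering H X κ) (hXW : X ⊆ W) :
    IsStarClustering H W κ where
  adj_of_ne := hκ.adj_of_ne
  map_map := hκ.map_map
  eq_of_notMem v hv := hκ.eq_of_notMem v fun h => hv (hXW h)

theorem exists_isStarClustering (hstar : ∀ z ∈ Z, ∃ x ∈ X, z = x ∨ H.Adj z x) :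
    ∃ κ, IsStarClustering H X κ ∧ (∀ z ∈ Z, κ z ∈ X) ∧ ∀ v ∉ Z, κ v = v := by
  classical
  choose! g hgX hg using hstar
  let κ : V → V := fun v => if v ∈ Z ∧ v ∉ X then g v else v
  have hκX : ∀ x ∈ X, κ x = x := fun x hx => if_neg fun h => h.2 hx
  have hκn : ∀ v ∉ Z, κ v = v := fun v hv => if_neg fun h => hv h.1
  have hκZ : ∀ z ∈ Z, κ z ∈ X := by
    intro z hz
    by_cases hx : z ∈ X
    · exact (hκX z hx).symm ▸ hx
    · rw [show κ z = g z from if_pos ⟨hz, hx⟩]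
      exact hgX z hz
  refine ⟨κ, ⟨fun v hv => ?_, fun v => ?_, fun v hv => hκn v fun h => hv (hκZ v h)⟩, hκZ, hκn⟩
  · by_cases h : v ∈ Z ∧ v ∉ X
    · have hκv : κ v = g v := if_pos h
      rw [hκv] at hv ⊢
      exact (hg v h.1).resolve_left (Ne.symm hv)
    · exact absurd (if_neg h) hv
  · by_cases hz : v ∈ Z
    · exact hκX _ (hκZ v hz)
    · rw [hκn v hz, hκn v hz]

theorem isSaturated_of_subset (hXZ : X ⊆ Z) (hκZ : ∀ z ∈ Z, κ z ∈ X) (hκn : ∀ v ∉ Z, κ v = v)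
    (hZS : Z ⊆ S) : IsSaturated κ S := by
  intro u v hu huv
  by_cases hv : v ∈ Z
  · exact hZS hv
  · rw [hκn v hv] at huv
    by_cases hu' : u ∈ Z
    · exact absurd (hXZ (huv ▸ hκZ u hu')) hv
    · rwa [huv, hκn u hu']

variable [DecidableRel H.Adj]

theorem card_interedges_eq_sum (S T : Finset V) :
    #(H.interedges S T) = ∑ u ∈ S, #{v ∈ T | H.Adj u v} := by
  simp only [SimpleGraph.interedges_def, card_filter, sum_product]

theorem two_mul_sum_card_lt_le_card_interedges (F : Finset V) (τ : V → ℕ) :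
    2 * ∑ f ∈ F, #{u ∈ F | H.Adj f u ∧ τ u < τ f} ≤ #(H.interedges F F) := by
  have hswap : ∑ f ∈ F, #{u ∈ F | H.Adj f u ∧ τ u < τ f} =
      ∑ f ∈ F, #{u ∈ F | H.Adj f u ∧ τ f < τ u} := by
    simp only [card_filter]
    rw [sum_comm]
    simp only [H.adj_comm]
  rw [two_mul]
  nth_rewrite 2 [hswap]
  rw [← sum_add_distrib, card_interedges_eq_sum]
  refine sum_le_sum fun f _ => ?_
  classical
  rw [← card_union_of_disjoint]
  · refine card_le_card fun u hu => ?_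
    simp only [mem_union, mem_filter] at hu ⊢
    tauto
  · rw [disjoint_left]
    intro u hu hu'
    simp only [mem_filter] at hu hu'
    omega

theorem two_mul_card_add_card_le_card_interedges (hβA : β ⊆ A)
    (hdeg : ∀ v ∈ A, 2 ≤ #{u ∈ A | H.Adj v u}) (hβ : ∀ v ∈ β, 3 ≤ #{u ∈ A | H.Adj v u}) :
    2 * #A + #β ≤ #(H.interedges A A) := by
  classical
  rw [card_interedges_eq_sum, ← inter_eq_right.2 hβA, ← filter_mem_eq_inter, card_filter, mul_comm,
    ← smul_eq_mul, ← sum_const, ← sum_add_distrib]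
  refine sum_le_sum fun v hv => ?_
  split_ifs with h
  · exact hβ v h
  · exact hdeg v hv

variable [DecidableEq V]

theorem exists_cheap_cycle_of_card_lt (hne : A.Nonempty) (hβA : β ⊆ A)
    (hdeg : ∀ v ∈ A, 2 ≤ #{u ∈ A | H.Adj v u}) (hβ : ∀ v ∈ β, 3 ≤ #{u ∈ A | H.Adj v u}) {R : ℕ}
    (hR : #β * 4 ^ R < 5 ^ R) :
    ∃ u, ∃ c : H.Walk u u, c.IsCycle ∧ cost β c ≤ 6 * (R + 2) + 1 := by
  refine exists_cheap_cycle_of_dense (W := β) (κ := id)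
    ⟨fun v h => absurd rfl h, fun _ => rfl, fun _ _ => rfl⟩ hR (fun _ _ h => h) hne
    (fun u v hu huv => (show v = u from huv) ▸ hu) ?_
  have := two_mul_card_add_card_le_card_interedges hβA hdeg hβ
  have := card_le_card (inter_subset_right (s₁ := A) (s₂ := β))
  omega

theorem exists_cheap_cycle_of_stars (hX : X.Nonempty) (hXZ : X ⊆ Z)
    (hstar : ∀ z ∈ Z, ∃ x ∈ X, z = x ∨ H.Adj z x) (hFβ : #(F ∩ β) ≤ 3 * #X)
    {R : ℕ} (hR : 4 * #X * 4 ^ R < 5 ^ R)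
    (hdense : 4 * #(F ∪ Z) + #X + #(F ∩ β) ≤ 2 * #(H.interedges (F ∪ Z) (F ∪ Z))) :
    ∃ u, ∃ c : H.Walk u u, c.IsCycle ∧ cost β c ≤ 6 * (R + 2) + 1 := by
  obtain ⟨κ, hκ, hκZ, hκn⟩ := exists_isStarClustering hstar
  have hcard : #(X ∪ F ∩ β) ≤ #X + #(F ∩ β) := card_union_le _ _
  refine exists_cheap_cycle_of_dense (hκ.mono (subset_union_left (s₂ := F ∩ β)))
    ((Nat.mul_le_mul_right _ (by omega)).trans_lt hR) (S := F ∪ Z) ?_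
    ((hX.mono hXZ).mono subset_union_right)
    (isSaturated_of_subset hXZ hκZ hκn subset_union_right) ?_
  · intro v hv hκv hvβ
    have hvZ : v ∉ Z := fun h => hκv (mem_union_left _ (hκZ v h))
    rw [hκn v hvZ] at hκv
    exact hκv (mem_union_right _ (mem_inter.2 ⟨(mem_union.1 hv).resolve_right hvZ, hvβ⟩))
  · have := card_le_card (inter_subset_right (s₁ := F ∪ Z) (s₂ := X ∪ F ∩ β))
    omega

theorem dense_union_of_stars (hXZ : X ⊆ Z) (hstar : ∀ z ∈ Z, ∃ x ∈ X, z = x ∨ H.Adj z x)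
    (hFZ : Disjoint F Z) (hFβ : 3 * #X ≤ #(F ∩ β))
    (hdeg : ∀ f ∈ F, (1 + if f ∈ β then 1 else 0) ≤
      #{u ∈ F | H.Adj f u ∧ τ u < τ f} + #{u ∈ Z | H.Adj f u}) :
    4 * #(F ∪ Z) + #X + #(F ∩ β) ≤ 2 * #(H.interedges (F ∪ Z) (F ∪ Z)) := by
  obtain ⟨κ, hκ, hκZ, -⟩ := exists_isStarClustering hstar
  have hedgesZ := two_mul_card_le_card_interedges_add_of_stars hκZ (fun z _ => hκ.adj_of_ne z) hXZ
  have hedgesF := two_mul_sum_card_lt_le_card_interedges (H := H) F τ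
  have hsum := sum_le_sum hdeg
  rw [sum_add_distrib, sum_add_distrib, ← card_filter, filter_mem_eq_inter, sum_const, smul_eq_mul,
    mul_one, ← card_interedges_eq_sum] at hsum
  have := card_interedges_union_self H hFZ
  have := card_union_of_disjoint hFZ
  omega

theorem le_card_earlier_add_card_of_degenerate {f : V} {T : ℕ} (hfT : τ f < T)
    (hdegen : #{u ∈ A | H.Adj f u ∧ τ f ≤ τ u} ≤ 1) :
    #{u ∈ A | H.Adj f u} ≤
      1 + (#{u ∈ A \ Z | τ u < T ∧ H.Adj f u ∧ τ u < τ f} + #{u ∈ Z | H.Adj f u}) := by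
  have hsub : {u ∈ A | H.Adj f u} ⊆ {u ∈ A | H.Adj f u ∧ τ f ≤ τ u} ∪
      ({u ∈ A \ Z | τ u < T ∧ H.Adj f u ∧ τ u < τ f} ∪ {u ∈ Z | H.Adj f u}) := by
    intro u hu
    simp only [mem_union, mem_filter, mem_sdiff] at hu ⊢
    grind
  have := (card_le_card hsub).trans (card_union_le _ _)
  have := card_union_le {u ∈ A \ Z | τ u < T ∧ H.Adj f u ∧ τ u < τ f} {u ∈ Z | H.Adj f u}
  omega

/-- Besides the stars, region growing is applied only to the vertices outside `Z` deleted before a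
suitable time `T`, chosen such that the number of branch vertices among them is comparable to the
number of stars. -/
theorem exists_cheap_cycle_of_elimination (hX : X.Nonempty) (hβA : β ⊆ A)
    (hdeg : ∀ v ∈ A, 2 ≤ #{u ∈ A | H.Adj v u}) (hβ : ∀ v ∈ β, 3 ≤ #{u ∈ A | H.Adj v u})
    (hXZ : X ⊆ Z) (hZA : Z ⊆ A) (hstar : ∀ z ∈ Z, ∃ x ∈ X, z = x ∨ H.Adj z x)
    (hdegen : ∀ v ∈ A \ Z, #{u ∈ A | H.Adj v u ∧ τ v ≤ τ u} ≤ 1)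
    (hτ : Set.InjOn τ (A \ Z : Finset V)) {R : ℕ} (hR : 4 * #X * 4 ^ R < 5 ^ R) :
    ∃ u, ∃ c : H.Walk u u, c.IsCycle ∧ cost β c ≤ 6 * (R + 2) + 1 := by
  by_cases hβX : #β < #X
  · exact exists_cheap_cycle_of_card_lt (hX.mono (hXZ.trans hZA)) hβA hdeg hβ
      ((Nat.mul_le_mul_right _ (by omega)).trans_lt hR)
  by_cases hfew : #((A \ Z) ∩ β) < 3 * #X
  · refine exists_cheap_cycle_of_stars hX hXZ hstar hfew.le hR ?_
    rw [sdiff_union_of_subset hZA]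
    have := two_mul_card_add_card_le_card_interedges hβA hdeg hβ
    have := card_le_card (inter_subset_right (s₁ := A \ Z) (s₂ := β))
    omega
  obtain ⟨T, hT⟩ :=
    exists_card_filter_lt_eq (hτ.mono (inter_subset_left (s₂ := β))) (not_lt.1 hfew)
  rw [← filter_inter] at hT
  refine exists_cheap_cycle_of_stars hX hXZ hstar hT.le hR (dense_union_of_stars (τ := τ) hXZ hstar
    (sdiff_disjoint.mono_left (filter_subset _ _)) hT.ge ?_)
  intro f hf
  obtain ⟨hfAZ, hfT⟩ := mem_filter.1 hf
  have hle := le_card_earlier_add_card_of_degenerate (Z := Z) hfT (hdegen f hfAZ)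
  rw [filter_filter]
  have := hdeg f (mem_sdiff.1 hfAZ).1
  have := hβ f
  split_ifs with hfβ <;> grind

end Elimination

section Alive

/-- The subgraph of `G` on the vertices that are deleted at time `i` or later, where `τ v` is the
time at which `v` is deleted. The vertices deleted earlier are kept as isolated vertices. -/
def aliveGraph (G : SimpleGraph V) (τ : V → ℕ) (i : ℕ) : SimpleGraph V where
  Adj u v := G.Adj u v ∧ i ≤ τ u ∧ i ≤ τ v
  symm := ⟨fun _ _ h => ⟨h.1.symm, h.2.2, h.2.1⟩⟩
  loopless := ⟨fun _ h => h.1.ne rfl⟩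

variable {G : SimpleGraph V} {τ : V → ℕ} {i : ℕ} {u v : V}

theorem aliveGraph_adj : (aliveGraph G τ i).Adj u v ↔ G.Adj u v ∧ i ≤ τ u ∧ i ≤ τ v := Iff.rfl

instance [DecidableRel G.Adj] : DecidableRel (aliveGraph G τ i).Adj :=
  fun _ _ => inferInstanceAs (Decidable (_ ∧ _))

variable [Fintype V]

/-- The vertices that are deleted at time `i` or later. -/
def alive (τ : V → ℕ) (i : ℕ) : Finset V := {v | i ≤ τ v}

theorem mem_alive : v ∈ alive τ i ↔ i ≤ τ v := by simp [alive]

variable (G) [DecidableRel G.Adj]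

/-- The neighbours of `v` that are deleted at time `i` or later. -/
def aliveNbrs (τ : V → ℕ) (i : ℕ) (v : V) : Finset V := {u | G.Adj v u ∧ i ≤ τ u}

/-- The branch vertices at time `i`: the vertices deleted at time `i` or later that have degree at
least three in the subgraph they induce. -/
def aliveBranch (τ : V → ℕ) (i : ℕ) : Finset V := {v | i ≤ τ v ∧ 3 ≤ #(aliveNbrs G τ i v)}

variable {G}

theorem mem_aliveNbrs : u ∈ aliveNbrs G τ i v ↔ G.Adj v u ∧ i ≤ τ u := by simp [aliveNbrs]

theorem mem_aliveBranch : v ∈ aliveBranch G τ i ↔ i ≤ τ v ∧ 3 ≤ #(aliveNbrs G τ i v) := by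
  simp [aliveBranch]

theorem aliveBranch_subset : aliveBranch G τ i ⊆ alive τ i :=
  fun _ hv => mem_alive.2 (mem_aliveBranch.1 hv).1

theorem filter_aliveGraph (hv : i ≤ τ v) :
    {u ∈ alive τ i | (aliveGraph G τ i).Adj v u} = aliveNbrs G τ i v := by
  ext u
  simp only [mem_filter, mem_alive, aliveGraph_adj, mem_aliveNbrs]
  tauto

theorem two_le_degree_aliveGraph (hdeg : ∀ v, i ≤ τ v → 2 ≤ #(aliveNbrs G τ i v)) :
    ∀ v ∈ alive τ i, 2 ≤ #{u ∈ alive τ i | (aliveGraph G τ i).Adj v u} := by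
  intro v hv
  rw [mem_alive] at hv
  rw [filter_aliveGraph hv]
  exact hdeg v hv

theorem three_le_degree_aliveGraph : ∀ v ∈ aliveBranch G τ i,
    3 ≤ #{u ∈ alive τ i | (aliveGraph G τ i).Adj v u} := by
  intro v hv
  rw [mem_aliveBranch] at hv
  rw [filter_aliveGraph hv.1]
  exact hv.2

theorem exists_isCycle_of_two_le_degree (hv : i ≤ τ v)
    (hdeg : ∀ v, i ≤ τ v → 2 ≤ #(aliveNbrs G τ i v)) :
    ∃ u, ∃ c : (aliveGraph G τ i).Walk u u, c.IsCycle := by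
  classical
  obtain ⟨u, c, hc, -⟩ := exists_cheap_cycle_of_card_lt (β := ∅) (R := 0) ⟨v, mem_alive.2 hv⟩
    (empty_subset _) (two_le_degree_aliveGraph hdeg) (by simp) (by simp)
  exact ⟨u, c, hc⟩

variable (G)

/-- The deletion times `τ` come from deleting, one after the other, vertices of degree at most one
(those outside `Z`) and closed neighbourhoods of sets of centres (collected in `X`); the latter
happens only when the minimum degree is two, and uses no more centres than there are vertices of
degree at least three, plus one, on any remaining cycle. -/
structure IsDismantling [DecidableEq V] (τ : V → ℕ) (X Z : Finset V) : Prop where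
  subset : X ⊆ Z
  star : ∀ z ∈ Z, ∃ x ∈ X, τ x = τ z ∧ (z = x ∨ G.Adj z x)
  degen : ∀ v ∉ Z, #(aliveNbrs G τ (τ v) v) ≤ 1
  inj : ∀ u ∉ Z, ∀ v ∉ Z, τ u = τ v → u = v
  degree : ∀ x ∈ X, ∀ v, τ x ≤ τ v → 2 ≤ #(aliveNbrs G τ (τ x) v)
  short : ∀ x ∈ X, ∀ u, ∀ c : (aliveGraph G τ (τ x)).Walk u u, c.IsCycle →
    #{y ∈ X | τ y = τ x} ≤ cost (aliveBranch G τ (τ x)) c + 1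

variable {G} [DecidableEq V] {X Z : Finset V}

theorem IsDismantling.exists_cheap_cycle (h : IsDismantling G τ X Z) {R : ℕ}
    (hR : 4 * #X * 4 ^ R < 5 ^ R) {x : V} (hx : x ∈ X) :
    ∃ u, ∃ c : (aliveGraph G τ (τ x)).Walk u u, c.IsCycle ∧
      cost (aliveBranch G τ (τ x)) c ≤ 6 * (R + 2) + 1 := by
  have hnot : ∀ v ∈ alive τ (τ x) \ {z ∈ Z | τ x ≤ τ z}, v ∉ Z := by
    intro v hv hvZ
    rw [mem_sdiff, mem_alive] at hv
    exact hv.2 (mem_filter.2 ⟨hvZ, hv.1⟩)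
  refine exists_cheap_cycle_of_elimination (X := {y ∈ X | τ x ≤ τ y}) (τ := τ)
    (Z := {z ∈ Z | τ x ≤ τ z}) ⟨x, mem_filter.2 ⟨hx, le_rfl⟩⟩ aliveBranch_subset
    (two_le_degree_aliveGraph (h.degree x hx)) three_le_degree_aliveGraph
    (filter_subset_filter _ h.subset) (fun v hv => mem_alive.2 (mem_filter.1 hv).2)
    (fun z hz => ?_) (fun v hv => ?_) (fun u hu v hv => h.inj u (hnot u hu) v (hnot v hv))
    ((Nat.mul_le_mul_right _ (Nat.mul_le_mul_left _ (card_le_card (filter_subset _ _)))).trans_lt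
      hR)
  · obtain ⟨hzZ, hxz⟩ := mem_filter.1 hz
    obtain ⟨y, hy, hyz, hadj⟩ := h.star z hzZ
    exact ⟨y, mem_filter.2 ⟨hy, hyz ▸ hxz⟩, hadj.imp_right fun ha => ⟨ha, hxz, hyz ▸ hxz⟩⟩
  · refine (card_le_card fun u hu => ?_).trans (h.degen v (hnot v hv))
    simp only [mem_filter, aliveGraph_adj] at hu
    exact mem_aliveNbrs.2 ⟨hu.2.1.1, hu.2.2⟩

theorem IsDismantling.card_le (h : IsDismantling G τ X Z) {R : ℕ}
    (hR : 4 * #X * 4 ^ R < 5 ^ R) : #X ≤ (6 * (R + 2) + 2) * #(X.image τ) := by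
  refine card_le_mul_card_image X _ fun i hi => ?_
  obtain ⟨x, hx, rfl⟩ := mem_image.1 hi
  obtain ⟨u, c, hc, hcost⟩ := h.exists_cheap_cycle hR hx
  have := h.short x hx u c hc
  omega

theorem mul_four_pow_lt_five_pow (m : ℕ) :
    m * 4 ^ (4 * (Nat.log 2 m + 1)) < 5 ^ (4 * (Nat.log 2 m + 1)) := by
  set a := Nat.log 2 m + 1
  calc m * 4 ^ (4 * a) < 2 ^ a * 4 ^ (4 * a) :=
        Nat.mul_lt_mul_of_pos_right (Nat.lt_pow_succ_log_self (by norm_num) _) (by positivity)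
    _ = 512 ^ a := by rw [pow_mul, ← mul_pow]; norm_num
    _ ≤ 625 ^ a := Nat.pow_le_pow_left (by norm_num) _
    _ = 5 ^ (4 * a) := by rw [pow_mul]; norm_num

theorem natLog_mul_log_two_le (m : ℕ) : Nat.log 2 m * Real.log 2 ≤ Real.log m := by
  rcases m.eq_zero_or_pos with rfl | hm
  · simp
  · rw [← Real.log_pow]
    exact Real.log_le_log (by positivity) (by exact_mod_cast Nat.pow_log_le_self 2 hm.ne')

theorem log_four_mul_le {x k : ℝ} (hx : 0 < x) (hk : 0 < k) :
    Real.log (4 * x) ≤ 72 + Real.log k + x / k / 70 := by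
  have hxk : 4 * x = 4 * (70 * (k * (x / k / 70))) := by field_simp
  rw [hxk, Real.log_mul (by norm_num) (by positivity), Real.log_mul (by norm_num) (by positivity),
    Real.log_mul hk.ne' (by positivity)]
  have := Real.log_le_sub_one_of_pos (show (0 : ℝ) < 4 by norm_num)
  have := Real.log_le_sub_one_of_pos (show (0 : ℝ) < 70 by norm_num)
  have := Real.log_le_sub_one_of_pos (show 0 < x / k / 70 by positivity)
  linarith

/-- Resolves a bound of the form `m ≤ O(k log m)`. The term linear in `m / k` that bounds `log m`
has a coefficient below `1 / 35`, so that it can be absorbed by the left-hand side. -/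
theorem le_mul_log_of_le_mul_natLog {m k : ℕ} (hk : 0 < k)
    (h : m ≤ (24 * Nat.log 2 (4 * m) + 38) * k) : (m : ℝ) ≤ 11000 * k * Real.log (k + 1) := by
  have hkR : (1 : ℝ) ≤ k := by exact_mod_cast hk
  have hlog2k : Real.log 2 ≤ Real.log (k + 1) := Real.log_le_log (by norm_num) (by linarith)
  have hlogk : Real.log k ≤ Real.log (k + 1) := Real.log_le_log (by linarith) (by linarith)
  have hlog2 := Real.log_two_gt_d9
  rcases m.eq_zero_or_pos with rfl | hm
  · rw [Nat.cast_zero]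
    exact mul_nonneg (by positivity) (by linarith)
  have hquot : (m : ℝ) / k ≤ 24 * Nat.log 2 (4 * m) + 38 := by
    rw [div_le_iff₀ (by linarith)]
    exact_mod_cast h
  have hlog : 24 * (Nat.log 2 (4 * m) : ℝ) ≤ 35 * Real.log (4 * m) := by
    have := natLog_mul_log_two_le (4 * m)
    push_cast at this
    nlinarith [(Nat.log 2 (4 * m)).cast_nonneg (α := ℝ)]
  have := log_four_mul_le (x := m) (k := k) (by exact_mod_cast hm) (by linarith)
  have hfinal : (m : ℝ) / k ≤ 11000 * Real.log (k + 1) := by linarith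
  calc (m : ℝ) = m / k * k := by field_simp
    _ ≤ 11000 * Real.log (k + 1) * k := by gcongr
    _ = 11000 * k * Real.log (k + 1) := by ring

theorem IsDismantling.card_le_mul_log (h : IsDismantling G τ X Z) {k : ℕ} (hk : 0 < k)
    (hXk : #(X.image τ) ≤ k) : (#X : ℝ) ≤ 11000 * k * Real.log (k + 1) := by
  refine le_mul_log_of_le_mul_natLog hk ?_
  refine (h.card_le (mul_four_pow_lt_five_pow (4 * #X))).trans (Nat.mul_le_mul ?_ hXk)
  omega

end Alive

/-! ### Tree-decompositions of dismantled graphs -/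

section ParentGraph

variable {ι : Type*}

/-- The graph joining every element to its parent; elements that are their own parents are roots. -/
def parentGraph (par : ι → ι) : SimpleGraph ι where
  Adj a b := a ≠ b ∧ (par a = b ∨ par b = a)
  symm := ⟨fun _ _ h => ⟨h.1.symm, h.2.symm⟩⟩
  loopless := ⟨fun _ h => h.1 rfl⟩

theorem parentGraph_adj {par : ι → ι} {a b : ι} :
    (parentGraph par).Adj a b ↔ a ≠ b ∧ (par a = b ∨ par b = a) := Iff.rfl

variable [Finite ι] {par : ι → ι} {root : ι} {ρ : ι → ℕ}

theorem connected_parentGraph (h : ∀ a, a ≠ root → ρ a < ρ (par a)) :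
    (parentGraph par).Connected := by
  obtain ⟨N, hN⟩ := (Set.finite_range ρ).bddAbove
  have hreach : ∀ d a, N - ρ a = d → (parentGraph par).Reachable a root := by
    intro d
    induction d using Nat.strong_induction_on with
    | _ d ih =>
    rintro a rfl
    by_cases ha : a = root
    · rw [ha]
    · have hlt := h a ha
      have hle : ρ (par a) ≤ N := hN ⟨par a, rfl⟩
      have hadj : (parentGraph par).Adj a (par a) := ⟨fun e => hlt.ne (congrArg ρ e), Or.inl rfl⟩
      exact hadj.reachable.trans (ih _ (by omega) _ rfl)
  have : Nonempty ι := ⟨root⟩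
  exact ⟨fun a b => (hreach _ a rfl).trans (hreach _ b rfl).symm⟩

theorem card_edgeSet_parentGraph_lt (hroot : par root = root) :
    Nat.card (parentGraph par).edgeSet < Nat.card ι := by
  have hsub : (parentGraph par).edgeSet ⊆ (fun a => s(a, par a)) '' {root}ᶜ := by
    intro e he
    induction e using Sym2.ind with
    | _ x y =>
    obtain ⟨hne, hxy | hyx⟩ := (SimpleGraph.mem_edgeSet _).1 he
    · exact ⟨x, fun hx => hne (by rw [← hxy, hx, hroot]), by simp only [hxy]⟩
    · exact ⟨y, fun hy => hne (by rw [← hyx, hy, hroot]), by simp only [hyx, Sym2.eq_swap]⟩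
  calc Nat.card (parentGraph par).edgeSet = (parentGraph par).edgeSet.ncard := rfl
    _ ≤ ((fun a => s(a, par a)) '' {root}ᶜ).ncard := Set.ncard_le_ncard hsub (Set.toFinite _)
    _ ≤ ({root}ᶜ : Set ι).ncard := Set.ncard_image_le (Set.toFinite _)
    _ < Nat.card ι := by
      have := Set.ncard_add_ncard_compl ({root} : Set ι)
      rw [Set.ncard_singleton] at this
      omega

theorem isTree_parentGraph (hroot : par root = root) (h : ∀ a, a ≠ root → ρ a < ρ (par a)) :
    (parentGraph par).IsTree :=
  SimpleGraph.isTree_iff_connected_and_card.2 ⟨connected_parentGraph h, le_antisymm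
    (card_edgeSet_parentGraph_lt hroot)
    (connected_parentGraph h).card_vert_le_card_edgeSet_add_one⟩

end ParentGraph

theorem connected_induce_of_forall_adj {ι : Type*} {T : SimpleGraph ι} {s : Set ι} {c : ι}
    (hc : c ∈ s) (h : ∀ a ∈ s, a = c ∨ T.Adj a c) : (T.induce s).Connected := by
  have hreach : ∀ a : s, (T.induce s).Reachable a ⟨c, hc⟩ := by
    rintro ⟨a, ha⟩
    rcases h a ha with rfl | hac
    · rfl
    · exact SimpleGraph.Adj.reachable (show (T.induce s).Adj ⟨a, ha⟩ ⟨c, hc⟩ from hac)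
  have : Nonempty s := ⟨⟨c, hc⟩⟩
  exact ⟨fun a b => (hreach a).trans (hreach b).symm⟩

section Independence

variable {G : SimpleGraph V} {t : ℕ} {x : V} {s : Finset V}

theorem isIndContained_of_isIndepSet_of_adj (hs : G.IsIndepSet s) (hx : ∀ v ∈ s, G.Adj v x) :
    (completeBipartiteGraph (Fin 1) (Fin #s)).IsIndContained G := by
  let e := s.equivFin.symm
  have he : ∀ i, (e i : V) ∈ s := fun i => (e i).2
  have hne : ∀ i, x ≠ (e i : V) := fun i => (hx _ (he i)).ne'
  refine ⟨⟨⟨Sum.elim (fun _ => x) fun i => (e i : V), ?_⟩, ?_⟩⟩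
  · rintro (i | i) (j | j) hij
    · rw [Subsingleton.elim i j]
    · exact absurd hij (hne j)
    · exact absurd hij.symm (hne i)
    · rw [e.injective (Subtype.ext hij)]
  · rintro (i | i) (j | j)
    · exact iff_of_false G.irrefl (by simp)
    · exact iff_of_true (hx _ (he j)).symm (by simp)
    · exact iff_of_true (hx _ (he i)) (by simp)
    · exact iff_of_false (fun hij => hs (he i) (he j) hij.ne hij) (by simp)

theorem isIndContained_completeBipartiteGraph_mono {m : ℕ} (h : t ≤ m) :
    (completeBipartiteGraph (Fin 1) (Fin t)).IsIndContained
      (completeBipartiteGraph (Fin 1) (Fin m)) :=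
  ⟨⟨⟨Sum.map id (Fin.castLE h), Function.injective_id.sumMap (Fin.castLE_injective h)⟩, by
    rintro (i | i) (j | j) <;> simp⟩⟩

theorem card_le_of_isIndepSet_of_subset_closedNbhd (ht : 0 < t)
    (hG : ¬ (completeBipartiteGraph (Fin 1) (Fin t)).IsIndContained G)
    (hs : G.IsIndepSet s) (hx : ∀ v ∈ s, v = x ∨ G.Adj v x) : #s ≤ t := by
  by_cases hxs : x ∈ s
  · have hsub : s ⊆ {x} := fun v hv => mem_singleton.2 <| by
      by_contra hne
      exact hs hv hxs hne ((hx v hv).resolve_left hne)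
    exact (card_le_card hsub).trans ht
  · by_contra! hlt
    exact hG <| (isIndContained_completeBipartiteGraph_mono hlt.le).trans <|
      isIndContained_of_isIndepSet_of_adj hs fun v hv =>
        (hx v hv).resolve_left fun e => hxs (e ▸ hv)

theorem card_le_card_mul_add_card (ht : 0 < t)
    (hG : ¬ (completeBipartiteGraph (Fin 1) (Fin t)).IsIndContained G) {X Y : Finset V}
    (hs : G.IsIndepSet s) (hXY : ∀ v ∈ s, v ∈ Y ∨ ∃ x ∈ X, v = x ∨ G.Adj v x) :
    #s ≤ #X * t + #Y := by
  classical
  have hcov : s ⊆ (X.biUnion fun x => {v ∈ s | v = x ∨ G.Adj v x}) ∪ Y := by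
    intro v hv
    rw [mem_union, mem_biUnion]
    refine (hXY v hv).symm.imp_left ?_
    rintro ⟨x, hx, hvx⟩
    exact ⟨x, hx, mem_filter.2 ⟨hv, hvx⟩⟩
  refine (card_le_card hcov).trans <| (card_union_le _ _).trans <| Nat.add_le_add_right ?_ _
  exact card_biUnion_le_card_mul _ _ _ fun x _ =>
    card_le_of_isIndepSet_of_subset_closedNbhd ht hG
      (hs.mono (coe_subset.2 (filter_subset _ _))) fun v hv => (mem_filter.1 hv).2

theorem indepNum_induce_le [Finite V] {B : Set V} {m : ℕ}
    (h : ∀ s : Finset V, G.IsIndepSet s → ↑s ⊆ B → #s ≤ m) : (G.induce B).indepNum ≤ m := by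
  have := Fintype.ofFinite B
  obtain ⟨s, hs⟩ := (G.induce B).exists_isNIndepSet_indepNum
  rw [← hs.card_eq, ← card_map (Function.Embedding.subtype _)]
  refine h _ ?_ (by simp)
  rw [coe_map]
  rintro _ ⟨a, ha, rfl⟩ _ ⟨b, hb, rfl⟩ hab
  exact hs.isIndepSet ha hb fun e => hab (congrArg _ e)

end Independence

section IsParent

variable {n : ℕ} {G : SimpleGraph (Fin n)} {τ : Fin n → ℕ} {X Z : Finset (Fin n)}
  {E : Fin n → Fin (n + 1)}

/-- `E` gives every vertex outside `Z` its neighbour deleted later, if there is one. The value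
`Fin.last n` stands for "no such neighbour". -/
structure IsParent (G : SimpleGraph (Fin n)) (τ : Fin n → ℕ) (Z : Finset (Fin n))
    (E : Fin n → Fin (n + 1)) : Prop where
  lt : ∀ v u, E v = Fin.castSucc u → τ v < τ u
  cover : ∀ v ∉ Z, ∀ u ∉ Z, G.Adj v u → τ v ≤ τ u → E v = Fin.castSucc u

/-- The parent function on the nodes of the tree-decomposition, which are the vertices and one
additional root `Fin.last n`. -/
def nodeParent (E : Fin n → Fin (n + 1)) : Fin (n + 1) → Fin (n + 1) :=
  Fin.lastCases (Fin.last n) E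

theorem nodeParent_last (E : Fin n → Fin (n + 1)) : nodeParent E (Fin.last n) = Fin.last n := by
  simp [nodeParent]

theorem nodeParent_castSucc (E : Fin n → Fin (n + 1)) (v : Fin n) :
    nodeParent E v.castSucc = E v := by
  simp [nodeParent]

/-- The bag of a node of the tree-decomposition: the vertices of `Z`, the node itself and its
parent. -/
def nodeBag (Z : Finset (Fin n)) (E : Fin n → Fin (n + 1)) (a : Fin (n + 1)) : Set (Fin n) :=
  {v | v ∈ Z ∨ v.castSucc = a ∨ v.castSucc = nodeParent E a}

theorem IsParent.isTree (h : IsParent G τ Z E) : (parentGraph (nodeParent E)).IsTree := by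
  refine isTree_parentGraph (ρ := Fin.lastCases (univ.sup τ + 1) τ) (nodeParent_last E)
    fun a ha => ?_
  induction a using Fin.lastCases with
  | last => exact absurd rfl ha
  | cast v =>
    rw [nodeParent_castSucc]
    rcases Fin.eq_castSucc_or_eq_last (E v) with ⟨u, hu⟩ | hu
    · simpa [hu] using h.lt v u hu
    · simpa [hu] using Nat.lt_succ_of_le (le_sup (f := τ) (mem_univ v))

theorem IsParent.exists_subset_nodeBag (h : IsParent G τ Z E) {u v : Fin n} (huv : G.Adj u v)
    (hle : τ u ≤ τ v) : ∃ a, {u, v} ⊆ nodeBag Z E a := by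
  by_cases hu : u ∈ Z
  · exact ⟨v.castSucc, Set.pair_subset (Or.inl hu) (Or.inr (Or.inl rfl))⟩
  · refine ⟨u.castSucc, Set.pair_subset (Or.inr (Or.inl rfl)) ?_⟩
    by_cases hv : v ∈ Z
    · exact Or.inl hv
    · exact Or.inr (Or.inr (by rw [nodeParent_castSucc, h.cover u hu v hv huv hle]))

theorem IsParent.connected_induce_nodeBag (h : IsParent G τ Z E) (v : Fin n) :
    ((parentGraph (nodeParent E)).induce {a | v ∈ nodeBag Z E a}).Connected := by
  by_cases hv : v ∈ Z
  · have huniv : {a | v ∈ nodeBag Z E a} = Set.univ := Set.eq_univ_of_forall fun a => Or.inl hv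
    rw [huniv]
    exact (SimpleGraph.Iso.connected_iff (SimpleGraph.induceUnivIso _)).2 h.isTree.1
  · refine connected_induce_of_forall_adj (c := v.castSucc) (Or.inr (Or.inl rfl)) fun a ha => ?_
    rcases ha with ha | ha | ha
    · exact absurd ha hv
    · exact Or.inl ha.symm
    · exact or_iff_not_imp_left.2 fun hne => ⟨hne, Or.inl ha.symm⟩

/-- The tree-decomposition of a dismantled graph: outside `Z` the graph is a forest in which `E`
gives the parents, and `Z` is added to all bags. -/
def IsParent.treeDecomposition (h : IsParent G τ Z E) : TreeDecomposition G (Fin (n + 1)) where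
  tree := parentGraph (nodeParent E)
  bag := nodeBag Z E
  isTree := h.isTree
  cover := Set.eq_univ_of_forall fun v => Set.mem_iUnion.2 ⟨v.castSucc, Or.inr (Or.inl rfl)⟩
  edge u v huv := by
    rcases le_total (τ u) (τ v) with hle | hle
    · exact h.exists_subset_nodeBag huv hle
    · simpa only [Set.pair_comm] using h.exists_subset_nodeBag huv.symm hle
  subtree := h.connected_induce_nodeBag

theorem IsParent.independenceNumber_le [DecidableRel G.Adj] (h : IsParent G τ Z E)
    (hd : IsDismantling G τ X Z) {t : ℕ} (ht : 0 < t)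
    (hG : ¬ (completeBipartiteGraph (Fin 1) (Fin t)).IsIndContained G) :
    h.treeDecomposition.independenceNumber ≤ #X * t + 2 := by
  refine Finset.sup_le fun a _ => indepNum_induce_le fun s hs hsub => ?_
  have hpair : #{v : Fin n | v.castSucc = a ∨ v.castSucc = nodeParent E a} ≤ 2 := by
    rw [← card_map Fin.castSuccEmb]
    refine (card_le_card (t := {a, nodeParent E a}) fun b hb => ?_).trans card_le_two
    obtain ⟨v, hv, rfl⟩ := mem_map.1 hb
    simpa using hv
  refine (card_le_card_mul_add_card ht hG (X := X) hs fun v hv => ?_).trans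
    (Nat.add_le_add_left hpair _)
  rcases hsub hv with hv | hv
  · obtain ⟨x, hx, -, hvx⟩ := hd.star v hv
    exact Or.inr ⟨x, hx, hvx⟩
  · exact Or.inl (by simpa using hv)

end IsParent

/-! ### Cycles chosen one after another -/

section ChosenAt

variable [Fintype V]

/-- The cycle `c` was chosen at time `T`: its vertices are present at that time, and the closed
neighbourhoods of its root and of its vertices of degree at least three are deleted at that time. -/
structure ChosenAt (G : SimpleGraph V) [DecidableRel G.Adj] (τ : V → ℕ) (T : ℕ) {r : V}
    (c : G.Walk r r) : Prop where
  isCycle : c.IsCycle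
  le : ∀ v ∈ c.support, T ≤ τ v
  deleted : ∀ v ∈ c.support, v = r ∨ 3 ≤ #(aliveNbrs G τ T v) →
    τ v = T ∧ ∀ w, G.Adj v w → T ≤ τ w → τ w = T

variable {G : SimpleGraph V} [DecidableRel G.Adj] {τ : V → ℕ} {T T' : ℕ} {r : V}
  {c : G.Walk r r} {v w : V}

theorem ChosenAt.card_aliveNbrs_le_two (h : ChosenAt G τ T c) (hv : v ∈ c.support)
    (hw : w = v ∨ G.Adj v w) (hlt : T < τ w) : #(aliveNbrs G τ T v) ≤ 2 := by
  by_contra! hdeg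
  obtain ⟨hτv, hnbr⟩ := h.deleted v hv (Or.inr hdeg)
  rcases hw with rfl | hvw
  · exact hlt.ne' hτv
  · exact hlt.ne' (hnbr w hvw hlt.le)

theorem ChosenAt.le_getVert_succ (h : ChosenAt G τ T c) (hT : T < T')
    (hdeg : ∀ v, T' ≤ τ v → 2 ≤ #(aliveNbrs G τ T' v)) {i : ℕ} (hi : i < c.length)
    (hle : T' ≤ τ (c.getVert i)) : T' ≤ τ (c.getVert (i + 1)) := by
  have hsub : aliveNbrs G τ T' (c.getVert i) ⊆ aliveNbrs G τ T (c.getVert i) := fun u hu =>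
    mem_aliveNbrs.2 ((mem_aliveNbrs.1 hu).imp_right hT.le.trans)
  have heq := eq_of_subset_of_card_le hsub <|
    (h.card_aliveNbrs_le_two (c.getVert_mem_support i) (Or.inl rfl) (hT.trans_le hle)).trans
      (hdeg _ hle)
  have hmem : c.getVert (i + 1) ∈ aliveNbrs G τ T' (c.getVert i) :=
    heq ▸ mem_aliveNbrs.2 ⟨c.adj_getVert_succ hi, h.le _ (c.getVert_mem_support _)⟩
  exact (mem_aliveNbrs.1 hmem).2

theorem ChosenAt.lt_of_mem_support (h : ChosenAt G τ T c) (hT : T < T')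
    (hdeg : ∀ v, T' ≤ τ v → 2 ≤ #(aliveNbrs G τ T' v)) (hv : v ∈ c.support) : τ v < T' := by
  by_contra! hle
  obtain ⟨i, rfl, hi⟩ := SimpleGraph.Walk.mem_support_iff_exists_getVert.1 hv
  have hend : T' ≤ τ (c.getVert c.length) :=
    Nat.le_induction (P := fun j _ => j ≤ c.length → T' ≤ τ (c.getVert j)) (fun _ => hle)
      (fun j _ ih hj => h.le_getVert_succ hT hdeg hj (ih (Nat.le_of_succ_le hj))) _ hi le_rfl
  rw [c.getVert_length, (h.deleted r c.start_mem_support (Or.inl rfl)).1] at hend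
  exact hT.not_ge hend

theorem ChosenAt.not_adj (h : ChosenAt G τ T c) (hT : T < T')
    (hdeg : ∀ v, T' ≤ τ v → 2 ≤ #(aliveNbrs G τ T' v)) (hv : v ∈ c.support) (hw : T' ≤ τ w) :
    ¬ G.Adj v w := by
  intro hvw
  have hsub : c.toSubgraph.neighborSet v ⊆ aliveNbrs G τ T v := fun u hu =>
    mem_aliveNbrs.2 ⟨hu.adj_sub, h.le _ (c.mem_verts_toSubgraph.1 hu.snd_mem)⟩
  have heq : c.toSubgraph.neighborSet v = aliveNbrs G τ T v := by
    refine Set.eq_of_subset_of_ncard_le hsub ?_ (finite_toSet _)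
    rw [Set.ncard_coe_finset, h.isCycle.ncard_neighborSet_toSubgraph_eq_two hv]
    exact h.card_aliveNbrs_le_two hv (Or.inr hvw) (hT.trans_le hw)
  have hmem : w ∈ c.toSubgraph.neighborSet v := by
    rw [heq]
    exact mem_aliveNbrs.2 ⟨hvw, hT.le.trans hw⟩
  have := h.lt_of_mem_support hT hdeg (c.mem_verts_toSubgraph.1 hmem.snd_mem)
  omega

theorem isInducedCyclePacking_of_chosenAt {k : ℕ} {root : Fin k → V}
    {cyc : ∀ i, G.Walk (root i) (root i)} {T : Fin k → ℕ} (hT : StrictMono T)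
    (h : ∀ i, ChosenAt G τ (T i) (cyc i))
    (hdeg : ∀ i v, T i ≤ τ v → 2 ≤ #(aliveNbrs G τ (T i) v)) :
    IsInducedCyclePacking G root cyc where
  isCycle i := (h i).isCycle
  disjoint i j hij u hu hu' := by
    rcases lt_or_gt_of_ne hij with hlt | hlt
    · exact ((h i).lt_of_mem_support (hT hlt) (hdeg j) hu).not_ge ((h j).le u hu')
    · exact ((h j).lt_of_mem_support (hT hlt) (hdeg i) hu').not_ge ((h i).le u hu)
  no_edge i j hij u hu v hv huv := by
    rcases lt_or_gt_of_ne hij with hlt | hlt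
    · exact (h i).not_adj (hT hlt) (hdeg j) hu ((h j).le v hv) huv
    · exact (h j).not_adj (hT hlt) (hdeg i) hv ((h i).le u hu) huv.symm

end ChosenAt

end CyclePacking

/-! ### Programs with counted loops -/

namespace Store

/-- `s'` has the same content as `s` in all registers outside `xs` and all arrays outside `as`. -/
structure AgreesOff (xs as : List ℕ) (s s' : Store) : Prop where
  var {x : ℕ} : x ∉ xs → s'.var x = s.var x
  arr {a : ℕ} : a ∉ as → s'.arr a = s.arr a

theorem AgreesOff.refl (xs as : List ℕ) (s : Store) : AgreesOff xs as s s :=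
  ⟨fun _ => rfl, fun _ => rfl⟩

theorem AgreesOff.trans {xs as : List ℕ} {s₁ s₂ s₃ : Store} (h : AgreesOff xs as s₁ s₂)
    (h' : AgreesOff xs as s₂ s₃) : AgreesOff xs as s₁ s₃ :=
  ⟨fun hx => (h'.var hx).trans (h.var hx), fun ha => (h'.arr ha).trans (h.arr ha)⟩

theorem AgreesOff.mono {xs ys as bs : List ℕ} {s s' : Store} (h : AgreesOff xs as s s')
    (hx : xs ⊆ ys) (ha : as ⊆ bs) : AgreesOff ys bs s s' :=
  ⟨fun hy => h.var fun h' => hy (hx h'), fun hb => h.arr fun h' => hb (ha h')⟩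

@[simp] theorem var_setVar (s : Store) (x v y : ℕ) :
    (s.setVar x v).var y = if y = x then v else s.var y := by
  simp [setVar, Function.update_apply]

@[simp] theorem arr_setVar (s : Store) (x v a : ℕ) : (s.setVar x v).arr a = s.arr a := rfl

@[simp] theorem var_setArr (s : Store) (a i v x : ℕ) : (s.setArr a i v).var x = s.var x := rfl

@[simp] theorem arr_setArr (s : Store) (a i v b : ℕ) :
    (s.setArr a i v).arr b = if b = a then Function.update (s.arr a) i v else s.arr b := by
  simp [setArr, Function.update_apply]

theorem agreesOff_setVar {x : ℕ} {xs : List ℕ} (hx : x ∈ xs) (as : List ℕ) (s : Store) (v : ℕ) :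
    AgreesOff xs as s (s.setVar x v) where
  var {y} hy := by simp [show y ≠ x by rintro rfl; exact hy hx]
  arr _ := rfl

theorem agreesOff_setArr {a : ℕ} (xs : List ℕ) {as : List ℕ} (ha : a ∈ as) (s : Store) (i v : ℕ) :
    AgreesOff xs as s (s.setArr a i v) where
  var _ := rfl
  arr {b} hb := by simp [show b ≠ a by rintro rfl; exact hb ha]

end Store

namespace Expr

instance : Add Expr := ⟨add⟩

instance : Sub Expr := ⟨sub⟩

@[simp] theorem eval_const (s : Store) (c : ℕ) : (const c).eval s = c := rfl

@[simp] theorem eval_var (s : Store) (x : ℕ) : (var x).eval s = s.var x := rfl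

@[simp] theorem eval_get (s : Store) (a : ℕ) (i : Expr) :
    (get a i).eval s = s.arr a (i.eval s) := rfl

@[simp] theorem eval_add (s : Store) (e f : Expr) : (e + f).eval s = e.eval s + f.eval s := rfl

@[simp] theorem eval_sub (s : Store) (e f : Expr) : (e - f).eval s = e.eval s - f.eval s := rfl

end Expr

open Polynomial in
theorem CyclePacking.eval_le_eval (P : ℕ[X]) {m n : ℕ} (h : m ≤ n) : P.eval m ≤ P.eval n := by
  simp only [Polynomial.eval_eq_sum]
  exact Finset.sum_le_sum fun i _ => Nat.mul_le_mul_left _ (Nat.pow_le_pow_left h i)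

/-- Structured programs whose loops run a counter `x` through `0, ..., n - 1`, where `n` is the
content of register 0. Such programs always halt, after a number of steps polynomial in `n`. -/
inductive ForProg where
  | skip
  | assign (x : ℕ) (e : Expr)
  | store (a : ℕ) (i e : Expr)
  | seq (p q : ForProg)
  | ite (e : Expr) (p q : ForProg)
  | forN (x : ℕ) (p : ForProg)

namespace ForProg

/-- The translation into programs for the random access machine. -/
def toProg : ForProg → Prog
  | skip => .skip
  | assign x e => .assign x e
  | store a i e => .store a i e
  | seq p q => .seq p.toProg q.toProg
  | ite e p q => .ite e p.toProg q.toProg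
  | forN x p => .seq (.assign x (.const 0)) (.loop (.sub (.var 0) (.var x))
      (.seq p.toProg (.assign x (.add (.var x) (.const 1)))))

/-- The registers that a program may change. -/
def vars : ForProg → List ℕ
  | skip => []
  | assign x _ => [x]
  | store _ _ _ => []
  | seq p q => p.vars ++ q.vars
  | ite _ p q => p.vars ++ q.vars
  | forN x p => x :: p.vars

/-- The arrays that a program may change. -/
def arrs : ForProg → List ℕ
  | skip => []
  | assign _ _ => []
  | store a _ _ => [a]
  | seq p q => p.arrs ++ q.arrs
  | ite _ p q => p.arrs ++ q.arrs
  | forN _ p => p.arrs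

/-- No part of the program changes register 0, and no loop body changes the loop counter. -/
def WellFormed : ForProg → Prop
  | skip => True
  | assign x _ => x ≠ 0
  | store _ _ _ => True
  | seq p q => p.WellFormed ∧ q.WellFormed
  | ite _ p q => p.WellFormed ∧ q.WellFormed
  | forN x p => x ≠ 0 ∧ x ∉ p.vars ∧ p.WellFormed

instance decidableWellFormed : ∀ p : ForProg, Decidable p.WellFormed
  | skip => isTrue trivial
  | assign x _ => inferInstanceAs (Decidable (x ≠ 0))
  | store _ _ _ => isTrue trivial
  | seq p q | ite _ p q =>
    haveI := decidableWellFormed p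
    haveI := decidableWellFormed q
    inferInstanceAs (Decidable (p.WellFormed ∧ q.WellFormed))
  | forN x p =>
    haveI := decidableWellFormed p
    inferInstanceAs (Decidable (x ≠ 0 ∧ x ∉ p.vars ∧ p.WellFormed))

/-- The memory after `i` rounds of a counted loop with counter `x` whose body has the effect `f`. -/
def forLoop (f : Store → Store) (x : ℕ) (s : Store) : ℕ → Store
  | 0 => s.setVar x 0
  | i + 1 => (f (forLoop f x s i)).setVar x (i + 1)

/-- The effect of a program on the memory. -/
def run : ForProg → Store → Store
  | skip, s => s
  | assign x e, s => s.setVar x (e.eval s)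
  | store a i e, s => s.setArr a (i.eval s) (e.eval s)
  | seq p q, s => q.run (p.run s)
  | ite e p q, s => if e.eval s = 0 then q.run s else p.run s
  | forN x p, s => forLoop p.run x s (s.var 0)

open Polynomial in
/-- A bound on the number of steps as a polynomial in the content of register 0. -/
noncomputable def timeBound : ForProg → ℕ[X]
  | skip => 1
  | assign _ e => C (e.cost + 1)
  | store _ i e => C (i.cost + e.cost + 1)
  | seq p q => p.timeBound + q.timeBound
  | ite e p q => C (e.cost + 1) + (p.timeBound + q.timeBound)
  | forN _ p => 6 + X * (p.timeBound + 8)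

variable {p q : ForProg} {e : Expr} {s : Store} {x : ℕ}

@[simp] theorem run_skip (s : Store) : skip.run s = s := rfl

@[simp] theorem run_assign (x : ℕ) (e : Expr) (s : Store) :
    (assign x e).run s = s.setVar x (e.eval s) := rfl

@[simp] theorem run_store (a : ℕ) (i e : Expr) (s : Store) :
    (store a i e).run s = s.setArr a (i.eval s) (e.eval s) := rfl

@[simp] theorem run_seq (p q : ForProg) (s : Store) : (seq p q).run s = q.run (p.run s) := rfl

theorem run_ite_of_eq (h : e.eval s = 0) : (ite e p q).run s = q.run s := if_pos h

theorem run_ite_of_ne (h : e.eval s ≠ 0) : (ite e p q).run s = p.run s := if_neg h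

theorem agreesOff_forLoop {f : Store → Store} {xs as : List ℕ}
    (hf : ∀ s : Store, s.AgreesOff xs as (f s)) (x : ℕ) (s : Store) (i : ℕ) :
    s.AgreesOff (x :: xs) as (forLoop f x s i) := by
  induction i with
  | zero => exact Store.agreesOff_setVar (by simp) _ _ _
  | succ i ih =>
    exact (ih.trans ((hf _).mono (List.subset_cons_self _ _) (List.Subset.refl _))).trans
      (Store.agreesOff_setVar (by simp) _ _ _)

theorem run_agreesOff (p : ForProg) (s : Store) : s.AgreesOff p.vars p.arrs (p.run s) := by
  induction p generalizing s with
  | skip => exact .refl _ _ s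
  | assign x e => exact Store.agreesOff_setVar (by simp [vars]) _ _ _
  | store a i e => exact Store.agreesOff_setArr _ (by simp [arrs]) _ _ _
  | seq p q ihp ihq =>
    exact ((ihp s).mono (List.subset_append_left _ _) (List.subset_append_left _ _)).trans
      ((ihq _).mono (List.subset_append_right _ _) (List.subset_append_right _ _))
  | ite e p q ihp ihq =>
    rw [run]
    split_ifs
    · exact (ihq s).mono (List.subset_append_right _ _) (List.subset_append_right _ _)
    · exact (ihp s).mono (List.subset_append_left _ _) (List.subset_append_left _ _)
  | forN x p ih => exact agreesOff_forLoop ih x s _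

theorem run_var (h : x ∉ p.vars) (s : Store) : (p.run s).var x = s.var x :=
  (p.run_agreesOff s).var h

theorem run_arr {a : ℕ} (h : a ∉ p.arrs) (s : Store) : (p.run s).arr a = s.arr a :=
  (p.run_agreesOff s).arr h

theorem forLoop_var_counter (f : Store → Store) (x : ℕ) (s : Store) (i : ℕ) :
    (forLoop f x s i).var x = i := by
  cases i <;> simp [forLoop]

theorem run_forN_induction (s : Store) {I : ℕ → Store → Prop} (zero : I 0 (s.setVar x 0))
    (succ : ∀ i st, i < s.var 0 → st.var x = i → s.AgreesOff (x :: p.vars) p.arrs st → I i st →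
      I (i + 1) ((p.run st).setVar x (i + 1))) :
    I (s.var 0) ((forN x p).run s) := by
  suffices ∀ i ≤ s.var 0, I i (forLoop p.run x s i) from this _ le_rfl
  intro i hi
  induction i with
  | zero => exact zero
  | succ i ih =>
    exact succ i _ hi (forLoop_var_counter ..) (agreesOff_forLoop p.run_agreesOff ..)
      (ih (by omega))

theorem WellFormed.zero_notMem_vars (h : p.WellFormed) : 0 ∉ p.vars := by
  induction p with
  | skip | store => simp [vars]
  | assign x e => simpa [vars] using Ne.symm h
  | seq p q ihp ihq | ite e p q ihp ihq => simp [vars, ihp h.1, ihq h.2]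
  | forN x p ih => simp [vars, ih h.2.2, Ne.symm h.1]

theorem exec_loop {P : Prog} {f : Store → Store} {xs as : List ℕ} {b : ℕ}
    (hf : ∀ s : Store, s.AgreesOff xs as (f s)) (hx₀ : x ≠ 0) (hx : x ∉ xs) (h₀ : 0 ∉ xs)
    (s : Store)
    (hP : ∀ st, st.var 0 = s.var 0 → ∃ c, Prog.Exec P st c (f st) ∧ c ≤ b)
    {d i : ℕ} (hd : i + d = s.var 0) :
    ∃ c, Prog.Exec (.loop (.sub (.var 0) (.var x))
        (.seq P (.assign x (.add (.var x) (.const 1))))) (forLoop f x s i) c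
        (forLoop f x s (s.var 0)) ∧ c ≤ 4 + d * (b + 8) := by
  have var_zero i : (forLoop f x s i).var 0 = s.var 0 :=
    (agreesOff_forLoop hf x s i).var (by simp [h₀, Ne.symm hx₀])
  induction d generalizing i with
  | zero =>
    obtain rfl : i = s.var 0 := hd
    exact ⟨_, .loop_done (by simp [Expr.eval, var_zero, forLoop_var_counter]),
      by simp [Expr.cost]⟩
  | succ d ih =>
    obtain ⟨c₁, exec₁, le₁⟩ := hP _ (var_zero i)
    obtain ⟨c₂, exec₂, le₂⟩ := ih (i := i + 1) (by omega)
    have succ_eq : forLoop f x s (i + 1) = (f (forLoop f x s i)).setVar x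
        ((Expr.add (.var x) (.const 1)).eval (f (forLoop f x s i))) := by
      simp [forLoop, Expr.eval, (hf _).var hx, forLoop_var_counter]
    rw [succ_eq] at exec₂
    refine ⟨_, .loop_step ?_ (.seq exec₁ (.assign _ _ _)) exec₂, ?_⟩
    · simp only [Expr.eval, var_zero, forLoop_var_counter]
      omega
    · simp only [Expr.cost, Nat.succ_mul]
      omega

theorem WellFormed.exec (h : p.WellFormed) (s : Store) :
    ∃ c, Prog.Exec p.toProg s c (p.run s) ∧ c ≤ p.timeBound.eval (s.var 0) := by
  induction p generalizing s with
  | skip => exact ⟨_, .skip s, by simp [timeBound]⟩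
  | assign x e => exact ⟨_, .assign s x e, by simp [timeBound]⟩
  | store a i e => exact ⟨_, .store s a i e, by simp [timeBound]⟩
  | seq p q ihp ihq =>
    obtain ⟨c₁, exec₁, le₁⟩ := ihp h.1 s
    obtain ⟨c₂, exec₂, le₂⟩ := ihq h.2 (p.run s)
    rw [run_var h.1.zero_notMem_vars] at le₂
    exact ⟨_, .seq exec₁ exec₂, by simpa [timeBound] using Nat.add_le_add le₁ le₂⟩
  | ite e p q ihp ihq =>
    simp only [toProg, run, timeBound, Polynomial.eval_add, Polynomial.eval_C]
    split_ifs with he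
    · obtain ⟨c, exec, le⟩ := ihq h.2 s
      exact ⟨_, .ite_false he exec, by omega⟩
    · obtain ⟨c, exec, le⟩ := ihp h.1 s
      exact ⟨_, .ite_true he exec, by omega⟩
  | forN x p ih =>
    obtain ⟨hx₀, hx, hp⟩ := h
    obtain ⟨c, exec, le⟩ := exec_loop p.run_agreesOff hx₀ hx hp.zero_notMem_vars s
      (fun st hst => hst ▸ ih hp st) (zero_add _)
    refine ⟨_, .seq (.assign s x (.const 0)) exec, ?_⟩
    simp only [Expr.cost, timeBound, Polynomial.eval_add, Polynomial.eval_mul, Polynomial.eval_X,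
      Polynomial.eval_ofNat]
    omega

end ForProg

/-- Sequential composition. -/
notation:60 p:61 ";;" q:60 => ForProg.seq p q

/-- Assignment to a register. -/
notation:65 x:max "≔" e:65 => ForProg.assign x e

namespace CyclePacking

open Finset Expr ForProg

-- Registers and arrays. The names up to `rNodes` and `aBag` are those of the input and output
-- format; the row of array `aRow` that is being written is always row `rCnt`.
local notation "rN" => (0 : ℕ)
local notation "rK" => (2 : ℕ)
local notation "rKind" => (3 : ℕ)
local notation "rNodes" => (4 : ℕ)
local notation "rCnt" => (5 : ℕ)
local notation "rRound" => (6 : ℕ)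
local notation "rV" => (7 : ℕ)
local notation "rW" => (8 : ℕ)
local notation "rDeg" => (9 : ℕ)
local notation "rBest" => (10 : ℕ)
local notation "rLow" => (11 : ℕ)
local notation "rNbr" => (12 : ℕ)
local notation "rLowNbr" => (13 : ℕ)
local notation "rSrc" => (14 : ℕ)
local notation "rDst" => (15 : ℕ)
local notation "rA" => (16 : ℕ)
local notation "rB" => (17 : ℕ)
local notation "rStep" => (18 : ℕ)
local notation "rInf" => (19 : ℕ)
local notation "rLen" => (20 : ℕ)
local notation "rCur" => (21 : ℕ)
local notation "rCenter" => (22 : ℕ)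
local notation "aAdj" => (0 : ℕ)
local notation "aLen" => (1 : ℕ)
local notation "aRow" => (2 : ℕ)
local notation "aTree" => (3 : ℕ)
local notation "aBag" => (4 : ℕ)
local notation "aMul" => (5 : ℕ)
local notation "aDead" => (6 : ℕ)
local notation "aWeight" => (7 : ℕ)
local notation "aDist" => (8 : ℕ)
local notation "aPred" => (9 : ℕ)
local notation "aMark" => (10 : ℕ)
local notation "aParent" => (14 : ℕ)

/-! ### Degrees and weights of the remaining vertices -/

section Degrees

section LiveGraph

variable {n : ℕ} (G : SimpleGraph (Fin n)) (dead : ℕ → ℕ)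

/-- A graph on `{0, ..., n - 1}` as a graph on the natural numbers, the values that the registers
of the machine hold. -/
def natGraph : SimpleGraph ℕ where
  Adj a b := ∃ (ha : a < n) (hb : b < n), G.Adj ⟨a, ha⟩ ⟨b, hb⟩
  symm := ⟨fun _ _ ⟨ha, hb, h⟩ => ⟨hb, ha, h.symm⟩⟩
  loopless := ⟨fun _ ⟨_, _, h⟩ => G.irrefl h⟩

@[simp] theorem natGraph_adj_val {u v : Fin n} : (natGraph G).Adj u v ↔ G.Adj u v := by
  simp [natGraph]

instance [DecidableRel G.Adj] : DecidableRel (natGraph G).Adj := fun a b =>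
  inferInstanceAs (Decidable (∃ (ha : a < n) (hb : b < n), G.Adj ⟨a, ha⟩ ⟨b, hb⟩))

/-- The remaining graph during the algorithm: `dead v` is the successor of the time at which the
vertex `v` was deleted, and zero as long as `v` remains. -/
def liveGraph : SimpleGraph ℕ where
  Adj a b := (natGraph G).Adj a b ∧ dead a = 0 ∧ dead b = 0
  symm := ⟨fun _ _ ⟨h, ha, hb⟩ => ⟨h.symm, hb, ha⟩⟩
  loopless := ⟨fun _ ⟨h, _⟩ => (natGraph G).irrefl h⟩

instance [DecidableRel G.Adj] : DecidableRel (liveGraph G dead).Adj := fun a b =>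
  inferInstanceAs (Decidable ((natGraph G).Adj a b ∧ dead a = 0 ∧ dead b = 0))

variable {G dead}

theorem liveGraph_adj {a b : ℕ} :
    (liveGraph G dead).Adj a b ↔ (natGraph G).Adj a b ∧ dead a = 0 ∧ dead b = 0 :=
  Iff.rfl

theorem lt_of_liveGraph_adj {a b : ℕ} (h : (liveGraph G dead).Adj a b) : b < n :=
  let ⟨⟨_, hb, _⟩, _⟩ := h
  hb

end LiveGraph

/-- The adjacency matrix entry at the row and the column given by two registers. -/
def adjE (a b : ℕ) : Expr := get aAdj (get aMul (var a) + var b)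

/-- The value is 1 if the vertices in two registers are adjacent in the remaining graph, and 0
otherwise; this relies on truncated subtraction. -/
def liveE (a b : ℕ) : Expr := adjE a b - (get aDead (var a) + get aDead (var b))

/-- The value is zero if and only if two expressions have the same value. -/
def neE (e f : Expr) : Expr := (e - f) + (f - e)

@[simp] theorem eval_neE (s : Store) (e f : Expr) :
    (neE e f).eval s = 0 ↔ e.eval s = f.eval s := by
  simp only [neE, eval_add, eval_sub]
  omega

variable {n : ℕ} {G : SimpleGraph (Fin n)} [DecidableRel G.Adj] {s s' : Store}

variable (G) in
/-- The memory contains the input graph and the multiples of `n`, which address the rows of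
matrices; the machine cannot multiply. -/
structure HoldsGraph (s : Store) : Prop where
  n_eq : s.var rN = n
  adj : ∀ u < n, ∀ v < n, s.arr aAdj (u * n + v) = if (natGraph G).Adj u v then 1 else 0
  mul : ∀ i ≤ n, s.arr aMul i = i * n

namespace HoldsGraph

theorem of_agreesOff {xs as : List ℕ} (h : HoldsGraph G s) (hs : s.AgreesOff xs as s')
    (hn : rN ∉ xs := by decide) (ha : aAdj ∉ as := by decide) (hm : aMul ∉ as := by decide) :
    HoldsGraph G s' where
  n_eq := (hs.var hn).trans h.n_eq
  adj := by rw [hs.arr ha]; exact h.adj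
  mul := by rw [hs.arr hm]; exact h.mul

theorem eval_adjE (h : HoldsGraph G s) {a b : ℕ} (ha : s.var a < n) (hb : s.var b < n) :
    (adjE a b).eval s = if (natGraph G).Adj (s.var a) (s.var b) then 1 else 0 := by
  simp only [adjE, eval_get, eval_add, eval_var, h.mul _ ha.le, h.adj _ ha _ hb]

theorem eval_liveE (h : HoldsGraph G s) {a b : ℕ} (ha : s.var a < n) (hb : s.var b < n) :
    (liveE a b).eval s = if (liveGraph G (s.arr aDead)).Adj (s.var a) (s.var b) then 1 else 0 := by
  simp only [liveE, eval_sub, h.eval_adjE ha hb, eval_add, eval_get, eval_var, liveGraph_adj]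
  split_ifs <;> first | omega | grind

end HoldsGraph

/-- Count the vertex in `rW` if it is a remaining neighbour of the vertex in `rV`. -/
def countNbrP : ForProg :=
  ite (liveE rV rW)
    (rDeg ≔ var rDeg + const 1 ;;
     rNbr ≔ var rW)
    skip

/-- Count the remaining neighbours of the vertex in `rV`; `rNbr` holds one of them, or `n`. -/
def degP : ForProg :=
  rDeg ≔ const 0 ;;
  rNbr ≔ var rN ;;
  forN rW countNbrP

variable (G) in
/-- `x` is a remaining neighbour of `v`, if there is one, and `n` otherwise. -/
def IsNbrOrNone (dead : ℕ → ℕ) (v x : ℕ) : Prop :=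
  (liveGraph G dead).Adj v x ∨ x = n ∧ ∀ y, ¬ (liveGraph G dead).Adj v y

theorem degP_spec (h : HoldsGraph G s) (hv : s.var rV < n) :
    (degP.run s).var rDeg = Nat.count ((liveGraph G (s.arr aDead)).Adj (s.var rV)) n ∧
    IsNbrOrNone G (s.arr aDead) (s.var rV) ((degP.run s).var rNbr) := by
  let s₁ := (rDeg ≔ const 0 ;; rNbr ≔ var rN).run s
  have hs₁ := run_agreesOff (rDeg ≔ const 0 ;; rNbr ≔ var rN) s
  have hG₁ := h.of_agreesOff hs₁
  have key := run_forN_induction (x := rW) (p := countNbrP) s₁ (I := fun i st =>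
    st.var rDeg = Nat.count ((liveGraph G (s.arr aDead)).Adj (s.var rV)) i ∧
    ((liveGraph G (s.arr aDead)).Adj (s.var rV) (st.var rNbr) ∨
      st.var rNbr = n ∧ ∀ y < i, ¬ (liveGraph G (s.arr aDead)).Adj (s.var rV) y))
    (by simp [s₁, h.n_eq]) ?_
  · rw [hG₁.n_eq] at key
    exact ⟨key.1, key.2.imp_right fun H => ⟨H.1, fun y hy => H.2 y (lt_of_liveGraph_adj hy) hy⟩⟩
  · intro i st hi hW hst ⟨hdeg, hnbr⟩
    have hV : st.var rV = s.var rV := (hst.var (by decide)).trans (hs₁.var (by decide))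
    have hD : st.arr aDead = s.arr aDead := (hst.arr (by decide)).trans (hs₁.arr (by decide))
    rw [hG₁.n_eq] at hi
    have eval_eq := (hG₁.of_agreesOff hst).eval_liveE (a := rV) (b := rW) (by omega) (by omega)
    rw [hV, hD, hW] at eval_eq
    by_cases hadj : (liveGraph G (s.arr aDead)).Adj (s.var rV) i
    · rw [countNbrP, run_ite_of_ne (by simp [eval_eq, hadj])]
      simp [Nat.count_succ, hdeg, hadj, hW]
    · rw [countNbrP, run_ite_of_eq (by simp [eval_eq, hadj])]
      refine ⟨by simp [Nat.count_succ, hdeg, hadj], ?_⟩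
      simpa using hnbr.imp_right fun H => And.intro H.1 (Nat.forall_lt_succ_right.2 ⟨H.2, hadj⟩)

/-- The weight of a vertex `v` in the search for a lightest cycle. A vertex of degree at least 3 is
heavier than all the vertices of degree 2 together. -/
def vertexWeight (n : ℕ) (L : SimpleGraph ℕ) [DecidableRel L.Adj] (v : ℕ) : ℕ :=
  if 3 ≤ Nat.count (L.Adj v) n then n + 1 else 1

theorem one_le_vertexWeight (n : ℕ) (L : SimpleGraph ℕ) [DecidableRel L.Adj] (v : ℕ) :
    1 ≤ vertexWeight n L v := by
  unfold vertexWeight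
  split_ifs <;> omega

theorem vertexWeight_le (n : ℕ) (L : SimpleGraph ℕ) [DecidableRel L.Adj] (v : ℕ) :
    vertexWeight n L v ≤ n + 1 := by
  unfold vertexWeight
  split_ifs <;> omega

/-- Write the weight of the vertex in `rV`, whose degree is in `rDeg`. -/
def weighP : ForProg :=
  ite (var rDeg - const 2) (store aWeight (var rV) (var rN + const 1))
    (store aWeight (var rV) (const 1))

theorem weighP_run (hn : s.var rN = n) {L : SimpleGraph ℕ} [DecidableRel L.Adj]
    (hdeg : s.var rDeg = Nat.count (L.Adj (s.var rV)) n) :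
    weighP.run s = s.setArr aWeight (s.var rV) (vertexWeight n L (s.var rV)) := by
  rw [vertexWeight, ← hdeg]
  split_ifs with h
  · rw [weighP, run_ite_of_ne (by simp; omega)]
    simp [hn]
  · rw [weighP, run_ite_of_eq (by simp; omega)]
    simp

/-- Record the vertex in `rV` if it remains and has degree at most one. -/
def recordLowP : ForProg :=
  ite (get aDead (var rV)) skip (ite (const 2 - var rDeg)
    (rLow ≔ var rV + const 1 ;;
     rLowNbr ≔ var rNbr)
    skip)

/-- Compute the weights, and find a remaining vertex `d` of degree at most one, if there is one:
`rLow` holds `d + 1`, so that 0 stands for none, and `rLowNbr` holds the neighbour of `d`. -/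
def scanP : ForProg := rLow ≔ const 0 ;; forN rV (degP ;; weighP ;; recordLowP)

variable (G) in
/-- The outcome of the search for a vertex of degree at most one among the vertices below `i`. -/
def LowRecorded (dead : ℕ → ℕ) (i : ℕ) (st : Store) : Prop :=
  st.var rLow = 0 ∧
      (∀ v < i, dead v = 0 → 2 ≤ Nat.count ((liveGraph G dead).Adj v) n) ∨
    ∃ d < n, st.var rLow = d + 1 ∧ dead d = 0 ∧ Nat.count ((liveGraph G dead).Adj d) n < 2 ∧
      IsNbrOrNone G dead d (st.var rLowNbr)

theorem LowRecorded.congr {dead : ℕ → ℕ} {i : ℕ} {st st' : Store} (h : LowRecorded G dead i st)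
    (hlow : st'.var rLow = st.var rLow) (hnbr : st'.var rLowNbr = st.var rLowNbr) :
    LowRecorded G dead i st' := by
  unfold LowRecorded
  rwa [hlow, hnbr]

theorem recordLowP_spec {i : ℕ} (hV : s.var rV = i) (hi : i < n)
    (hdeg : s.var rDeg = Nat.count ((liveGraph G (s.arr aDead)).Adj i) n)
    (hnbr : IsNbrOrNone G (s.arr aDead) i (s.var rNbr)) (h : LowRecorded G (s.arr aDead) i s) :
    LowRecorded G (s.arr aDead) (i + 1) (recordLowP.run s) := by
  have of_not_low (hnot : s.arr aDead i = 0 → 2 ≤ s.var rDeg) :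
      LowRecorded G (s.arr aDead) (i + 1) s :=
    h.imp_left fun H => ⟨H.1, Nat.forall_lt_succ_right.2 ⟨H.2, fun h0 => hdeg ▸ hnot h0⟩⟩
  by_cases hdead : s.arr aDead i = 0
  · rw [recordLowP, run_ite_of_eq (by simpa [hV] using hdead)]
    by_cases hlow : s.var rDeg < 2
    · rw [run_ite_of_ne (by simp; omega)]
      exact Or.inr ⟨i, hi, by simp [hV], hdead, hdeg ▸ hlow, by simpa using hnbr⟩
    · rw [run_ite_of_eq (by simp; omega)]
      exact of_not_low fun _ => not_lt.1 hlow
  · rw [recordLowP, run_ite_of_ne (by simpa [hV] using hdead)]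
    exact of_not_low fun h0 => absurd h0 hdead

theorem scanP_spec (h : HoldsGraph G s) :
    (∀ v < n, (scanP.run s).arr aWeight v = vertexWeight n (liveGraph G (s.arr aDead)) v) ∧
    LowRecorded G (s.arr aDead) n (scanP.run s) := by
  have hs₁ : s.AgreesOff [rLow] [] (s.setVar rLow 0) := Store.agreesOff_setVar (by decide) _ _ _
  have key := run_forN_induction (x := rV) (p := degP ;; weighP ;; recordLowP) (s.setVar rLow 0)
    (I := fun i st =>
      (∀ v < i, st.arr aWeight v = vertexWeight n (liveGraph G (s.arr aDead)) v) ∧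
      LowRecorded G (s.arr aDead) i st) ⟨by simp, by simp [LowRecorded]⟩ ?_
  · rw [(h.of_agreesOff hs₁).n_eq] at key
    exact key
  · intro i st hi hV hst ⟨hweight, hlow⟩
    have hG := (h.of_agreesOff hs₁).of_agreesOff hst
    have hD : st.arr aDead = s.arr aDead := (hst.arr (by decide)).trans (hs₁.arr (by decide))
    rw [(h.of_agreesOff hs₁).n_eq] at hi
    have hdegP := degP_spec hG (by omega)
    have hfr := run_agreesOff degP st
    rw [hV, hD] at hdegP
    set s₂ := degP.run st
    have hV₂ : s₂.var rV = i := (hfr.var (by decide)).trans hV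
    have hD₂ : s₂.arr aDead = s.arr aDead := (hfr.arr (by decide)).trans hD
    have hlow₂ : LowRecorded G (s.arr aDead) i s₂ :=
      hlow.congr (hfr.var (by decide)) (hfr.var (by decide))
    have hweight₂ : s₂.arr aWeight = st.arr aWeight := hfr.arr (by decide)
    rw [run_seq, run_seq, weighP_run (hG.of_agreesOff hfr).n_eq (by rw [hV₂]; exact hdegP.1)]
    have := recordLowP_spec (G := G) (s := s₂.setArr aWeight (s₂.var rV)
      (vertexWeight n (liveGraph G (s.arr aDead)) (s₂.var rV))) (i := i) (by simpa) hi
      (by simpa [hD₂] using hdegP.1) (by simpa [hD₂] using hdegP.2)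
      (by simpa [hD₂] using hlow₂.congr (by simp) (by simp))
    refine ⟨fun v hv => ?_, ?_⟩
    · rw [Store.arr_setVar, run_arr (by decide)]
      rcases Nat.lt_succ_iff_lt_or_eq.1 hv with hv | rfl
      · simp [hV₂, Function.update_of_ne hv.ne, hweight₂, hweight v hv]
      · simp [hV₂]
    · simpa [hD₂] using this.congr (st' := (Store.setVar _ rV (i + 1))) (by simp) (by simp)

end Degrees

/-! ### Lightest paths -/

section LightestPaths

section Relaxation

/-- The total weight of the first `len` terms of a sequence of vertices. -/
def seqWeight (w f : ℕ → ℕ) (len : ℕ) : ℕ := ∑ j ∈ range len, w (f j)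

/-- The arcs that a path from `u` to `v` may use if it is to be closed by the edge `uv`. -/
def IsSearchArc (L : SimpleGraph ℕ) (u v a b : ℕ) : Prop := L.Adj a b ∧ ¬ (a = u ∧ b = v)

/-- The distances `δ` and the predecessors `π` of an incomplete search for lightest paths from `u`.
The distance of a vertex that has not been reached yet is `inf`. -/
structure IsLabelling (L : SimpleGraph ℕ) (w : ℕ → ℕ) (u v inf : ℕ) (δ π : ℕ → ℕ) : Prop where
  start : δ u = w u
  pred : ∀ b ∈ L.support, b ≠ u → δ b < inf →
    IsSearchArc L u v (π b) b ∧ δ (π b) + w b ≤ δ b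

/-- A labelling obtained from the distances `δ₀` by relaxing arcs, at least those in `P`. -/
structure IsRelaxation (L : SimpleGraph ℕ) (w : ℕ → ℕ) (u v inf : ℕ) (δ₀ : ℕ → ℕ)
    (P : ℕ → ℕ → Prop) (δ π : ℕ → ℕ) : Prop extends IsLabelling L w u v inf δ π where
  le : ∀ b, δ b ≤ δ₀ b
  relaxed : ∀ a b, P a b → IsSearchArc L u v a b → δ b ≤ δ₀ a + w b

/-- The distances are at most the weights of the walks from `u` with at most `i` arcs. -/
def BoundsWalks (L : SimpleGraph ℕ) (w : ℕ → ℕ) (u v i : ℕ) (δ : ℕ → ℕ) : Prop :=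
  ∀ f : ℕ → ℕ, f 0 = u → ∀ j ≤ i, (∀ l < j, IsSearchArc L u v (f l) (f (l + 1))) →
    δ (f j) ≤ seqWeight w f (j + 1)

variable {L : SimpleGraph ℕ} {w : ℕ → ℕ} {u v inf : ℕ} {δ₀ δ π : ℕ → ℕ} {P Q : ℕ → ℕ → Prop}

theorem IsLabelling.update (h : IsLabelling L w u v inf δ π) {a b : ℕ}
    (hab : IsSearchArc L u v a b) (hlt : δ a + w b < δ b) :
    IsLabelling L w u v inf (Function.update δ b (δ a + w b)) (Function.update π b a) := by
  have hbu : b ≠ u := by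
    rintro rfl
    have := h.start
    omega
  have hne : a ≠ b := hab.1.ne
  refine ⟨by rw [Function.update_of_ne hbu.symm, h.start], fun c hc hcu hlt' => ?_⟩
  by_cases hcb : c = b
  · subst hcb
    simpa [hne] using hab
  · simp only [Function.update_of_ne hcb] at hlt' ⊢
    obtain ⟨harc, hle⟩ := h.pred c hc hcu hlt'
    refine ⟨harc, ?_⟩
    rw [Function.update_apply]
    split_ifs with hπ
    · rw [hπ] at hle
      omega
    · exact hle

namespace IsRelaxation

theorem of_isLabelling (h : IsLabelling L w u v inf δ π) :
    IsRelaxation L w u v inf δ (fun _ _ => False) δ π :=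
  ⟨h, fun _ => le_rfl, fun _ _ => False.elim⟩

theorem mono (h : IsRelaxation L w u v inf δ₀ P δ π) (hQ : ∀ a b, L.Adj a b → Q a b → P a b) :
    IsRelaxation L w u v inf δ₀ Q δ π :=
  ⟨h.toIsLabelling, h.le, fun a b hab harc => h.relaxed a b (hQ a b harc.1 hab) harc⟩

theorem update (h : IsRelaxation L w u v inf δ₀ P δ π) {a b : ℕ} (hab : IsSearchArc L u v a b)
    (hlt : δ a + w b < δ b) :
    IsRelaxation L w u v inf δ₀ (fun x y => P x y ∨ x = a ∧ y = b)
      (Function.update δ b (δ a + w b)) (Function.update π b a) where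
  toIsLabelling := h.toIsLabelling.update hab hlt
  le c := by
    have := h.le c
    grind [Function.update_apply]
  relaxed x y hxy harc := by
    have := h.relaxed x y
    have := h.le a
    grind [Function.update_apply]

theorem of_not_lt (h : IsRelaxation L w u v inf δ₀ P δ π) {a b : ℕ}
    (hab : ¬ (IsSearchArc L u v a b ∧ δ a + w b < δ b)) :
    IsRelaxation L w u v inf δ₀ (fun x y => P x y ∨ x = a ∧ y = b) δ π where
  toIsLabelling := h.toIsLabelling
  le := h.le
  relaxed x y hxy harc := by
    have := h.relaxed x y
    have := h.le a
    grind

theorem boundsWalks_succ (h : IsRelaxation L w u v inf δ₀ (fun _ _ => True) δ π) {i : ℕ}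
    (hδ₀ : BoundsWalks L w u v i δ₀) : BoundsWalks L w u v (i + 1) δ := by
  intro f hf j hj hwalk
  rcases (by omega : j ≤ i ∨ j = i + 1) with hj | rfl
  · exact (h.le _).trans (hδ₀ f hf j hj hwalk)
  · have := h.relaxed _ _ trivial (hwalk i (by omega))
    have := hδ₀ f hf i le_rfl fun l hl => hwalk l (by omega)
    rw [seqWeight, sum_range_succ, ← seqWeight]
    omega

end IsRelaxation

theorem IsLabelling.exists_iterate_eq (h : IsLabelling L w u v inf δ π) (hw : ∀ a, 1 ≤ w a) {b : ℕ}
    (hb : b ∈ L.support) (hlt : δ b < inf) :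
    ∃ l, π^[l] b = u ∧
      (∀ i < l, π^[i] b ≠ u ∧ IsSearchArc L u v (π^[i + 1] b) (π^[i] b) ∧
        δ (π^[i + 1] b) < δ (π^[i] b)) ∧
      seqWeight w (fun i => π^[i] b) (l + 1) ≤ δ b := by
  induction hd : δ b using Nat.strong_induction_on generalizing b with
  | _ d ih =>
  subst hd
  by_cases hbu : b = u
  · subst hbu
    exact ⟨0, rfl, by simp, by simp [seqWeight, h.start]⟩
  · obtain ⟨harc, hle⟩ := h.pred b hb hbu hlt
    have := hw b
    obtain ⟨l, hl, hstep, hsum⟩ := ih (δ (π b)) (by omega) ⟨b, harc.1⟩ (by omega) rfl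
    refine ⟨l + 1, hl, fun i hi => ?_, ?_⟩
    · cases i with
      | zero => exact ⟨hbu, harc, show δ (π b) < δ b by omega⟩
      | succ i => exact hstep i (by omega)
    · simp only [seqWeight, Function.iterate_succ_apply, sum_range_succ' _ (l + 1),
        Function.iterate_zero_apply] at hsum ⊢
      omega

end Relaxation

variable {n : ℕ} {G : SimpleGraph (Fin n)} {L : SimpleGraph ℕ} {w : ℕ → ℕ} {u v inf : ℕ}
  {δ₀ : ℕ → ℕ} {P : ℕ → ℕ → Prop} {s s' : Store}

section

variable [DecidableRel G.Adj]

variable (G L w) in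
/-- The memory contains the input graph, deletion times for which `L` is the remaining graph, and
the weights `w`. -/
structure HoldsNetwork (s : Store) : Prop extends HoldsGraph G s where
  live_eq : liveGraph G (s.arr aDead) = L
  weight_eq : ∀ v < n, s.arr aWeight v = w v

variable (G L w u v) in
/-- The memory is set up for the search of a lightest path from `u` to `v`. -/
structure HoldsQuery (s : Store) : Prop extends HoldsNetwork G L w s where
  src_eq : s.var rSrc = u
  dst_eq : s.var rDst = v

theorem HoldsNetwork.of_agreesOff {xs as : List ℕ} (h : HoldsNetwork G L w s)
    (hs : s.AgreesOff xs as s') (hn : rN ∉ xs := by decide)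
    (has : aAdj ∉ as ∧ aMul ∉ as ∧ aDead ∉ as ∧ aWeight ∉ as := by decide) :
    HoldsNetwork G L w s' where
  toHoldsGraph := h.toHoldsGraph.of_agreesOff hs hn has.1 has.2.1
  live_eq := by rw [hs.arr has.2.2.1, h.live_eq]
  weight_eq := by rw [hs.arr has.2.2.2]; exact h.weight_eq

theorem HoldsQuery.of_agreesOff {xs as : List ℕ} (h : HoldsQuery G L w u v s)
    (hs : s.AgreesOff xs as s') (hxs : rN ∉ xs ∧ rSrc ∉ xs ∧ rDst ∉ xs := by decide)
    (has : aAdj ∉ as ∧ aMul ∉ as ∧ aDead ∉ as ∧ aWeight ∉ as := by decide) :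
    HoldsQuery G L w u v s' where
  toHoldsNetwork := h.toHoldsNetwork.of_agreesOff hs hxs.1 has
  src_eq := (hs.var hxs.2.1).trans h.src_eq
  dst_eq := (hs.var hxs.2.2).trans h.dst_eq

theorem HoldsNetwork.lt_of_adj (h : HoldsNetwork G L w s) {a b : ℕ} (hab : L.Adj a b) : b < n :=
  lt_of_liveGraph_adj (by rwa [h.live_eq])

theorem HoldsNetwork.eval_liveE_eq_zero (h : HoldsNetwork G L w s) {a b : ℕ} (ha : s.var a < n)
    (hb : s.var b < n) : (liveE a b).eval s = 0 ↔ ¬ L.Adj (s.var a) (s.var b) := by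
  rw [h.eval_liveE ha hb, ← h.live_eq]
  simp

/-- Relax the arc given by `rA` and `rB`. -/
def relaxP : ForProg :=
  ite (liveE rA rB)
    (ite (neE (var rA) (var rSrc) + neE (var rB) (var rDst))
      (ite (get aDist (var rB) - (get aDist (var rA) + get aWeight (var rB)))
        (store aDist (var rB) (get aDist (var rA) + get aWeight (var rB)) ;;
         store aPred (var rB) (var rA))
        skip)
      skip)
    skip

open Classical in
theorem relaxP_run (h : HoldsQuery G L w u v s) (ha : s.var rA < n) (hb : s.var rB < n) :
    relaxP.run s =
      if IsSearchArc L u v (s.var rA) (s.var rB) ∧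
          s.arr aDist (s.var rA) + w (s.var rB) < s.arr aDist (s.var rB) then
        (s.setArr aDist (s.var rB) (s.arr aDist (s.var rA) + w (s.var rB))).setArr aPred (s.var rB)
          (s.var rA)
      else s := by
  have hlive := h.eval_liveE_eq_zero ha hb
  have hw := h.weight_eq _ hb
  have hclosing : (neE (var rA) (var rSrc) + neE (var rB) (var rDst)).eval s = 0 ↔
      s.var rA = u ∧ s.var rB = v := by
    simp [h.src_eq, h.dst_eq]
  by_cases hadj : L.Adj (s.var rA) (s.var rB)
  · rw [relaxP, run_ite_of_ne (by simpa [hlive] using hadj)]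
    by_cases hnot : s.var rA = u ∧ s.var rB = v
    · rw [run_ite_of_eq (hclosing.2 hnot), if_neg fun H => H.1.2 hnot, run_skip]
    · rw [run_ite_of_ne (fun H => hnot (hclosing.1 H))]
      split_ifs with hlt
      · rw [run_ite_of_ne (by simp [hw]; omega)]
        simp [hw]
      · have hle := not_lt.1 fun H => hlt ⟨⟨hadj, hnot⟩, H⟩
        rw [run_ite_of_eq (by simp [hw]; omega), run_skip]
  · rw [relaxP, run_ite_of_eq (hlive.2 hadj), if_neg fun H => hadj H.1.1, run_skip]

theorem relaxP_spec (h : HoldsQuery G L w u v s) (ha : s.var rA < n) (hb : s.var rB < n)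
    (hR : IsRelaxation L w u v inf δ₀ P (s.arr aDist) (s.arr aPred)) :
    IsRelaxation L w u v inf δ₀ (fun x y => P x y ∨ x = s.var rA ∧ y = s.var rB)
      ((relaxP.run s).arr aDist) ((relaxP.run s).arr aPred) := by
  classical
  rw [relaxP_run h ha hb]
  split_ifs with hlt
  · simpa using hR.update hlt.1 hlt.2
  · exact hR.of_not_lt hlt

theorem relaxRow_spec (h : HoldsQuery G L w u v s) (ha : s.var rA < n)
    (hR : IsRelaxation L w u v inf δ₀ P (s.arr aDist) (s.arr aPred)) :
    IsRelaxation L w u v inf δ₀ (fun x y => P x y ∨ x = s.var rA)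
      (((forN rB relaxP).run s).arr aDist) (((forN rB relaxP).run s).arr aPred) := by
  have key := run_forN_induction (x := rB) (p := relaxP) s (I := fun i st =>
    IsRelaxation L w u v inf δ₀ (fun x y => P x y ∨ x = s.var rA ∧ y < i)
      (st.arr aDist) (st.arr aPred)) (by simpa using hR) ?_
  · rw [h.n_eq] at key
    exact key.mono fun x y hxy => Or.imp_right fun hx => ⟨hx, h.lt_of_adj hxy⟩
  · intro i st hi hB hst hI
    have hA : st.var rA = s.var rA := hst.var (by decide)
    rw [h.n_eq] at hi
    refine (relaxP_spec (h.of_agreesOff hst) (by omega) (by omega) hI).mono ?_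
    grind

theorem relaxAll_spec (h : HoldsQuery G L w u v s)
    (hS : IsLabelling L w u v inf (s.arr aDist) (s.arr aPred)) :
    IsRelaxation L w u v inf (s.arr aDist) (fun _ _ => True)
      (((forN rA (forN rB relaxP)).run s).arr aDist)
      (((forN rA (forN rB relaxP)).run s).arr aPred) := by
  have key := run_forN_induction (x := rA) (p := forN rB relaxP) s (I := fun i st =>
    IsRelaxation L w u v inf (s.arr aDist) (fun x _ => x < i) (st.arr aDist) (st.arr aPred))
    (by simpa using IsRelaxation.of_isLabelling hS) ?_
  · rw [h.n_eq] at key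
    exact key.mono fun x y hxy _ => h.lt_of_adj hxy.symm
  · intro i st hi hA hst hI
    rw [h.n_eq] at hi
    refine (relaxRow_spec (h.of_agreesOff hst) (by omega) hI).mono ?_
    grind

/-- Assign infinite distance to all vertices except the start. -/
def initDistP : ForProg :=
  forN rW (store aDist (var rW) (var rInf)) ;;
  store aDist (var rSrc) (get aWeight (var rSrc))

theorem initDistP_spec (h : HoldsQuery G L w u v s) (hinf : s.var rInf = inf) (hu : u < n) :
    IsLabelling L w u v inf ((initDistP.run s).arr aDist) ((initDistP.run s).arr aPred) ∧
    BoundsWalks L w u v 0 ((initDistP.run s).arr aDist) := by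
  have hfill : ∀ b < n, ((forN rW (store aDist (var rW) (var rInf))).run s).arr aDist b = inf := by
    have key := run_forN_induction (x := rW) (p := store aDist (var rW) (var rInf)) s
      (I := fun i st => ∀ b < i, st.arr aDist b = inf) (by simp) ?_
    · rwa [h.n_eq] at key
    · intro i st _ hW hst hI b hb
      have hinf' : st.var rInf = inf := (hst.var (by decide)).trans hinf
      rcases Nat.lt_succ_iff_lt_or_eq.1 hb with hb | rfl
      · simp [hW, Function.update_of_ne hb.ne, hI b hb]
      · simp [hW, hinf']
  have hq := h.of_agreesOff (run_agreesOff (forN rW (store aDist (var rW) (var rInf))) s)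
  have hdist : (initDistP.run s).arr aDist = Function.update
      (((forN rW (store aDist (var rW) (var rInf))).run s).arr aDist) u (w u) := by
    simp [initDistP, hq.src_eq, hq.weight_eq u hu]
  rw [hdist]
  refine ⟨⟨by simp, fun b hb hbu hlt => ?_⟩, fun f hf j hj _ => ?_⟩
  · obtain ⟨a, hab⟩ := hb
    rw [Function.update_of_ne hbu, hfill b (h.lt_of_adj hab.symm)] at hlt
    exact absurd hlt (lt_irrefl _)
  · obtain rfl : j = 0 := by omega
    simp [hf, seqWeight]

/-- Bellman-Ford search for the lightest paths from the vertex in `rSrc` that do not use the arc to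
the vertex in `rDst`. -/
def distP : ForProg := initDistP ;; forN rStep (forN rA (forN rB relaxP))

theorem distP_spec (h : HoldsQuery G L w u v s) (hinf : s.var rInf = inf) (hu : u < n) :
    IsLabelling L w u v inf ((distP.run s).arr aDist) ((distP.run s).arr aPred) ∧
    BoundsWalks L w u v n ((distP.run s).arr aDist) := by
  have hq := h.of_agreesOff (run_agreesOff initDistP s)
  have key := run_forN_induction (x := rStep) (p := forN rA (forN rB relaxP)) (initDistP.run s)
    (I := fun i st => IsLabelling L w u v inf (st.arr aDist) (st.arr aPred) ∧
      BoundsWalks L w u v i (st.arr aDist)) (by simpa using initDistP_spec h hinf hu) ?_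
  · rw [hq.n_eq] at key
    exact key
  · intro i st _ _ hst ⟨hlab, hwalks⟩
    have hR := relaxAll_spec (hq.of_agreesOff hst) hlab
    exact ⟨hR.toIsLabelling, hR.boundsWalks_succ hwalks⟩

end

end LightestPaths

/-! ### Lightest cycles -/

section LightestCycles

/-- The first `len` terms of a sequence form a cycle. -/
structure IsCycleSeq (L : SimpleGraph ℕ) (f : ℕ → ℕ) (len : ℕ) : Prop where
  three_le : 3 ≤ len
  injOn : Set.InjOn f (Set.Iio len)
  adj : ∀ j, j + 1 < len → L.Adj (f j) (f (j + 1))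
  adj_last : L.Adj (f (len - 1)) (f 0)

theorem seqWeight_congr {w f g : ℕ → ℕ} {len : ℕ} (hfg : ∀ j < len, f j = g j) :
    seqWeight w f len = seqWeight w g len :=
  sum_congr rfl fun j hj => by rw [hfg j (mem_range.1 hj)]

namespace IsCycleSeq

variable {L : SimpleGraph ℕ} {w : ℕ → ℕ} {f g : ℕ → ℕ} {len n u v inf : ℕ} {δ π : ℕ → ℕ}

theorem congr (h : IsCycleSeq L f len) (hfg : ∀ j < len, f j = g j) : IsCycleSeq L g len := by
  have := h.three_le
  exact ⟨h.three_le, h.injOn.congr hfg,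
    fun j hj => hfg j (by omega) ▸ hfg (j + 1) hj ▸ h.adj j hj,
    hfg (len - 1) (by omega) ▸ hfg 0 (by omega) ▸ h.adj_last⟩

theorem exists_adj (h : IsCycleSeq L f len) {j : ℕ} (hj : j < len) : ∃ a, L.Adj a (f j) := by
  cases j with
  | zero => exact ⟨_, h.adj_last⟩
  | succ j => exact ⟨_, h.adj j hj⟩

theorem len_le (h : IsCycleSeq L f len) (hL : ∀ a b, L.Adj a b → b < n) : len ≤ n := by
  have := card_le_card_of_injOn (s := range len) (t := range n) f
    (fun j hj => mem_range.2 (hL _ _ (h.exists_adj (mem_range.1 hj)).choose_spec))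
    (by simpa using h.injOn)
  simpa using this

theorem seqWeight_lt (h : IsCycleSeq L f len) (hL : ∀ a b, L.Adj a b → b < n)
    (hw : ∀ v, w v ≤ n + 1) : seqWeight w f len < n * n + (n + 1) := by
  have hsum : seqWeight w f len ≤ len * (n + 1) :=
    (sum_le_card_nsmul _ _ (n + 1) fun j _ => hw (f j)).trans_eq (by simp)
  have hlen := Nat.mul_le_mul_right (n + 1) (h.len_le hL)
  rw [mul_add_one n n] at hlen
  omega

theorem dist_le_seqWeight (h : IsCycleSeq L f len) (hwalks : BoundsWalks L w u v n δ)
    (hL : ∀ a b, L.Adj a b → b < n) (hu : f 0 = u) (hv : f (len - 1) = v) :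
    δ v ≤ seqWeight w f len := by
  have hthree := h.three_le
  have hlen := h.len_le hL
  have := hwalks f hu (len - 1) (by omega) fun l hl => by
    refine ⟨h.adj l (by omega), fun ⟨h0, h1⟩ => ?_⟩
    have := h.injOn (by simp; omega) (by simp; omega) (h0.trans hu.symm)
    have := h.injOn (by simp; omega) (by simp; omega) (h1.trans hv.symm)
    omega
  rwa [hv, Nat.sub_add_cancel (by omega)] at this

end IsCycleSeq

theorem IsLabelling.exists_isCycleSeq {L : SimpleGraph ℕ} {w δ π : ℕ → ℕ} {u v inf : ℕ}
    (h : IsLabelling L w u v inf δ π) (hw : ∀ a, 1 ≤ w a) (huv : L.Adj u v) (hlt : δ v < inf) :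
    ∃ l, π^[l] v = u ∧ (∀ i < l, π^[i] v ≠ u) ∧ IsCycleSeq L (fun i => π^[i] v) (l + 1) ∧
      seqWeight w (fun i => π^[i] v) (l + 1) ≤ δ v := by
  obtain ⟨l, hl, hstep, hsum⟩ := h.exists_iterate_eq hw ⟨u, huv.symm⟩ hlt
  have hanti : StrictAntiOn (fun i => δ (π^[i] v)) (Set.Iic l) := by
    refine strictAntiOn_of_succ_lt Set.ordConnected_Iic fun i _ _ hi => ?_
    exact (hstep i (by simpa using hi)).2.2
  refine ⟨l, hl, fun i hi => (hstep i hi).1, ⟨?_, ?_, fun j hj => ?_, ?_⟩, hsum⟩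
  · by_contra! hlt
    obtain rfl | rfl : l = 0 ∨ l = 1 := by omega
    · exact huv.ne hl.symm
    · exact (hstep 0 one_pos).2.1.2 ⟨hl, rfl⟩
  · intro i hi j hj hij
    exact hanti.injOn (Nat.lt_succ_iff.1 hi) (Nat.lt_succ_iff.1 hj) (congrArg δ hij)
  · exact (hstep j (by omega)).2.1.1.symm
  · simpa [hl] using huv

variable {n : ℕ} {G : SimpleGraph (Fin n)} [DecidableRel G.Adj] {L : SimpleGraph ℕ}
  {w : ℕ → ℕ} {q u v inf m : ℕ} {f : ℕ → ℕ} {s st : Store} {S : ℕ → ℕ → Prop}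

/-- Append the vertex in `rCur` to the current row. -/
def pushP : ForProg :=
  store aRow (get aMul (var rCnt) + var rLen) (var rCur) ;;
  rLen ≔ var rLen + const 1

/-- Write the path from the vertex in `rDst` to the vertex in `rSrc` that follows the predecessors
into the current row. -/
def extractP : ForProg :=
  rLen ≔ const 0 ;;
  rCur ≔ var rDst ;;
  forN rStep (ite (neE (var rCur) (var rSrc)) (pushP ;; rCur ≔ get aPred (var rCur)) skip) ;;
  pushP ;;
  store aLen (var rCnt) (var rLen)

/-- The rows of `s` before row `q` are still there, and the first `m` terms of `f` have been written
into row `q`. -/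
structure HoldsPrefix (n q : ℕ) (f : ℕ → ℕ) (s : Store) (m : ℕ) (st : Store) : Prop where
  len_eq : st.var rLen = m
  row : ∀ j < m, st.arr aRow (q * n + j) = f j
  before : ∀ i < q * n, st.arr aRow i = s.arr aRow i

theorem pushP_spec (h : HoldsGraph G st) (hq : st.var rCnt = q) (hqn : q ≤ n)
    (hP : HoldsPrefix n q f s m st) (hcur : st.var rCur = f m) :
    HoldsPrefix n q f s (m + 1) (pushP.run st) where
  len_eq := by simp [pushP, hP.len_eq]
  row j hj := by
    rcases Nat.lt_succ_iff_lt_or_eq.1 hj with hj | rfl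
    · simp [pushP, hq, h.mul q hqn, hP.len_eq, hj.ne, hP.row j hj]
    · simp [pushP, hq, h.mul q hqn, hP.len_eq, hcur]
  before i hi := by
    have hne : i ≠ q * n + m := by omega
    simp [pushP, hq, h.mul q hqn, hP.len_eq, hne, hP.before i hi]

theorem extractLoop_spec (h : HoldsQuery G L w u v st) (hq : st.var rCnt = q) (hqn : q ≤ n) {l : ℕ}
    (hln : l < n) (hl : (st.arr aPred)^[l] v = u) (hne : ∀ i < l, (st.arr aPred)^[i] v ≠ u)
    (hP : HoldsPrefix n q (fun j => (st.arr aPred)^[j] v) s 0 st) (hcur : st.var rCur = v) :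
    let st' := (forN rStep (ite (neE (var rCur) (var rSrc))
      (pushP ;; rCur ≔ get aPred (var rCur)) skip)).run st
    HoldsPrefix n q (fun j => (st.arr aPred)^[j] v) s l st' ∧ st'.var rCur = u := by
  have key := run_forN_induction (x := rStep) (p := ite (neE (var rCur) (var rSrc))
    (pushP ;; rCur ≔ get aPred (var rCur)) skip) st (I := fun i st' =>
    HoldsPrefix n q (fun j => (st.arr aPred)^[j] v) s (min i l) st' ∧
      st'.var rCur = (st.arr aPred)^[min i l] v) ?_ ?_
  · rw [h.n_eq, min_eq_right hln.le, hl] at key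
    exact key
  · simpa [hcur] using (⟨by simpa using hP.len_eq, by simp, by simpa using hP.before⟩ :
      HoldsPrefix n q (fun j => (st.arr aPred)^[j] v) s 0 (st.setVar rStep 0))
  · intro i st' _ _ hst ⟨hpre, hcur'⟩
    have hQ := h.of_agreesOff hst
    have hpred : st'.arr aPred = st.arr aPred := hst.arr (by decide)
    by_cases hil : i < l
    · rw [min_eq_left hil.le] at hpre hcur'
      have hrun : (neE (var rCur) (var rSrc)).eval st' ≠ 0 := by
        simpa [hcur', hQ.src_eq] using hne i hil
      have hpush := pushP_spec hQ.toHoldsGraph ((hst.var (by decide)).trans hq) hqn hpre hcur'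
      have hfr := run_agreesOff pushP st'
      have hcur₂ : (pushP.run st').var rCur = st'.var rCur := hfr.var (by decide)
      have hpred₂ : (pushP.run st').arr aPred = st'.arr aPred := hfr.arr (by decide)
      rw [min_eq_left (Nat.succ_le_of_lt hil), run_ite_of_ne hrun]
      refine ⟨⟨by simpa using hpush.len_eq, by simpa using hpush.row, by simpa using hpush.before⟩,
        ?_⟩
      simp [hcur₂, hpred₂, hpred, hcur', Function.iterate_succ_apply']
    · rw [min_eq_right (by omega)] at hpre hcur' ⊢
      rw [run_ite_of_eq (by simp [hcur', hQ.src_eq, hl]), run_skip]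
      exact ⟨⟨by simpa using hpre.len_eq, by simpa using hpre.row, by simpa using hpre.before⟩,
        by simpa using hcur'⟩

theorem extractP_spec (h : HoldsQuery G L w u v st) (hq : st.var rCnt = q) (hqn : q ≤ n) {l : ℕ}
    (hln : l < n) (hl : (st.arr aPred)^[l] v = u) (hne : ∀ i < l, (st.arr aPred)^[i] v ≠ u) :
    (∀ j ≤ l, (extractP.run st).arr aRow (q * n + j) = (st.arr aPred)^[j] v) ∧
    (∀ i < q * n, (extractP.run st).arr aRow i = st.arr aRow i) ∧
    (extractP.run st).arr aLen = Function.update (st.arr aLen) q (l + 1) := by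
  let st₁ := (rLen ≔ const 0 ;; rCur ≔ var rDst).run st
  have hst₁ : st.AgreesOff _ _ st₁ := run_agreesOff (rLen ≔ const 0 ;; rCur ≔ var rDst) st
  obtain ⟨hpre, hcur⟩ := extractLoop_spec (s := st) (h.of_agreesOff hst₁)
    ((hst₁.var (by decide)).trans hq) hqn hln hl hne ⟨by simp [st₁], by simp, by simp [st₁]⟩
    (by simp [st₁, h.dst_eq])
  have hst₂ := run_agreesOff (forN rStep (ite (neE (var rCur) (var rSrc))
    (pushP ;; rCur ≔ get aPred (var rCur)) skip)) st₁
  set st₂ := (forN rStep (ite (neE (var rCur) (var rSrc))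
    (pushP ;; rCur ≔ get aPred (var rCur)) skip)).run st₁
  have hq₂ : st₂.var rCnt = q := (hst₂.var (by decide)).trans ((hst₁.var (by decide)).trans hq)
  have hpush := pushP_spec ((h.of_agreesOff hst₁).of_agreesOff hst₂).toHoldsGraph hq₂ hqn hpre
    (hcur.trans hl.symm)
  have hst₃ := run_agreesOff pushP st₂
  have hq₃ : (pushP.run st₂).var rCnt = q := (hst₃.var (by decide)).trans hq₂
  have hlen : (pushP.run st₂).arr aLen = st.arr aLen :=
    (hst₃.arr (by decide)).trans ((hst₂.arr (by decide)).trans (hst₁.arr (by decide)))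
  have hrun : extractP.run st = (pushP.run st₂).setArr aLen q (l + 1) := by
    have : extractP.run st = (store aLen (var rCnt) (var rLen)).run (pushP.run st₂) := rfl
    rw [this, run_store, eval_var, eval_var, hq₃, hpush.len_eq]
  rw [hrun]
  refine ⟨fun j hj => ?_, fun i hi => ?_, by simp [hlen]⟩
  · exact hpush.row j (by omega)
  · simpa using hpush.before i hi

variable (n L w q inf s S) in
/-- The memory holds in row `q` a cycle of `L` whose weight is at most the content of `rBest`,
unless the latter is `inf`; no cycle whose closing edge is in `S` is lighter. The other rows are
those of `s`. -/
structure HoldsBest (st : Store) : Prop where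
  le_inf : st.var rBest ≤ inf
  cycle : st.var rBest < inf → IsCycleSeq L (fun j => st.arr aRow (q * n + j)) (st.arr aLen q) ∧
    seqWeight w (fun j => st.arr aRow (q * n + j)) (st.arr aLen q) ≤ st.var rBest
  minimal : ∀ f len, IsCycleSeq L f len → S (f 0) (f (len - 1)) → st.var rBest ≤ seqWeight w f len
  rows : ∀ i < q * n, st.arr aRow i = s.arr aRow i
  lens : ∀ q', q' ≠ q → st.arr aLen q' = s.arr aLen q'

theorem HoldsBest.mono {S' : ℕ → ℕ → Prop} {st' : Store} (h : HoldsBest n L w q inf s S st)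
    (hbest : st'.var rBest = st.var rBest) (hrow : st'.arr aRow = st.arr aRow)
    (hlen : st'.arr aLen = st.arr aLen) (hS : ∀ a b, L.Adj b a → S' a b → S a b) :
    HoldsBest n L w q inf s S' st' where
  le_inf := hbest ▸ h.le_inf
  cycle := by rw [hbest, hrow, hlen]; exact h.cycle
  minimal f len hf hs := hbest ▸ h.minimal f len hf (hS _ _ hf.adj_last hs)
  rows := by rw [hrow]; exact h.rows
  lens := by rw [hlen]; exact h.lens

/-- Replace the best cycle by the lightest cycle through the vertices in `rSrc` and `rDst`, if it is
lighter. -/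
def updateBestP : ForProg :=
  ite (var rBest - get aDist (var rDst))
    (rBest ≔ get aDist (var rDst) ;;
     extractP)
    skip

theorem updateBestP_spec (h : HoldsQuery G L w u v st) (hw : ∀ a, 1 ≤ w a) (huv : L.Adj u v)
    (hq : st.var rCnt = q) (hqn : q ≤ n)
    (hlab : IsLabelling L w u v inf (st.arr aDist) (st.arr aPred))
    (hwalks : BoundsWalks L w u v n (st.arr aDist)) (hB : HoldsBest n L w q inf s S st) :
    HoldsBest n L w q inf s (fun a b => S a b ∨ a = u ∧ b = v) (updateBestP.run st) := by
  have hlight {f len} (hf : IsCycleSeq L f len) (h0 : f 0 = u) (h1 : f (len - 1) = v) :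
      st.arr aDist v ≤ seqWeight w f len :=
    hf.dist_le_seqWeight hwalks (fun _ _ => h.lt_of_adj) h0 h1
  have hle := hB.le_inf
  by_cases hlt : st.arr aDist v < st.var rBest
  · obtain ⟨l, hl, hne, hcycle, hsum⟩ := hlab.exists_isCycleSeq hw huv (hlt.trans_le hle)
    have hst : st.AgreesOff [rBest] [] (st.setVar rBest (st.arr aDist v)) :=
      Store.agreesOff_setVar (by decide) _ _ _
    obtain ⟨hrow, hrows, hlens⟩ := extractP_spec (h.of_agreesOff hst)
      ((hst.var (by decide)).trans hq) hqn (hcycle.len_le fun _ _ => h.lt_of_adj) hl hne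
    have hbest := run_var (p := extractP) (x := rBest) (by decide)
      (st.setVar rBest (st.arr aDist v))
    rw [updateBestP, run_ite_of_ne (by simp [h.dst_eq]; omega), run_seq, run_assign, eval_get,
      eval_var, h.dst_eq]
    simp only [Store.var_setVar, if_true] at hbest
    refine ⟨by omega, fun _ => ?_, fun f len hf hs => ?_, fun i hi => ?_, fun q' hq' => ?_⟩
    · rw [hlens, hbest, Function.update_self,
        seqWeight_congr fun j hj => hrow j (Nat.lt_succ_iff.1 hj)]
      exact ⟨hcycle.congr fun j hj => (hrow j (by omega)).symm, hsum⟩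
    · rw [hbest]
      exact hs.elim (fun hs => hlt.le.trans (hB.minimal f len hf hs)) fun hs => hlight hf hs.1 hs.2
    · exact (hrows i hi).trans (hB.rows i hi)
    · rw [hlens, Function.update_of_ne hq']
      exact hB.lens q' hq'
  · rw [updateBestP, run_ite_of_eq (by simp [h.dst_eq]; omega), run_skip]
    exact ⟨hB.le_inf, hB.cycle, fun f len hf hs => hs.elim (hB.minimal f len hf) fun hs =>
      (not_lt.1 hlt).trans (hlight hf hs.1 hs.2), hB.rows, hB.lens⟩

/-- Search for a lightest cycle through the edge between the vertices in `rSrc` and `rDst`, if there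
is such an edge. -/
def edgeP : ForProg :=
  ite (liveE rSrc rDst)
    (distP ;;
     updateBestP)
    skip

theorem edgeP_spec (h : HoldsNetwork G L w st) (hw : ∀ a, 1 ≤ w a) (hu : st.var rSrc < n)
    (hv : st.var rDst < n) (hq : st.var rCnt = q) (hqn : q ≤ n) (hinf : st.var rInf = inf)
    (hB : HoldsBest n L w q inf s S st) :
    HoldsBest n L w q inf s (fun a b => S a b ∨ a = st.var rSrc ∧ b = st.var rDst)
      (edgeP.run st) := by
  have hlive := h.eval_liveE_eq_zero hu hv
  by_cases hadj : L.Adj (st.var rSrc) (st.var rDst)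
  · have hQ : HoldsQuery G L w (st.var rSrc) (st.var rDst) st := ⟨h, rfl, rfl⟩
    obtain ⟨hlab, hwalks⟩ := distP_spec hQ hinf hu
    have hfr := run_agreesOff distP st
    rw [edgeP, run_ite_of_ne (by simpa [hlive] using hadj), run_seq]
    exact updateBestP_spec (hQ.of_agreesOff hfr) hw hadj ((hfr.var (by decide)).trans hq) hqn hlab
      hwalks (hB.mono (hfr.var (by decide)) (hfr.arr (by decide)) (hfr.arr (by decide))
        fun _ _ _ => id)
  · rw [edgeP, run_ite_of_eq (hlive.2 hadj), run_skip]
    refine hB.mono rfl rfl rfl fun a b hab => Or.rec id ?_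
    rintro ⟨rfl, rfl⟩
    exact absurd hab.symm hadj

theorem edgeRow_spec (h : HoldsNetwork G L w st) (hw : ∀ a, 1 ≤ w a) (hu : st.var rSrc < n)
    (hq : st.var rCnt = q) (hqn : q ≤ n) (hinf : st.var rInf = inf)
    (hB : HoldsBest n L w q inf s S st) :
    HoldsBest n L w q inf s (fun a b => S a b ∨ a = st.var rSrc) ((forN rDst edgeP).run st) := by
  have key := run_forN_induction (x := rDst) (p := edgeP) st (I := fun i st' =>
    HoldsBest n L w q inf s (fun a b => S a b ∨ a = st.var rSrc ∧ b < i) st')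
    (hB.mono (by simp) rfl rfl (by simp)) ?_
  · rw [h.n_eq] at key
    exact key.mono rfl rfl rfl fun a b hab => Or.imp_right fun ha => ⟨ha, h.lt_of_adj hab.symm⟩
  · intro i st' hi hdst hst hI
    have hsrc : st'.var rSrc = st.var rSrc := hst.var (by decide)
    rw [h.n_eq] at hi
    refine (edgeP_spec (h.of_agreesOff hst) hw (by omega) (by omega)
      ((hst.var (by decide)).trans hq) hqn ((hst.var (by decide)).trans hinf) hI).mono
      (by simp) rfl rfl ?_
    grind

/-- Find a lightest cycle of the remaining graph. All cycles are lighter than the content of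
`rInf`. -/
def searchP : ForProg :=
  rInf ≔ get aMul (var rN) + (var rN + const 1) ;;
  rBest ≔ var rInf ;;
  forN rSrc (forN rDst edgeP)

theorem searchP_spec (h : HoldsNetwork G L w s) (hw : ∀ a, 1 ≤ w a) (hqn : s.var rCnt ≤ n) :
    (searchP.run s).var rInf = n * n + (n + 1) ∧
    HoldsBest n L w (s.var rCnt) (n * n + (n + 1)) s (fun _ _ => True) (searchP.run s) := by
  let s₁ := (rInf ≔ get aMul (var rN) + (var rN + const 1) ;; rBest ≔ var rInf).run s
  have hs₁ : s.AgreesOff _ _ s₁ :=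
    run_agreesOff (rInf ≔ get aMul (var rN) + (var rN + const 1) ;; rBest ≔ var rInf) s
  have hinf : s₁.var rInf = n * n + (n + 1) := by simp [s₁, h.n_eq, h.mul n le_rfl]
  have hbest : s₁.var rBest = n * n + (n + 1) := by simp [s₁, h.n_eq, h.mul n le_rfl]
  have h₁ := h.of_agreesOff hs₁
  have key := run_forN_induction (x := rSrc) (p := forN rDst edgeP) s₁ (I := fun i st =>
    HoldsBest n L w (s.var rCnt) (n * n + (n + 1)) s (fun a _ => a < i) st)
    ⟨by simp [hbest], by simp [hbest], by simp, by simp [s₁], by simp [s₁]⟩ ?_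
  · rw [h₁.n_eq] at key
    exact ⟨(run_var (p := forN rSrc (forN rDst edgeP)) (by decide) s₁).trans hinf,
      key.mono rfl rfl rfl fun a b hab _ => h.lt_of_adj hab⟩
  · intro i st hi hsrc hst hI
    rw [h₁.n_eq] at hi
    refine (edgeRow_spec (h₁.of_agreesOff hst) hw (by omega)
      ((hst.var (by decide)).trans (hs₁.var (by decide))) hqn
      ((hst.var (by decide)).trans hinf) hI).mono (by simp) rfl rfl ?_
    grind

end LightestCycles

/-! ### Deletion of neighbourhoods -/

section Deletion

/-- From `s` to `st`, the remaining vertices in `K` have been deleted and marked in the current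
round. -/
structure HasKilled (K : ℕ → Prop) (s st : Store) : Prop where
  killed : ∀ w, s.arr aDead w = 0 → K w →
    st.arr aDead w = s.var rRound + 1 ∧ st.arr aMark w = 1
  kept : ∀ w, ¬ (s.arr aDead w = 0 ∧ K w) →
    st.arr aDead w = s.arr aDead w ∧ st.arr aMark w = s.arr aMark w

namespace HasKilled

variable {K K' : ℕ → Prop} {s s' st st' : Store}

theorem refl (s : Store) : HasKilled (fun _ => False) s s :=
  ⟨fun _ _ h => h.elim, fun _ _ => ⟨rfl, rfl⟩⟩

theorem congr (h : HasKilled K s st) (hK : ∀ w, K w ↔ K' w) (hd : st'.arr aDead = st.arr aDead)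
    (hm : st'.arr aMark = st.arr aMark) : HasKilled K' s st' := by
  obtain rfl : K = K' := funext fun w => propext (hK w)
  exact ⟨by rw [hd, hm]; exact h.killed, by rw [hd, hm]; exact h.kept⟩

theorem trans (h : HasKilled K s st) (hd : s'.arr aDead = st.arr aDead)
    (hm : s'.arr aMark = st.arr aMark) (hr : s'.var rRound = s.var rRound)
    (h' : HasKilled K' s' st') : HasKilled (fun w => K w ∨ K' w) s st' := by
  constructor <;> intro w <;>
  · have := h.killed w
    have := h.kept w
    have := h'.killed w
    have := h'.kept w
    grind

end HasKilled

/-- Delete the vertex in `rW`, unless it has been deleted before. -/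
def killOneP : ForProg :=
  ite (get aDead (var rW)) skip
    (store aDead (var rW) (var rRound + const 1) ;;
     store aMark (var rW) (const 1))

/-- Delete the vertex in `rCenter` and its neighbours. -/
def killStarP : ForProg :=
  rW ≔ var rCenter ;;
  killOneP ;;
  forN rW (ite (adjE rCenter rW) killOneP skip)

/-- Delete the vertices of the current row that are heavier than 1, its first vertex, and all their
neighbours. -/
def killP : ForProg :=
  forN rStep (ite (get aLen (var rCnt) - var rStep)
    (rCenter ≔ get aRow (get aMul (var rCnt) + var rStep) ;;
     ite ((const 1 - var rStep) + (get aWeight (var rCenter) - const 1)) killStarP skip)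
    skip)

variable {n : ℕ} {G : SimpleGraph (Fin n)} [DecidableRel G.Adj] {s : Store}

theorem killOneP_spec (s : Store) : HasKilled (fun w => w = s.var rW) s (killOneP.run s) := by
  by_cases hd : s.arr aDead (s.var rW) = 0
  · rw [killOneP, run_ite_of_eq (by simpa using hd)]
    constructor
    · rintro w - rfl
      simp
    · intro w hw
      have hne : w ≠ s.var rW := fun h => hw ⟨h ▸ hd, h⟩
      simp [hne]
  · rw [killOneP, run_ite_of_ne (by simpa using hd), run_skip]
    exact ⟨by rintro w h rfl; exact absurd h hd, fun _ _ => ⟨rfl, rfl⟩⟩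

theorem killStarP_spec (h : HoldsGraph G s) (hc : s.var rCenter < n) :
    HasKilled (fun w => w = s.var rCenter ∨ (natGraph G).Adj (s.var rCenter) w) s
      (killStarP.run s) := by
  let s₁ := (rW ≔ var rCenter ;; killOneP).run s
  have hs₁ : s.AgreesOff _ _ s₁ := run_agreesOff (rW ≔ var rCenter ;; killOneP) s
  have hcenter : HasKilled (fun w => w = s.var rCenter) s s₁ := by
    exact ((HasKilled.refl s).trans (s' := s.setVar rW (s.var rCenter)) rfl rfl (by simp)
      (killOneP_spec _)).congr (by simp) rfl rfl
  have key := run_forN_induction (x := rW) (p := ite (adjE rCenter rW) killOneP skip) s₁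
    (I := fun i st => HasKilled (fun w => w = s.var rCenter ∨
      w < i ∧ (natGraph G).Adj (s.var rCenter) w) s st) (hcenter.congr (by simp) rfl rfl) ?_
  · rw [(h.of_agreesOff hs₁).n_eq] at key
    exact key.congr (fun w => or_congr_right (and_iff_right_of_imp fun ⟨_, hw, _⟩ => hw)) rfl rfl
  · intro i st hi hW hst hI
    rw [(h.of_agreesOff hs₁).n_eq] at hi
    have hC : st.var rCenter = s.var rCenter := (hst.var (by decide)).trans (hs₁.var (by decide))
    have hadj := ((h.of_agreesOff hs₁).of_agreesOff hst).eval_adjE (a := rCenter) (b := rW)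
      (by omega) (by omega)
    rw [hC, hW] at hadj
    by_cases hi : (natGraph G).Adj (s.var rCenter) i
    · rw [run_ite_of_ne (by simp [hadj, hi])]
      exact (hI.trans rfl rfl ((hst.var (by decide)).trans (hs₁.var (by decide)))
        (killOneP_spec st)).congr (by grind) rfl rfl
    · rw [run_ite_of_eq (by simp [hadj, hi]), run_skip]
      exact hI.congr (by grind) rfl rfl

/-- The vertex `x` is in the closed neighbourhood of one of the first `i` terms of `f`, which is
the first term or heavier than 1. -/
def IsNear (L : SimpleGraph ℕ) (w f : ℕ → ℕ) (i x : ℕ) : Prop :=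
  ∃ j < i, (j = 0 ∨ 1 < w (f j)) ∧ (x = f j ∨ L.Adj (f j) x)

theorem isNear_succ {L : SimpleGraph ℕ} {w f : ℕ → ℕ} {i x : ℕ} :
    IsNear L w f (i + 1) x ↔
      IsNear L w f i x ∨ (i = 0 ∨ 1 < w (f i)) ∧ (x = f i ∨ L.Adj (f i) x) := by
  constructor
  · rintro ⟨j, hj, h⟩
    obtain hj | rfl := Nat.lt_succ_iff_lt_or_eq.1 hj
    · exact Or.inl ⟨j, hj, h⟩
    · exact Or.inr h
  · rintro (⟨j, hj, h⟩ | h)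
    · exact ⟨j, by omega, h⟩
    · exact ⟨i, by omega, h⟩

theorem killP_spec (h : HoldsGraph G s) {q len : ℕ} {f : ℕ → ℕ} (hq : s.var rCnt = q) (hqn : q ≤ n)
    (hlen : s.arr aLen q = len) (hlen_le : len ≤ n)
    (hf : ∀ j < len, s.arr aRow (q * n + j) = f j ∧ f j < n) :
    HasKilled (IsNear (natGraph G) (s.arr aWeight) f len) s (killP.run s) := by
  have key := run_forN_induction (x := rStep) (p := ite (get aLen (var rCnt) - var rStep)
    (rCenter ≔ get aRow (get aMul (var rCnt) + var rStep) ;;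
     ite ((const 1 - var rStep) + (get aWeight (var rCenter) - const 1)) killStarP skip) skip) s
    (I := fun i st => HasKilled (IsNear (natGraph G) (s.arr aWeight) f (min i len)) s st)
    ((HasKilled.refl s).congr (by simp [IsNear]) rfl rfl) ?_
  · rw [h.n_eq, min_eq_right hlen_le] at key
    exact key
  · intro i st _ hstep hst hI
    have hG := h.of_agreesOff hst
    have hq' : st.var rCnt = q := (hst.var (by decide)).trans hq
    have hlen' : st.arr aLen q = len := (congrFun (hst.arr (by decide)) q).trans hlen
    by_cases hi : i < len
    · have hcur : st.arr aRow (st.arr aMul q + i) = f i := by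
        rw [hst.arr (by decide), hG.mul q hqn, (hf i hi).1]
      have hweight : st.arr aWeight = s.arr aWeight := hst.arr (by decide)
      rw [min_eq_left hi.le] at hI
      rw [min_eq_left (Nat.succ_le_of_lt hi), run_ite_of_ne (by simp [hq', hlen', hstep]; omega),
        run_seq, run_assign, eval_get, eval_add, eval_get, eval_var, eval_var, hq', hstep, hcur]
      by_cases hheavy : i = 0 ∨ 1 < s.arr aWeight (f i)
      · rw [run_ite_of_ne (by simp [hstep, hweight]; omega)]
        have hstar := killStarP_spec (s := st.setVar rCenter (f i))
          (hG.of_agreesOff (Store.agreesOff_setVar (xs := [rCenter]) (by decide) [] _ _))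
          (by simpa using (hf i hi).2)
        exact (hI.trans (s' := st.setVar rCenter (f i)) rfl rfl
          (by simpa using hst.var (by decide)) hstar).congr
          (fun x => by simp [isNear_succ, hheavy]) rfl rfl
      · rw [run_ite_of_eq (by simp [hstep, hweight]; omega), run_skip]
        exact hI.congr (fun x => by simp [isNear_succ, hheavy]) rfl rfl
    · rw [min_eq_right (by omega)] at hI ⊢
      rw [run_ite_of_eq (by simp [hq', hlen', hstep]; omega), run_skip]
      exact hI.congr (fun _ => Iff.rfl) rfl rfl

end Deletion

/-! ### The history of the greedy deletion -/

section GreedyHistory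

section Rounds

variable {n : ℕ} (G : SimpleGraph (Fin n)) [DecidableRel G.Adj] (τ : Fin n → ℕ)
  (Z : Finset (Fin n)) (E : Fin n → Fin (n + 1)) (j : ℕ)

/-- At time `j` only the vertex `d` was deleted. At most one neighbour of it was present, and `E d`
is this neighbour. -/
structure IsPruneRound (d : Fin n) : Prop where
  eq_iff : ∀ v, τ v = j ↔ v = d
  notMem : d ∉ Z
  card_le : #(aliveNbrs G τ j d) ≤ 1
  parent_iff : ∀ u, E d = Fin.castSucc u ↔ u ∈ aliveNbrs G τ j d

/-- The vertices around which the stars are deleted when the cycle `c` is chosen at time `j`. -/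
def starCenters {r : Fin n} (c : G.Walk r r) : Finset (Fin n) :=
  {v ∈ c.support.toFinset | v = r ∨ 3 ≤ #(aliveNbrs G τ j v)}

/-- At time `j` the cycle `c` was chosen, and the vertices deleted at that time belong to the stars
around `starCenters G τ j c`. -/
structure IsKillRound {r : Fin n} (c : G.Walk r r) : Prop extends ChosenAt G τ j c where
  two_le : ∀ v, j ≤ τ v → 2 ≤ #(aliveNbrs G τ j v)
  star : ∀ z, τ z = j →
    z ∈ Z ∧ E z = Fin.last n ∧ ∃ x ∈ starCenters G τ j c, z = x ∨ G.Adj z x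
  short : ∀ u, ∀ c' : (aliveGraph G τ j).Walk u u, c'.IsCycle →
    #(starCenters G τ j c) ≤ cost (aliveBranch G τ j) c' + 1

/-- What is recorded after `i` rounds, where `τ v = n` means that `v` has not been deleted. The
cycles were chosen at the times `T 0 < ⋯ < T (cnt - 1)`; the `q`-th one has length `lens q` and its
vertices are in the `q`-th row of length `n` of `rows`. -/
structure History (i : ℕ) (cnt : ℕ) (T lens rows : ℕ → ℕ) : Prop where
  time : ∀ v, τ v < i ∨ τ v = n
  remaining : ∀ v, τ v = n → v ∉ Z ∧ E v = Fin.last n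
  mono : ∀ q q', q < q' → q' < cnt → T q < T q'
  kill : ∀ q < cnt, T q < i ∧ ∃ (r : Fin n) (c : G.Walk r r), IsKillRound G τ Z E (T q) c ∧
    c.length = lens q ∧ lens q ≤ n ∧ ∀ l < c.length, rows (q * n + l) = c.getVert l
  round : ∀ j < i,
    (∃ q < cnt, T q = j) ∨ (∃ d, IsPruneRound G τ Z E j d) ∨ ∀ v, τ v < j

end Rounds

variable {n i j cnt : ℕ} {G : SimpleGraph (Fin n)} [DecidableRel G.Adj] {τ τ' : Fin n → ℕ}
  {Z Z' : Finset (Fin n)} {E E' : Fin n → Fin (n + 1)} {T lens rows lens' rows' : ℕ → ℕ}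
  {d r v x : Fin n} {c : G.Walk r r}

theorem mem_starCenters :
    x ∈ starCenters G τ j c ↔ x ∈ c.support ∧ (x = r ∨ 3 ≤ #(aliveNbrs G τ j x)) := by
  simp [starCenters]

theorem ChosenAt.time_eq_of_mem (h : ChosenAt G τ j c) (hx : x ∈ starCenters G τ j c) :
    τ x = j :=
  (h.deleted x (mem_starCenters.1 hx).1 (mem_starCenters.1 hx).2).1

section Advance

/-- The records `τ'`, `Z'`, `E'` arise from `τ`, `Z`, `E` by deleting some of the remaining vertices
in round `i`. -/
structure Advance {n : ℕ} (i : ℕ) (τ τ' : Fin n → ℕ) (Z Z' : Finset (Fin n))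
    (E E' : Fin n → Fin (n + 1)) : Prop where
  lt : i < n
  eq_or : ∀ v, τ' v = τ v ∨ τ v = n ∧ τ' v = i
  mem_iff : ∀ v, τ v < i → (v ∈ Z' ↔ v ∈ Z)
  parent_eq : ∀ v, τ v < i → E' v = E v
  remaining : ∀ v, τ' v = n → v ∉ Z' ∧ E' v = Fin.last n

namespace Advance

variable (h : Advance i τ τ' Z Z' E E')
include h

theorem le_iff (hj : j ≤ i) (v : Fin n) : j ≤ τ' v ↔ j ≤ τ v := by
  grind [h.lt, h.eq_or v]

theorem eq_iff (hj : j < i) (v : Fin n) : τ' v = j ↔ τ v = j := by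
  grind [h.lt, h.eq_or v]

theorem aliveNbrs_eq (hj : j ≤ i) (v : Fin n) : aliveNbrs G τ' j v = aliveNbrs G τ j v := by
  ext u
  simp only [mem_aliveNbrs, h.le_iff hj]

omit [DecidableRel G.Adj] in
theorem aliveGraph_eq (hj : j ≤ i) : aliveGraph G τ' j = aliveGraph G τ j := by
  ext u v
  simp only [aliveGraph_adj, h.le_iff hj]

theorem aliveBranch_eq (hj : j ≤ i) : aliveBranch G τ' j = aliveBranch G τ j := by
  ext u
  simp only [mem_aliveBranch, h.le_iff hj, h.aliveNbrs_eq hj]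

theorem starCenters_eq (hj : j ≤ i) (c : G.Walk r r) :
    starCenters G τ' j c = starCenters G τ j c := by
  simp only [starCenters, h.aliveNbrs_eq hj]

theorem isPruneRound (hj : j < i) (hd : IsPruneRound G τ Z E j d) :
    IsPruneRound G τ' Z' E' j d := by
  have hlt : τ d < i := ((hd.eq_iff d).2 rfl).trans_lt hj
  constructor
  · simpa only [h.eq_iff hj] using hd.eq_iff
  · simpa only [h.mem_iff d hlt] using hd.notMem
  · simpa only [h.aliveNbrs_eq hj.le] using hd.card_le
  · simpa only [h.aliveNbrs_eq hj.le, h.parent_eq d hlt] using hd.parent_iff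

theorem isKillRound (hj : j < i) (hc : IsKillRound G τ Z E j c) : IsKillRound G τ' Z' E' j c where
  isCycle := hc.isCycle
  le := by simpa only [h.le_iff hj.le] using hc.le
  deleted := by
    simpa only [h.aliveNbrs_eq hj.le, h.le_iff hj.le, h.eq_iff hj] using hc.deleted
  two_le := by simpa only [h.aliveNbrs_eq hj.le, h.le_iff hj.le] using hc.two_le
  star z hz := by
    have hz := (h.eq_iff hj z).1 hz
    rw [h.mem_iff z (hz ▸ hj), h.parent_eq z (hz ▸ hj), h.starCenters_eq hj.le]
    exact hc.star z hz
  short := by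
    rw [h.aliveGraph_eq hj.le, h.aliveBranch_eq hj.le, h.starCenters_eq hj.le]
    exact hc.short

end Advance

end Advance

namespace History

theorem remaining_of_le (h : History G τ Z E i cnt T lens rows) (hv : i ≤ τ v) : τ v = n :=
  (h.time v).resolve_left hv.not_gt

theorem cnt_le (h : History G τ Z E i cnt T lens rows) : cnt ≤ i := by
  have hT : Set.InjOn T (range cnt) := StrictMonoOn.injOn fun q _ q' hq' hqq' =>
    h.mono q q' hqq' (mem_range.1 hq')
  have := card_le_card_of_injOn (s := range cnt) (t := range i) T
    (fun q hq => mem_range.2 (h.kill q (mem_range.1 hq)).1) hT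
  simpa using this

theorem congr (h : History G τ Z E i cnt T lens rows) (hlens : ∀ q < cnt, lens' q = lens q)
    (hrows : ∀ l < cnt * n, rows' l = rows l) : History G τ Z E i cnt T lens' rows' where
  time := h.time
  remaining := h.remaining
  mono := h.mono
  kill q hq := by
    obtain ⟨hT, r, c, hc, hlen, hle, hrow⟩ := h.kill q hq
    rw [hlens q hq]
    refine ⟨hT, r, c, hc, hlen, hle, fun l hl => ?_⟩
    rw [hrows, hrow l hl]
    calc q * n + l < (q + 1) * n := by rw [Nat.succ_mul]; omega
      _ ≤ cnt * n := Nat.mul_le_mul_right n hq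
  round := h.round

theorem kill_advance (h : History G τ Z E i cnt T lens rows) (ha : Advance i τ τ' Z Z' E E') :
    ∀ q < cnt, T q < i + 1 ∧ ∃ (r : Fin n) (c : G.Walk r r), IsKillRound G τ' Z' E' (T q) c ∧
      c.length = lens q ∧ lens q ≤ n ∧ ∀ l < c.length, rows (q * n + l) = c.getVert l := by
  intro q hq
  obtain ⟨hT, r, c, hc, hrest⟩ := h.kill q hq
  exact ⟨by omega, r, c, ha.isKillRound hT hc, hrest⟩

theorem time_advance (h : History G τ Z E i cnt T lens rows) (ha : Advance i τ τ' Z Z' E E')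
    (v : Fin n) : τ' v < i + 1 ∨ τ' v = n := by
  grind [h.time v, ha.eq_or v]

theorem round_advance (h : History G τ Z E i cnt T lens rows) (ha : Advance i τ τ' Z Z' E E')
    (hj : j < i) : (∃ q < cnt, T q = j) ∨ (∃ d, IsPruneRound G τ' Z' E' j d) ∨ ∀ v, τ' v < j := by
  refine (h.round j hj).imp_right (Or.imp (Exists.imp fun d => ha.isPruneRound hj) ?_)
  simpa only [← not_le, ha.le_iff hj.le] using id

theorem succ_of_prune (h : History G τ Z E i cnt T lens rows) (ha : Advance i τ τ' Z Z' E E')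
    (hi : (∃ d, IsPruneRound G τ' Z' E' i d) ∨ ∀ v, τ' v < i) :
    History G τ' Z' E' (i + 1) cnt T lens rows where
  time := h.time_advance ha
  remaining := ha.remaining
  mono := h.mono
  kill := h.kill_advance ha
  round j hj := by
    obtain hj | rfl := Nat.lt_succ_iff_lt_or_eq.1 hj
    · exact h.round_advance ha hj
    · exact Or.inr hi

theorem succ_of_kill (h : History G τ Z E i cnt T lens rows) (ha : Advance i τ τ' Z Z' E E')
    (hc : IsKillRound G τ' Z' E' i c) (hlen : c.length = lens cnt) (hle : lens cnt ≤ n)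
    (hrow : ∀ l < c.length, rows (cnt * n + l) = c.getVert l) :
    History G τ' Z' E' (i + 1) (cnt + 1) (Function.update T cnt i) lens rows where
  time := h.time_advance ha
  remaining := ha.remaining
  mono q q' hqq' hq' := by
    rw [Function.update_of_ne (by omega)]
    obtain hq' | rfl := Nat.lt_succ_iff_lt_or_eq.1 hq'
    · rw [Function.update_of_ne hq'.ne]
      exact h.mono q q' hqq' hq'
    · rw [Function.update_self]
      exact (h.kill q hqq').1
  kill q hq := by
    obtain hq | rfl := Nat.lt_succ_iff_lt_or_eq.1 hq
    · rw [Function.update_of_ne hq.ne]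
      exact h.kill_advance ha q hq
    · rw [Function.update_self]
      exact ⟨Nat.lt_succ_self i, r, c, hc, hlen, hle, hrow⟩
  round j hj := by
    obtain hj | rfl := Nat.lt_succ_iff_lt_or_eq.1 hj
    · refine (h.round_advance ha hj).imp_left fun ⟨q, hq, hT⟩ => ⟨q, by omega, ?_⟩
      rw [Function.update_of_ne hq.ne, hT]
    · exact Or.inl ⟨cnt, Nat.lt_succ_self cnt, Function.update_self ..⟩

theorem exists_starCenters (h : History G τ Z E i cnt T lens rows) :
    ∃ X : Finset (Fin n), (∀ x ∈ X, ∃ q < cnt, τ x = T q) ∧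
      ∀ q < cnt, ∃ (r : Fin n) (c : G.Walk r r), IsKillRound G τ Z E (T q) c ∧
        starCenters G τ (T q) c = {x ∈ X | τ x = T q} := by
  choose _ r c hc _ using fun q : Fin cnt => h.kill q q.2
  have hT : Function.Injective fun q : Fin cnt => T q :=
    StrictMono.injective fun q q' hq => h.mono q q' hq q'.2
  refine ⟨univ.biUnion fun q : Fin cnt => starCenters G τ (T q) (c q), fun x hx => ?_,
    fun q hq => ⟨r ⟨q, hq⟩, c ⟨q, hq⟩, hc ⟨q, hq⟩, ?_⟩⟩
  · obtain ⟨q, -, hxq⟩ := mem_biUnion.1 hx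
    exact ⟨q, q.2, (hc q).time_eq_of_mem hxq⟩
  · ext x
    simp only [mem_filter, mem_biUnion, mem_univ, true_and]
    refine ⟨fun hx => ⟨⟨⟨q, hq⟩, hx⟩, (hc ⟨q, hq⟩).time_eq_of_mem hx⟩, ?_⟩
    rintro ⟨⟨q', hx⟩, hxq⟩
    obtain rfl : q' = ⟨q, hq⟩ := hT (((hc q').time_eq_of_mem hx).symm.trans hxq)
    exact hx

section Final

variable (h : History G τ Z E n cnt T lens rows)
include h

-- If `v` survived all rounds, then a vertex was deleted in each of the `n` rounds.
theorem time_lt (v : Fin n) : τ v < n := by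
  refine (h.time v).resolve_right fun hv => ?_
  have hsurj : range (n + 1) ⊆ univ.image τ := by
    intro j hj
    simp only [mem_image, mem_univ, true_and]
    obtain hj | rfl := Nat.lt_succ_iff_lt_or_eq.1 (mem_range.1 hj)
    · rcases h.round j hj with ⟨q, hq, rfl⟩ | ⟨d, hd⟩ | hidle
      · obtain ⟨-, r, c, hc, -⟩ := h.kill q hq
        exact ⟨r, (hc.deleted r c.start_mem_support (Or.inl rfl)).1⟩
      · exact ⟨d, (hd.eq_iff d).2 rfl⟩
      · exact absurd (hidle v) (by omega)
    · exact ⟨v, hv⟩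
  have := (card_le_card hsurj).trans card_image_le
  simp at this

theorem exists_kill_or_isPruneRound (v : Fin n) :
    (∃ q < cnt, T q = τ v) ∨ IsPruneRound G τ Z E (τ v) v := by
  rcases h.round (τ v) (h.time_lt v) with hq | ⟨d, hd⟩ | hidle
  · exact Or.inl hq
  · obtain rfl := (hd.eq_iff v).1 rfl
    exact Or.inr hd
  · exact absurd (hidle v) (lt_irrefl _)

theorem isPruneRound_of_notMem (hv : v ∉ Z) : IsPruneRound G τ Z E (τ v) v := by
  refine (h.exists_kill_or_isPruneRound v).resolve_left fun ⟨q, hq, hT⟩ => hv ?_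
  obtain ⟨-, r, c, hc, -⟩ := h.kill q hq
  exact (hc.star v hT.symm).1

theorem exists_isDismantling : ∃ X, IsDismantling G τ X Z ∧ #(X.image τ) ≤ cnt := by
  obtain ⟨X, hX, hkill⟩ := h.exists_starCenters
  refine ⟨X, ?_, ?_⟩
  · constructor
    · intro x hx
      obtain ⟨q, hq, hxq⟩ := hX x hx
      obtain ⟨r, c, hc, -⟩ := hkill q hq
      exact (hc.star x hxq).1
    · intro z hz
      obtain ⟨q, hq, hTz⟩ :=
        (h.exists_kill_or_isPruneRound z).resolve_right fun hz' => hz'.notMem hz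
      obtain ⟨r, c, hc, hcX⟩ := hkill q hq
      obtain ⟨-, -, x, hx, hzx⟩ := hc.star z hTz.symm
      obtain ⟨hxX, hxq⟩ := mem_filter.1 (hcX ▸ hx)
      exact ⟨x, hxX, hxq.trans hTz, hzx⟩
    · exact fun v hv => (h.isPruneRound_of_notMem hv).card_le
    · exact fun u _ v hv huv => ((h.isPruneRound_of_notMem hv).eq_iff u).1 huv
    · intro x hx
      obtain ⟨q, hq, hxq⟩ := hX x hx
      obtain ⟨r, c, hc, -⟩ := hkill q hq
      exact hxq ▸ hc.two_le
    · intro x hx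
      obtain ⟨q, hq, hxq⟩ := hX x hx
      obtain ⟨r, c, hc, hcX⟩ := hkill q hq
      rw [hxq, ← hcX]
      exact hc.short
  · have hsub : X.image τ ⊆ (range cnt).image T := by
      intro j hj
      obtain ⟨x, hx, rfl⟩ := mem_image.1 hj
      obtain ⟨q, hq, hxq⟩ := hX x hx
      exact mem_image.2 ⟨q, mem_range.2 hq, hxq.symm⟩
    simpa using (card_le_card hsub).trans card_image_le

theorem isParent : IsParent G τ Z E where
  lt v u hu := by
    rcases h.exists_kill_or_isPruneRound v with ⟨q, hq, hT⟩ | hv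
    · obtain ⟨-, r, c, hc, -⟩ := h.kill q hq
      exact absurd ((hc.star v hT.symm).2.1.symm.trans hu) (Fin.castSucc_lt_last u).ne'
    · obtain ⟨hadj, hle⟩ := mem_aliveNbrs.1 ((hv.parent_iff u).1 hu)
      exact hle.lt_of_ne fun heq => hadj.ne ((hv.eq_iff u).1 heq.symm).symm
  cover v hv u _ huv hle :=
    ((h.isPruneRound_of_notMem hv).parent_iff u).2 (mem_aliveNbrs.2 ⟨huv, hle⟩)

theorem exists_packing {k : ℕ} (hk : k ≤ cnt) :
    ∃ (root : Fin k → Fin n) (cyc : ∀ q, G.Walk (root q) (root q)),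
      IsInducedCyclePacking G root cyc ∧ ∀ q : Fin k, lens q = (cyc q).length ∧
        ∀ l < (cyc q).length, rows (q * n + l) = (cyc q).getVert l := by
  choose _ r c hc hlen _ hrow using fun q : Fin k => h.kill q (q.2.trans_le hk)
  exact ⟨r, c, isInducedCyclePacking_of_chosenAt (T := fun q => T q)
    (fun q q' hq => h.mono q q' hq (q'.2.trans_le hk)) (fun q => (hc q).toChosenAt)
    (fun q => (hc q).two_le), fun q => ⟨(hlen q).symm, hrow q⟩⟩

end Final

end History

end GreedyHistory

/-! ### Cycles of the remaining graph as sequences of numbers -/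

section Sequences

section Walks

variable {V : Type*} {G : SimpleGraph V}

theorem exists_walk_getVert (m : ℕ) (F : ℕ → V) (h : ∀ j < m, G.Adj (F j) (F (j + 1))) :
    ∃ p : G.Walk (F 0) (F m), p.length = m ∧ ∀ j ≤ m, p.getVert j = F j := by
  induction m generalizing F with
  | zero => exact ⟨.nil, rfl, by simp⟩
  | succ m ih =>
    obtain ⟨p, hlen, hget⟩ := ih (fun j => F (j + 1)) fun j hj => h (j + 1) (by omega)
    refine ⟨.cons (h 0 (by omega)) p, by simp [hlen], fun j hj => ?_⟩
    cases j with
    | zero => simp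
    | succ j => exact hget j (by omega)

theorem exists_lt_length_getVert_eq {r x : V} {c : G.Walk r r} (hc : 0 < c.length)
    (hx : x ∈ c.support) : ∃ j < c.length, c.getVert j = x := by
  obtain ⟨j, rfl, hj⟩ := SimpleGraph.Walk.mem_support_iff_exists_getVert.1 hx
  obtain hj | rfl := hj.lt_or_eq
  · exact ⟨j, hj, rfl⟩
  · exact ⟨0, hc, by simp⟩

end Walks

variable {n i len len' : ℕ} {G : SimpleGraph (Fin n)} {dead f f' : ℕ → ℕ} {τ : Fin n → ℕ}

theorem IsCycleSeq.mono {L L' : SimpleGraph ℕ} (h : IsCycleSeq L f len) (hL : L ≤ L') :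
    IsCycleSeq L' f len :=
  ⟨h.three_le, h.injOn, fun j hj => hL (h.adj j hj), hL h.adj_last⟩

theorem liveGraph_le : liveGraph G dead ≤ natGraph G := fun _ _ h => h.1

theorem exists_isCycle_of_isCycleSeq (h : IsCycleSeq (natGraph G) f len) :
    ∃ (r : Fin n) (c : G.Walk r r), c.IsCycle ∧ c.length = len ∧ ∀ j < len, f j = c.getVert j := by
  have hthree := h.three_le
  have hmod (j : ℕ) : j % len < len := Nat.mod_lt j (by omega)
  have hlt (j : ℕ) (hj : j < len) : f j < n := let ⟨_, _, hb, _⟩ := h.exists_adj hj; hb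
  let F : ℕ → Fin n := fun j => ⟨f (j % len), hlt _ (hmod j)⟩
  have hF : F len = F 0 := by simp [F]
  have hwalk := exists_walk_getVert (G := G) len F fun j hj => by
    rw [← natGraph_adj_val]
    simp only [F, Nat.mod_eq_of_lt hj]
    obtain hj' | hj' : j + 1 < len ∨ j + 1 = len := by omega
    · rw [Nat.mod_eq_of_lt hj']
      exact h.adj j hj'
    · rw [hj', Nat.mod_self, show j = len - 1 by omega]
      exact h.adj_last
  rw [hF] at hwalk
  obtain ⟨p, hlen, hget⟩ := hwalk
  refine ⟨F 0, p, ?_, hlen, fun j hj => ?_⟩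
  case refine_2 =>
    rw [hget j hj.le]
    simp only [F, Nat.mod_eq_of_lt hj]
  rw [SimpleGraph.Walk.isCycle_iff_isPath_tail_and_le_length]
  refine ⟨(SimpleGraph.Walk.IsPath.getVert_injOn_iff _).1 fun a ha b hb hab => ?_, by omega⟩
  have htail : p.tail.length + 1 = len := by
    rw [SimpleGraph.Walk.length_tail_add_one, hlen]
    rw [SimpleGraph.Walk.not_nil_iff_lt_length]
    omega
  simp only [Set.mem_ofPred_eq] at ha hb
  rw [SimpleGraph.Walk.getVert_tail, SimpleGraph.Walk.getVert_tail, hget _ (by omega),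
    hget _ (by omega)] at hab
  have hmodEq : a + 1 ≡ b + 1 [MOD len] := h.injOn (hmod _) (hmod _) (congrArg Fin.val hab)
  exact (Nat.ModEq.add_right_cancel' 1 hmodEq).eq_of_lt_of_lt (by omega) (by omega)

section Remaining

variable [DecidableRel G.Adj]

theorem count_liveGraph_eq (hτ : ∀ v : Fin n, i ≤ τ v ↔ dead v = 0) {v : Fin n} (hv : dead v = 0) :
    Nat.count ((liveGraph G dead).Adj v) n = #(aliveNbrs G τ i v) := by
  rw [Nat.count_eq_card_filter_range, ← card_map Fin.valEmbedding]
  congr 1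
  ext w
  simp only [mem_filter, mem_range, mem_map, mem_aliveNbrs, Fin.valEmbedding_apply, liveGraph_adj]
  constructor
  · rintro ⟨hw, hadj, -, hdead⟩
    exact ⟨⟨w, hw⟩, ⟨(natGraph_adj_val G).1 hadj, (hτ ⟨w, hw⟩).2 hdead⟩, rfl⟩
  · rintro ⟨w, ⟨hadj, hle⟩, rfl⟩
    exact ⟨w.2, (natGraph_adj_val G).2 hadj, hv, (hτ w).1 hle⟩

omit [DecidableRel G.Adj] in
theorem liveGraph_adj_val (hτ : ∀ v : Fin n, i ≤ τ v ↔ dead v = 0) {u v : Fin n} :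
    (liveGraph G dead).Adj u v ↔ (aliveGraph G τ i).Adj u v := by
  rw [liveGraph_adj, aliveGraph_adj, natGraph_adj_val, hτ, hτ]

omit [DecidableRel G.Adj] in
theorem isCycleSeq_of_isCycle (hτ : ∀ v : Fin n, i ≤ τ v ↔ dead v = 0) {u : Fin n}
    {c : (aliveGraph G τ i).Walk u u} (hc : c.IsCycle) :
    IsCycleSeq (liveGraph G dead) (fun j => c.getVert j) c.length := by
  have hthree := hc.three_le_length
  refine ⟨hthree, fun a ha b hb hab => ?_, fun j hj => ?_, ?_⟩
  · simp only [Set.mem_Iio] at ha hb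
    exact hc.getVert_injOn' (show a ≤ c.length - 1 by omega) (show b ≤ c.length - 1 by omega)
      (Fin.ext hab)
  · exact (liveGraph_adj_val hτ).2 (c.adj_getVert_succ (by omega))
  · have hadj := c.adj_getVert_succ (i := c.length - 1) (by omega)
    rw [Nat.sub_add_cancel (by omega), c.getVert_length] at hadj
    rw [c.getVert_zero]
    exact (liveGraph_adj_val hτ).2 hadj

theorem seqWeight_vertexWeight (n : ℕ) (L : SimpleGraph ℕ) [DecidableRel L.Adj] (f : ℕ → ℕ)
    (len : ℕ) : seqWeight (vertexWeight n L) f len =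
      len + n * #{j ∈ range len | 3 ≤ Nat.count (L.Adj (f j)) n} := by
  have hweight (v : ℕ) : vertexWeight n L v = 1 + if 3 ≤ Nat.count (L.Adj v) n then n else 0 := by
    unfold vertexWeight
    split_ifs <;> omega
  simp only [seqWeight, hweight, sum_add_distrib, ← sum_filter, sum_const, card_range, smul_eq_mul,
    mul_one]
  ring

theorem card_heavy_le_of_seqWeight_le {L : SimpleGraph ℕ} [DecidableRel L.Adj] (hlen : 0 < len)
    (hlen' : len' ≤ n)
    (h : seqWeight (vertexWeight n L) f len ≤ seqWeight (vertexWeight n L) f' len') :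
    #{j ∈ range len | 3 ≤ Nat.count (L.Adj (f j)) n} ≤
      #{j ∈ range len' | 3 ≤ Nat.count (L.Adj (f' j)) n} := by
  rw [seqWeight_vertexWeight, seqWeight_vertexWeight] at h
  by_contra! hlt
  have := Nat.mul_le_mul_left n (Nat.succ_le_of_lt hlt)
  rw [Nat.succ_eq_add_one, Nat.mul_add] at this
  omega

theorem card_heavy_le_cost (hτ : ∀ v : Fin n, i ≤ τ v ↔ dead v = 0) {u : Fin n}
    {c : (aliveGraph G τ i).Walk u u} (hc : c.IsCycle) :
    #{j ∈ range c.length | 3 ≤ Nat.count ((liveGraph G dead).Adj (c.getVert j)) n} ≤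
      cost (aliveBranch G τ i) c := by
  refine card_le_card_of_injOn c.getVert (fun j hj => ?_) fun a ha b hb => ?_
  · obtain ⟨hj, hdeg⟩ := mem_filter.1 hj
    have hle : i ≤ τ (c.getVert j) := (aliveGraph_adj.1 (c.adj_getVert_succ (mem_range.1 hj))).2.1
    rw [count_liveGraph_eq hτ ((hτ _).1 hle)] at hdeg
    exact mem_inter.2
      ⟨List.mem_toFinset.2 (c.getVert_mem_support j), mem_aliveBranch.2 ⟨hle, hdeg⟩⟩
  · have ha := mem_range.1 (mem_filter.1 ha).1
    have hb := mem_range.1 (mem_filter.1 hb).1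
    exact hc.getVert_injOn' (show a ≤ c.length - 1 by omega) (show b ≤ c.length - 1 by omega)

section Centers

variable {r : Fin n} {c : G.Walk r r}

theorem mem_starCenters_iff_getVert (hc : 0 < c.length) {x : Fin n} :
    x ∈ starCenters G τ i c ↔
      ∃ j < c.length, c.getVert j = x ∧ (j = 0 ∨ 3 ≤ #(aliveNbrs G τ i x)) := by
  rw [mem_starCenters]
  constructor
  · rintro ⟨hx, rfl | hdeg⟩
    · exact ⟨0, hc, c.getVert_zero, Or.inl rfl⟩
    · obtain ⟨j, hj, rfl⟩ := exists_lt_length_getVert_eq hc hx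
      exact ⟨j, hj, rfl, Or.inr hdeg⟩
  · rintro ⟨j, hj, rfl, hdeg⟩
    refine ⟨c.getVert_mem_support j, hdeg.imp_left ?_⟩
    rintro rfl
    exact c.getVert_zero

theorem isNear_iff_starCenters (hτ : ∀ v : Fin n, i ≤ τ v ↔ dead v = 0) (hc : 0 < c.length)
    (hdead : ∀ v ∈ c.support, dead v = 0) (hf : ∀ j < c.length, f j = c.getVert j) {w : ℕ → ℕ}
    (hw : ∀ j < c.length, w (f j) = vertexWeight n (liveGraph G dead) (f j)) {v : Fin n} :
    IsNear (natGraph G) w f c.length v ↔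
      ∃ x ∈ starCenters G τ i c, v = x ∨ G.Adj v x := by
  have hheavy (j : ℕ) (hj : j < c.length) :
      1 < w (f j) ↔ 3 ≤ #(aliveNbrs G τ i (c.getVert j)) := by
    rw [hw j hj, hf j hj, ← count_liveGraph_eq hτ (hdead _ (c.getVert_mem_support j)), vertexWeight]
    have := r.pos
    split_ifs <;> omega
  simp only [mem_starCenters_iff_getVert hc, IsNear]
  constructor
  · rintro ⟨j, hj, hstar, hv⟩
    rw [hheavy j hj] at hstar
    rw [hf j hj, natGraph_adj_val] at hv
    exact ⟨_, ⟨j, hj, rfl, hstar⟩, hv.imp Fin.ext fun h => h.symm⟩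
  · rintro ⟨_, ⟨j, hj, rfl, hstar⟩, hv⟩
    refine ⟨j, hj, by rwa [hheavy j hj], ?_⟩
    rw [hf j hj, natGraph_adj_val]
    exact hv.imp (congrArg _) fun h => h.symm

theorem card_starCenters_le (hτ : ∀ v : Fin n, i ≤ τ v ↔ dead v = 0) (hc : 0 < c.length)
    (hdead : ∀ v ∈ c.support, dead v = 0) :
    #(starCenters G τ i c) ≤
      #{j ∈ range c.length | 3 ≤ Nat.count ((liveGraph G dead).Adj (c.getVert j)) n} + 1 := by
  have hsub : starCenters G τ i c ⊆ insert r
      ({j ∈ range c.length | 3 ≤ Nat.count ((liveGraph G dead).Adj (c.getVert j)) n}.image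
        c.getVert) := by
    intro x hx
    obtain ⟨j, hj, rfl, rfl | hdeg⟩ := (mem_starCenters_iff_getVert hc).1 hx
    · simp
    · rw [← count_liveGraph_eq hτ (hdead _ (c.getVert_mem_support j))] at hdeg
      exact mem_insert_of_mem (mem_image_of_mem _ (mem_filter.2 ⟨mem_range.2 hj, hdeg⟩))
  exact (card_le_card hsub).trans ((card_insert_le _ _).trans (by gcongr; exact card_image_le))

theorem card_starCenters_le_cost (hτ : ∀ v : Fin n, i ≤ τ v ↔ dead v = 0) (hc : 0 < c.length)
    (hdead : ∀ v ∈ c.support, dead v = 0)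
    (hmin : ∀ f len, IsCycleSeq (liveGraph G dead) f len →
      seqWeight (vertexWeight n (liveGraph G dead)) (fun j => c.getVert j) c.length ≤
        seqWeight (vertexWeight n (liveGraph G dead)) f len)
    {u : Fin n} {c' : (aliveGraph G τ i).Walk u u} (hc' : c'.IsCycle) :
    #(starCenters G τ i c) ≤ cost (aliveBranch G τ i) c' + 1 := by
  have hseq := isCycleSeq_of_isCycle hτ hc'
  calc #(starCenters G τ i c)
    _ ≤ #{j ∈ range c.length | 3 ≤ Nat.count ((liveGraph G dead).Adj (c.getVert j)) n} + 1 :=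
      card_starCenters_le hτ hc hdead
    _ ≤ #{j ∈ range c'.length | 3 ≤ Nat.count ((liveGraph G dead).Adj (c'.getVert j)) n} + 1 := by
      gcongr 1
      exact card_heavy_le_of_seqWeight_le hc (hseq.len_le fun _ _ => lt_of_liveGraph_adj)
        (hmin _ _ hseq)
    _ ≤ cost (aliveBranch G τ i) c' + 1 := by
      gcongr
      exact card_heavy_le_cost hτ hc'

end Centers

end Remaining

end Sequences

/-! ### The rounds of the greedy algorithm -/

section GreedyRounds

section Records

variable {n i : ℕ} {dead : ℕ → ℕ} {v : Fin n}

/-- The deletion time of a vertex, and `n` for a vertex that remains. -/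
def timeOf (n : ℕ) (dead : ℕ → ℕ) (v : Fin n) : ℕ := if dead v = 0 then n else dead v - 1

/-- The vertices that were deleted in a star around a chosen cycle. -/
def markedOf (n : ℕ) (mark : ℕ → ℕ) : Finset (Fin n) := {v | mark v ≠ 0}

/-- The recorded parents, where the number `n` stands for the root `Fin.last n` of the tree. -/
def parentOf (n : ℕ) (par : ℕ → ℕ) (v : Fin n) : Fin (n + 1) := Fin.ofNat (n + 1) (par v)

theorem timeOf_eq_iff (hi : i < n) : timeOf n dead v = i ↔ dead v = i + 1 := by
  unfold timeOf
  split_ifs <;> omega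

theorem le_timeOf_iff (hi : i ≤ n) (hle : dead v ≤ i) : i ≤ timeOf n dead v ↔ dead v = 0 := by
  unfold timeOf
  split_ifs <;> omega

theorem mem_markedOf {mark : ℕ → ℕ} : v ∈ markedOf n mark ↔ mark v ≠ 0 := by
  simp [markedOf]

theorem val_parentOf {par : ℕ → ℕ} (hle : par v ≤ n) : (parentOf n par v : ℕ) = par v :=
  Nat.mod_eq_of_lt (Nat.lt_succ_of_le hle)

end Records

variable {n i : ℕ} {G : SimpleGraph (Fin n)} [DecidableRel G.Adj] {s s' st : Store}

/-- The memory contains the records of the first `i` rounds. -/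
structure HoldsHistory {n : ℕ} (G : SimpleGraph (Fin n)) [DecidableRel G.Adj] (i : ℕ) (s : Store) :
    Prop extends HoldsGraph G s where
  dead_le : ∀ v < n, s.arr aDead v ≤ i
  mark_le : ∀ v < n, s.arr aMark v ≤ 1
  parent_le : ∀ v < n, s.arr aParent v ≤ n
  history : ∃ T, History G (timeOf n (s.arr aDead)) (markedOf n (s.arr aMark))
    (parentOf n (s.arr aParent)) i (s.var rCnt) T (s.arr aLen) (s.arr aRow)

variable (n i) in
/-- The records in `st` arise from those in `s` by deleting some remaining vertices in round `i`. -/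
def DeletesFrom (s st : Store) : Prop :=
  ∀ v < n, st.arr aDead v = s.arr aDead v ∧ st.arr aMark v = s.arr aMark v ∧
      st.arr aParent v = s.arr aParent v ∨
    s.arr aDead v = 0 ∧ st.arr aDead v = i + 1 ∧ st.arr aMark v ≤ 1 ∧ st.arr aParent v ≤ n

namespace HoldsHistory

theorem congr (h : HoldsHistory G i s) (hG : HoldsGraph G s')
    (hrecords : s'.arr aDead = s.arr aDead ∧ s'.arr aMark = s.arr aMark ∧
      s'.arr aParent = s.arr aParent)
    (hcnt : s'.var rCnt = s.var rCnt) (hlens : ∀ q < s.var rCnt, s'.arr aLen q = s.arr aLen q)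
    (hrows : ∀ l < s.var rCnt * n, s'.arr aRow l = s.arr aRow l) : HoldsHistory G i s' where
  toHoldsGraph := hG
  dead_le := hrecords.1 ▸ h.dead_le
  mark_le := hrecords.2.1 ▸ h.mark_le
  parent_le := hrecords.2.2 ▸ h.parent_le
  history := by
    obtain ⟨T, hT⟩ := h.history
    rw [hrecords.1, hrecords.2.1, hrecords.2.2, hcnt]
    exact ⟨T, hT.congr hlens hrows⟩

theorem of_agreesOff {xs as : List ℕ} (h : HoldsHistory G i s) (hs : s.AgreesOff xs as s')
    (hxs : rN ∉ xs ∧ rCnt ∉ xs := by decide)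
    (has : aAdj ∉ as ∧ aMul ∉ as ∧ aDead ∉ as ∧ aMark ∉ as ∧ aParent ∉ as := by decide)
    (has' : aLen ∉ as ∧ aRow ∉ as := by decide) : HoldsHistory G i s' :=
  h.congr (h.toHoldsGraph.of_agreesOff hs hxs.1 has.1 has.2.1)
    ⟨hs.arr has.2.2.1, hs.arr has.2.2.2.1, hs.arr has.2.2.2.2⟩ (hs.var hxs.2)
    (fun _ _ => by rw [hs.arr has'.1]) fun _ _ => by rw [hs.arr has'.2]

theorem cnt_le (h : HoldsHistory G i s) : s.var rCnt ≤ i :=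
  let ⟨_, hT⟩ := h.history
  hT.cnt_le

theorem le_timeOf_iff (h : HoldsHistory G i s) (hi : i ≤ n) (v : Fin n) :
    i ≤ timeOf n (s.arr aDead) v ↔ s.arr aDead v = 0 :=
  CyclePacking.le_timeOf_iff hi (h.dead_le v v.2)

theorem two_le_card_aliveNbrs (h : HoldsHistory G i s) (hi : i ≤ n)
    (hdeg : ∀ v < n, s.arr aDead v = 0 → 2 ≤ Nat.count ((liveGraph G (s.arr aDead)).Adj v) n)
    (v : Fin n) (hv : i ≤ timeOf n (s.arr aDead) v) :
    2 ≤ #(aliveNbrs G (timeOf n (s.arr aDead)) i v) := by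
  have hτ := h.le_timeOf_iff hi
  rw [← count_liveGraph_eq hτ ((hτ v).1 hv)]
  exact hdeg v v.2 ((hτ v).1 hv)

theorem advance (h : HoldsHistory G i s) (hi : i < n) (hd : DeletesFrom n i s st) :
    Advance i (timeOf n (s.arr aDead)) (timeOf n (st.arr aDead)) (markedOf n (s.arr aMark))
      (markedOf n (st.arr aMark)) (parentOf n (s.arr aParent)) (parentOf n (st.arr aParent)) where
  lt := hi
  eq_or v := by
    obtain ⟨hdead, -⟩ | ⟨h0, hdead, -⟩ := hd v v.2 <;> simp [timeOf, *]
  mem_iff v hv := by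
    obtain ⟨-, hmark, -⟩ | ⟨h0, -⟩ := hd v v.2
    · rw [mem_markedOf, mem_markedOf, hmark]
    · exact absurd ((h.le_timeOf_iff hi.le v).2 h0) hv.not_ge
  parent_eq v hv := by
    obtain ⟨-, -, hpar⟩ | ⟨h0, -⟩ := hd v v.2
    · rw [parentOf, parentOf, hpar]
    · exact absurd ((h.le_timeOf_iff hi.le v).2 h0) hv.not_ge
  remaining v hv := by
    obtain ⟨T, hT⟩ := h.history
    obtain ⟨hdead, hmark, hpar⟩ | ⟨-, hdead, -⟩ := hd v v.2
    · rw [mem_markedOf, parentOf, hmark, hpar, ← mem_markedOf]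
      exact hT.remaining v (by rwa [timeOf, ← hdead])
    · exact absurd hv (((timeOf_eq_iff hi).2 hdead).trans_lt hi).ne

theorem succ (h : HoldsHistory G i s) (hG : HoldsGraph G st) (hd : DeletesFrom n i s st)
    (hT : ∃ T, History G (timeOf n (st.arr aDead)) (markedOf n (st.arr aMark))
      (parentOf n (st.arr aParent)) (i + 1) (st.var rCnt) T (st.arr aLen) (st.arr aRow)) :
    HoldsHistory G (i + 1) st where
  toHoldsGraph := hG
  dead_le v hv := by grind [hd v hv, h.dead_le v hv]
  mark_le v hv := by grind [hd v hv, h.mark_le v hv]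
  parent_le v hv := by grind [hd v hv, h.parent_le v hv]
  history := hT

theorem idle (h : HoldsHistory G i s) (hi : i < n)
    (hdeg : ∀ v < n, s.arr aDead v = 0 → 2 ≤ Nat.count ((liveGraph G (s.arr aDead)).Adj v) n)
    (hacyclic : ∀ f len, ¬ IsCycleSeq (liveGraph G (s.arr aDead)) f len) :
    HoldsHistory G (i + 1) s := by
  obtain ⟨T, hT⟩ := h.history
  have hd : DeletesFrom n i s s := fun _ _ => Or.inl ⟨rfl, rfl, rfl⟩
  refine h.succ h.toHoldsGraph hd ⟨T, hT.succ_of_prune (h.advance hi hd) (Or.inr fun v => ?_)⟩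
  by_contra! hv
  obtain ⟨u, c, hc⟩ := exists_isCycle_of_two_le_degree hv (h.two_le_card_aliveNbrs hi.le hdeg)
  exact hacyclic _ _ (isCycleSeq_of_isCycle (h.le_timeOf_iff hi.le) hc)

end HoldsHistory

/-- Delete the vertex of degree at most one that was found and record its neighbour. -/
def pruneP : ForProg :=
  store aDead (var rLow - const 1) (var rRound + const 1) ;;
  store aParent (var rLow - const 1) (var rLowNbr)

/-- One round: delete a vertex of degree at most one, or else stars around a lightest cycle. -/
def roundP : ForProg :=
  scanP ;;
  ite (var rLow) pruneP
    (searchP ;;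
     ite (var rInf - var rBest) (killP ;; rCnt ≔ var rCnt + const 1) skip)

theorem eq_castSucc_iff_mem_aliveNbrs {τ : Fin n → ℕ} {dead : ℕ → ℕ}
    (hτ : ∀ v : Fin n, i ≤ τ v ↔ dead v = 0) {d : Fin n} (hdead : dead d = 0)
    (hcount : Nat.count ((liveGraph G dead).Adj d) n < 2) {e : Fin (n + 1)}
    (hnbr : IsNbrOrNone G dead d e) (u : Fin n) : e = Fin.castSucc u ↔ u ∈ aliveNbrs G τ i d := by
  have hmem (v : Fin n) : v ∈ aliveNbrs G τ i d ↔ (liveGraph G dead).Adj d v := by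
    rw [mem_aliveNbrs, liveGraph_adj, natGraph_adj_val, hτ, and_iff_right hdead]
  rw [count_liveGraph_eq hτ hdead, Nat.lt_succ_iff, card_le_one] at hcount
  rw [hmem, Fin.ext_iff, Fin.val_castSucc]
  obtain hadj | ⟨hroot, hnone⟩ := hnbr
  · refine ⟨fun heq => heq ▸ hadj, fun hu => ?_⟩
    have he : (⟨e, lt_of_liveGraph_adj hadj⟩ : Fin n) ∈ aliveNbrs G τ i d := (hmem _).2 hadj
    exact congrArg Fin.val (hcount _ he u ((hmem u).2 hu))
  · exact ⟨fun heq => absurd u.2 (by omega), fun hu => absurd hu (hnone u)⟩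

theorem pruneP_spec (h : HoldsHistory G i s) (hi : i < n) (hround : s.var rRound = i) {d : Fin n}
    (hlow : s.var rLow = d + 1) (hdead : s.arr aDead d = 0)
    (hcount : Nat.count ((liveGraph G (s.arr aDead)).Adj d) n < 2)
    (hnbr : IsNbrOrNone G (s.arr aDead) d (s.var rLowNbr)) :
    HoldsHistory G (i + 1) (pruneP.run s) := by
  obtain ⟨T, hT⟩ := h.history
  have hτ := h.le_timeOf_iff hi.le
  have hst := run_agreesOff pruneP s
  have hdead' : (pruneP.run s).arr aDead = Function.update (s.arr aDead) d (i + 1) := by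
    simp [pruneP, hlow, hround]
  have hpar' : (pruneP.run s).arr aParent = Function.update (s.arr aParent) d (s.var rLowNbr) := by
    simp [pruneP, hlow]
  have hmark' : (pruneP.run s).arr aMark = s.arr aMark := hst.arr (by decide)
  have hnbr_le : s.var rLowNbr ≤ n :=
    hnbr.elim (fun h => (lt_of_liveGraph_adj h).le) fun h => h.1.le
  have hd : DeletesFrom n i s (pruneP.run s) := by
    intro v hv
    rw [hdead', hpar', hmark']
    by_cases hvd : v = d
    · subst hvd
      simp [hdead, h.mark_le _ hv, hnbr_le]
    · simp [hvd]
  have ha := h.advance hi hd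
  refine h.succ (h.toHoldsGraph.of_agreesOff hst) hd ⟨T, ?_⟩
  rw [run_var (by decide), run_arr (a := aLen) (by decide), run_arr (a := aRow) (by decide)]
  refine hT.succ_of_prune ha (Or.inl ⟨d, fun v => ?_, ?_, ?_, fun u => ?_⟩)
  · have := h.dead_le v v.2
    simp only [timeOf_eq_iff hi, hdead', Function.update_apply, Fin.val_inj]
    split_ifs with hvd
    · simp [hvd]
    · simp only [hvd, iff_false]
      omega
  · rw [hmark']
    exact (hT.remaining d (hT.remaining_of_le ((hτ d).2 hdead))).1
  · rw [ha.aliveNbrs_eq le_rfl, ← count_liveGraph_eq hτ hdead]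
    exact Nat.le_of_lt_succ hcount
  · rw [ha.aliveNbrs_eq le_rfl]
    refine eq_castSucc_iff_mem_aliveNbrs hτ hdead hcount ?_ u
    rw [val_parentOf (by rw [hpar']; simpa using hnbr_le), hpar', Function.update_self]
    exact hnbr

section Kill

variable {r : Fin n} {c : G.Walk r r} {K : ℕ → Prop}

theorem HasKilled.deletesFrom (h : HoldsHistory G i s) (hround : s.var rRound = i)
    (hk : HasKilled K s st) (hpar : st.arr aParent = s.arr aParent) : DeletesFrom n i s st := by
  intro v hv
  rw [hpar]
  by_cases hv' : s.arr aDead v = 0 ∧ K v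
  · obtain ⟨hdead, hmark⟩ := hk.killed v hv'.1 hv'.2
    exact Or.inr ⟨hv'.1, by rw [hdead, hround], hmark.le, h.parent_le v hv⟩
  · obtain ⟨hdead, hmark⟩ := hk.kept v hv'
    exact Or.inl ⟨hdead, hmark, rfl⟩

theorem HasKilled.timeOf_eq_iff (h : HoldsHistory G i s) (hi : i < n) (hround : s.var rRound = i)
    (hk : HasKilled K s st) (v : Fin n) :
    timeOf n (st.arr aDead) v = i ↔ s.arr aDead v = 0 ∧ K v := by
  rw [CyclePacking.timeOf_eq_iff hi]
  by_cases hv : s.arr aDead v = 0 ∧ K v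
  · simp [hv, (hk.killed v hv.1 hv.2).1, hround]
  · rw [(hk.kept v hv).1]
    have := h.dead_le v v.2
    exact iff_of_false (by omega) hv

theorem isKillRound_of_hasKilled (h : HoldsHistory G i s) (hi : i < n)
    (hround : s.var rRound = i) (hk : HasKilled K s st) (hpar : st.arr aParent = s.arr aParent)
    (hK : ∀ v : Fin n, K v ↔
      ∃ x ∈ starCenters G (timeOf n (s.arr aDead)) i c, v = x ∨ G.Adj v x)
    (hdeg : ∀ v < n, s.arr aDead v = 0 → 2 ≤ Nat.count ((liveGraph G (s.arr aDead)).Adj v) n)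
    (hc : c.IsCycle) (hdead : ∀ v ∈ c.support, s.arr aDead v = 0)
    (hshort : ∀ u, ∀ c' : (aliveGraph G (timeOf n (s.arr aDead)) i).Walk u u, c'.IsCycle →
      #(starCenters G (timeOf n (s.arr aDead)) i c) ≤
        cost (aliveBranch G (timeOf n (s.arr aDead)) i) c' + 1) :
    IsKillRound G (timeOf n (st.arr aDead)) (markedOf n (st.arr aMark))
      (parentOf n (st.arr aParent)) i c := by
  obtain ⟨T, hT⟩ := h.history
  have hτ := h.le_timeOf_iff hi.le
  have ha := h.advance hi (hk.deletesFrom h hround hpar)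
  have hkilled (v : Fin n) := hk.timeOf_eq_iff h hi hround v
  constructor
  · refine ⟨hc, fun v hv => (ha.le_iff le_rfl v).2 ((hτ v).2 (hdead v hv)), fun v hv hstar => ?_⟩
    rw [ha.aliveNbrs_eq le_rfl] at hstar
    have hv' : v ∈ starCenters G (timeOf n (s.arr aDead)) i c := mem_starCenters.2 ⟨hv, hstar⟩
    refine ⟨(hkilled v).2 ⟨hdead v hv, (hK v).2 ⟨v, hv', Or.inl rfl⟩⟩, fun w hvw hw => ?_⟩
    rw [ha.le_iff le_rfl, hτ] at hw
    exact (hkilled w).2 ⟨hw, (hK w).2 ⟨v, hv', Or.inr hvw.symm⟩⟩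
  · intro v hv
    rw [ha.aliveNbrs_eq le_rfl]
    exact h.two_le_card_aliveNbrs hi.le hdeg v ((ha.le_iff le_rfl v).1 hv)
  · intro z hz
    obtain ⟨hz0, hzK⟩ := (hkilled z).1 hz
    rw [mem_markedOf, (hk.killed z hz0 hzK).2, parentOf, hpar, ha.starCenters_eq le_rfl]
    exact ⟨one_ne_zero, (hT.remaining z (hT.remaining_of_le ((hτ z).2 hz0))).2, (hK z).1 hzK⟩
  · rwa [ha.aliveGraph_eq le_rfl, ha.aliveBranch_eq le_rfl, ha.starCenters_eq le_rfl]

end Kill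

theorem killRound_spec (h : HoldsHistory G i s) (hi : i < n) (hround : s.var rRound = i)
    (hdeg : ∀ v < n, s.arr aDead v = 0 → 2 ≤ Nat.count ((liveGraph G (s.arr aDead)).Adj v) n)
    (hw : ∀ v < n, s.arr aWeight v = vertexWeight n (liveGraph G (s.arr aDead)) v) {f : ℕ → ℕ}
    {len : ℕ} (hlen : s.arr aLen (s.var rCnt) = len)
    (hrow : ∀ j < len, s.arr aRow (s.var rCnt * n + j) = f j)
    (hf : IsCycleSeq (liveGraph G (s.arr aDead)) f len)
    (hmin : ∀ f' len', IsCycleSeq (liveGraph G (s.arr aDead)) f' len' →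
      seqWeight (vertexWeight n (liveGraph G (s.arr aDead))) f len ≤
        seqWeight (vertexWeight n (liveGraph G (s.arr aDead))) f' len') :
    HoldsHistory G (i + 1) ((killP ;; rCnt ≔ var rCnt + const 1).run s) := by
  obtain ⟨T, hT⟩ := h.history
  have hτ := h.le_timeOf_iff hi.le
  have hst := run_agreesOff (killP ;; rCnt ≔ var rCnt + const 1) s
  have hpos := hf.three_le
  have hlt (j : ℕ) (hj : j < len) : f j < n := lt_of_liveGraph_adj (hf.exists_adj hj).choose_spec
  have hle : len ≤ n := hf.len_le fun _ _ => lt_of_liveGraph_adj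
  have hk := (killP_spec h.toHoldsGraph rfl (h.cnt_le.trans hi.le) hlen hle
    fun j hj => ⟨hrow j hj, hlt j hj⟩).congr (st' := (killP ;; rCnt ≔ var rCnt + const 1).run s)
      (fun _ => Iff.rfl) rfl rfl
  obtain ⟨r, c, hc, rfl, hget⟩ := exists_isCycle_of_isCycleSeq (hf.mono liveGraph_le)
  have hdead (v : Fin n) (hv : v ∈ c.support) : s.arr aDead v = 0 := by
    obtain ⟨j, hj, rfl⟩ := exists_lt_length_getVert_eq (by omega) hv
    rw [← hget j hj]
    exact (hf.exists_adj hj).choose_spec.2.2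
  rw [seqWeight_congr hget] at hmin
  have hround' := isKillRound_of_hasKilled h hi hround hk (hst.arr (by decide))
    (fun v => isNear_iff_starCenters hτ (by omega) hdead hget fun j hj => hw _ (hlt j hj)) hdeg hc
    hdead fun u c' => card_starCenters_le_cost hτ (by omega) hdead hmin
  have hd := hk.deletesFrom h hround (hst.arr (by decide))
  refine h.succ (h.toHoldsGraph.of_agreesOff hst) hd ⟨Function.update T (s.var rCnt) i, ?_⟩
  rw [run_arr (a := aLen) (by decide), run_arr (a := aRow) (by decide)]
  have hcnt : ((killP ;; rCnt ≔ var rCnt + const 1).run s).var rCnt = s.var rCnt + 1 := by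
    simp [run_var (p := killP) (x := rCnt) (by decide)]
  rw [hcnt]
  exact hT.succ_of_kill (h.advance hi hd) hround' hlen.symm (hlen.trans_le hle)
    fun l hl => (hrow l hl).trans (hget l hl)

theorem searchRound_spec (h : HoldsHistory G i s) (hi : i < n) (hround : s.var rRound = i)
    (hdeg : ∀ v < n, s.arr aDead v = 0 → 2 ≤ Nat.count ((liveGraph G (s.arr aDead)).Adj v) n)
    (hw : ∀ v < n, s.arr aWeight v = vertexWeight n (liveGraph G (s.arr aDead)) v) :
    HoldsHistory G (i + 1) ((searchP ;;
      ite (var rInf - var rBest) (killP ;; rCnt ≔ var rCnt + const 1) skip).run s) := by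
  have hs' := run_agreesOff searchP s
  have hcnt : (searchP.run s).var rCnt = s.var rCnt := hs'.var (by decide)
  have hdead : (searchP.run s).arr aDead = s.arr aDead := hs'.arr (by decide)
  obtain ⟨hinf, hbest⟩ := searchP_spec (s := s) ⟨h.toHoldsGraph, rfl, hw⟩
    (one_le_vertexWeight n _) (h.cnt_le.trans hi.le)
  have h' : HoldsHistory G i (searchP.run s) :=
    h.congr (h.toHoldsGraph.of_agreesOff hs') ⟨hdead, hs'.arr (by decide), hs'.arr (by decide)⟩
      hcnt (fun q hq => hbest.lens q hq.ne) hbest.rows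
  rw [← hdead] at hdeg
  rw [run_seq]
  by_cases hfound : (searchP.run s).var rBest < n * n + (n + 1)
  · obtain ⟨hcycle, hweight⟩ := hbest.cycle hfound
    rw [run_ite_of_ne (by simp only [eval_sub, eval_var, hinf]; omega)]
    refine killRound_spec h' hi ((hs'.var (by decide)).trans hround) hdeg
      (by rw [hdead, hs'.arr (by decide)]; exact hw) (by rw [hcnt])
      (fun j _ => by rw [hcnt]) (by rw [hdead]; exact hcycle) fun f' len' hf' => ?_
    rw [hdead] at hf' ⊢
    exact hweight.trans (hbest.minimal f' len' hf' trivial)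
  · rw [run_ite_of_eq (by simp only [eval_sub, eval_var, hinf]; omega), run_skip]
    refine h'.idle hi hdeg fun f len hf => hfound ?_
    rw [hdead] at hf
    exact (hbest.minimal f len hf trivial).trans_lt
      (hf.seqWeight_lt (fun _ _ => lt_of_liveGraph_adj) (vertexWeight_le n _))

theorem roundP_spec (h : HoldsHistory G i s) (hi : i < n) (hround : s.var rRound = i) :
    HoldsHistory G (i + 1) (roundP.run s) := by
  have hs' := run_agreesOff scanP s
  have h' := h.of_agreesOff hs'
  have hround' : (scanP.run s).var rRound = i := (hs'.var (by decide)).trans hround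
  have hdead : (scanP.run s).arr aDead = s.arr aDead := hs'.arr (by decide)
  obtain ⟨hw, hlow⟩ := scanP_spec h.toHoldsGraph
  rw [← hdead] at hw hlow
  rw [roundP, run_seq]
  obtain ⟨hlow, hdeg⟩ | ⟨d, hd, hlow, hd0, hcount, hnbr⟩ := hlow
  · rw [run_ite_of_eq (by simpa using hlow)]
    exact searchRound_spec h' hi hround' hdeg hw
  · rw [run_ite_of_ne (by simp [hlow])]
    exact pruneP_spec h' hi hround' (d := ⟨d, hd⟩) hlow hd0 hcount hnbr

end GreedyRounds

/-! ### The whole program -/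

section WholeProgram

open Store

section Matrix

variable {w a v : ℕ} {f : ℕ → ℕ} {R R' : ℕ → ℕ → Prop}

open Classical in
/-- The array `f` contains, row by row with rows of width `w`, the zero-one matrix of the
relation `R`. -/
def HoldsMatrix (f : ℕ → ℕ) (w : ℕ) (R : ℕ → ℕ → Prop) : Prop :=
  ∀ a, ∀ v < w, f (a * w + v) = if R a v then 1 else 0

theorem mul_add_inj {u u' v' : ℕ} (hv : v < w) (hv' : v' < w) :
    u * w + v = u' * w + v' ↔ u = u' ∧ v = v' := by
  refine ⟨fun h => ?_, fun ⟨hu, hv⟩ => by rw [hu, hv]⟩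
  have hmod := congrArg (· % w) h
  simp only [Nat.mul_add_mod_self_right, Nat.mod_eq_of_lt hv, Nat.mod_eq_of_lt hv'] at hmod
  subst hmod
  exact ⟨Nat.eq_of_mul_eq_mul_right (by omega) (Nat.add_right_cancel h), rfl⟩

namespace HoldsMatrix

theorem apply_eq_ite (h : HoldsMatrix f w R) (hv : v < w) {P : Prop} [Decidable P]
    (hP : R a v ↔ P) : f (a * w + v) = if P then 1 else 0 := by
  rw [h a v hv]
  simp only [hP]

theorem congr (h : HoldsMatrix f w R) (hR : ∀ a, ∀ v < w, R' a v ↔ R a v) :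
    HoldsMatrix f w R' := fun a v hv => by
  classical exact h.apply_eq_ite hv (hR a v hv).symm

theorem update (h : HoldsMatrix f w R) (hv : v < w) (a : ℕ) :
    HoldsMatrix (Function.update f (a * w + v) 1) w fun b u => b = a ∧ u = v ∨ R b u := by
  intro b u hu
  rw [Function.update_apply, h b u hu]
  simp only [mul_add_inj hu hv]
  split_ifs <;> simp_all

end HoldsMatrix

end Matrix

variable {n : ℕ} {G : SimpleGraph (Fin n)} [DecidableRel G.Adj] {s s' : Store}

/-- Store the multiples of `n`, and make every vertex a child of the root `n`. -/
def initP : ForProg :=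
  forN rRound
    (store aMul (var rRound + const 1) (get aMul (var rRound) + var rN) ;;
     store aParent (var rRound) (var rN))

/-- The greedy algorithm. -/
def greedyP : ForProg :=
  initP ;;
  forN rRound roundP

theorem initP_spec (hmul : s.arr aMul 0 = 0) :
    (∀ i ≤ s.var rN, (initP.run s).arr aMul i = i * s.var rN) ∧
    ∀ i < s.var rN, (initP.run s).arr aParent i = s.var rN := by
  refine run_forN_induction (x := rRound) s (I := fun m st =>
    (∀ i ≤ m, st.arr aMul i = i * s.var rN) ∧ ∀ i < m, st.arr aParent i = s.var rN)
    (by simp [hmul]) fun m st _ hround hst ⟨hm, hp⟩ => ?_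
  have hn : st.var rN = s.var rN := hst.var (by decide)
  refine ⟨fun i hi => ?_, fun i hi => ?_⟩
  · obtain rfl | hi := Nat.le_succ_iff_eq_or_le.1 hi
    · simp [hround, hn, hm, Nat.succ_mul]
    · simp [hround, hm i hi, (Nat.lt_succ_of_le hi).ne]
  · obtain hi | rfl := Nat.lt_succ_iff_lt_or_eq.1 hi
    · simp [hround, hp i hi, hi.ne]
    · simp [hround, hn]

theorem HoldsHistory.of_initial (h : HoldsGraph G s) (hcnt : s.var rCnt = 0)
    (hdead : ∀ v, s.arr aDead v = 0) (hmark : ∀ v, s.arr aMark v = 0)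
    (hpar : ∀ v < n, s.arr aParent v = n) : HoldsHistory G 0 s where
  toHoldsGraph := h
  dead_le v _ := (hdead v).le
  mark_le v _ := by simp [hmark]
  parent_le v hv := (hpar v hv).le
  history := by
    refine ⟨0, ⟨fun v => Or.inr (by simp [timeOf, hdead]), fun v _ =>
      ⟨by simp [mem_markedOf, hmark], Fin.ext ?_⟩, ?_, ?_, fun j hj => absurd hj j.not_lt_zero⟩⟩
    · rw [val_parentOf (hpar v v.2).le, hpar v v.2, Fin.val_last]
    all_goals simp [hcnt]

theorem greedyP_spec (hn : s.var rN = n)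
    (hadj : ∀ u < n, ∀ v < n, s.arr aAdj (u * n + v) = if (natGraph G).Adj u v then 1 else 0)
    (hcnt : s.var rCnt = 0) (harr : ∀ a ≠ aAdj, ∀ i, s.arr a i = 0) :
    HoldsHistory G n (greedyP.run s) := by
  let s₁ := initP.run s
  have hs₁ : s.AgreesOff _ _ s₁ := run_agreesOff initP s
  obtain ⟨hmul, hpar⟩ := initP_spec (s := s) (harr aMul (by decide) 0)
  rw [hn] at hmul hpar
  have hgraph : HoldsGraph G s₁ :=
    ⟨(hs₁.var (by decide)).trans hn, by rwa [hs₁.arr (by decide)], hmul⟩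
  have hinit : HoldsHistory G 0 s₁ :=
    .of_initial hgraph ((hs₁.var (by decide)).trans hcnt)
      (fun v => (congrFun (hs₁.arr (by decide)) v).trans (harr aDead (by decide) v))
      (fun v => (congrFun (hs₁.arr (by decide)) v).trans (harr aMark (by decide) v)) hpar
  have key := run_forN_induction (x := rRound) (p := roundP) s₁ (I := HoldsHistory G)
    (hinit.of_agreesOff (Store.agreesOff_setVar (xs := [rRound]) (by simp) [] _ _))
    fun i st hi hround _ h =>
      (roundP_spec h (hgraph.n_eq ▸ hi) hround).of_agreesOff
        (Store.agreesOff_setVar (xs := [rRound]) (by simp) [] _ _)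
  rw [hgraph.n_eq] at key
  exact key

/-- Write the adjacencies between the node in `rV` and its parent. -/
def treeEdgeP : ForProg :=
  store aTree ((get aMul (var rV) + var rV) + get aParent (var rV)) (const 1) ;;
  store aTree ((get aMul (get aParent (var rV)) + get aParent (var rV)) + var rV) (const 1)

/-- The value is nonzero if the vertex in `rW` is in the bag of the node in `rV`. -/
def inBagE : Expr :=
  get aMark (var rW) + ((const 1 - neE (var rW) (var rV)) +
    (const 1 - neE (var rW) (get aParent (var rV))))

/-- Write the vertex in `rW` into the bag of the node in `rV`, if it belongs there. -/
def bagEntryP : ForProg :=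
  ite inBagE (store aBag (get aMul (var rV) + var rW) (const 1)) skip

/-- Write all bags. -/
def bagsP : ForProg :=
  forN rV (forN rW bagEntryP) ;;
  rV ≔ var rN ;;
  forN rW bagEntryP

/-- Write the tree-decomposition given by the parents and by the marks. -/
def treeP : ForProg :=
  store aParent (var rN) (var rN) ;;
  rKind ≔ const 2 ;;
  rNodes ≔ var rN + const 1 ;;
  forN rV treeEdgeP ;;
  bagsP

theorem forN_treeEdgeP_spec (h : HoldsGraph G s) (hpar : ∀ a < n, s.arr aParent a ≤ n)
    (hzero : ∀ x, s.arr aTree x = 0) :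
    HoldsMatrix (((forN rV treeEdgeP).run s).arr aTree) (n + 1) fun a b =>
      a < n ∧ b = s.arr aParent a ∨ b < n ∧ a = s.arr aParent b := by
  have key := run_forN_induction (x := rV) (p := treeEdgeP) s (I := fun i st =>
    HoldsMatrix (st.arr aTree) (n + 1) fun a b =>
      a < i ∧ b = s.arr aParent a ∨ b < i ∧ a = s.arr aParent b)
    (fun a b _ => by simp [hzero]) fun i st hi hv hst hI => ?_
  · rw [h.n_eq] at key
    exact key
  · rw [h.n_eq] at hi
    have hmul := (h.of_agreesOff hst).mul
    have hparent : st.arr aParent = s.arr aParent := hst.arr (by decide)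
    have hp := hpar i hi
    have hrun : ((treeEdgeP.run st).setVar rV (i + 1)).arr aTree =
        Function.update (Function.update (st.arr aTree) (i * (n + 1) + s.arr aParent i) 1)
          (s.arr aParent i * (n + 1) + i) 1 := by
      simp [treeEdgeP, hv, hparent, hmul _ hi.le, hmul _ hp, Nat.mul_succ]
    rw [hrun]
    refine ((hI.update (by omega) i).update (by omega) (s.arr aParent i)).congr fun a b _ => ?_
    grind

/-- The vertex `v` is in the bag of the node `a`, as far as the memory records it. -/
def RecordsInBag (s : Store) (a v : ℕ) : Prop :=
  s.arr aMark v ≠ 0 ∨ v = a ∨ v = s.arr aParent a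

theorem eval_inBagE : inBagE.eval s = 0 ↔ ¬ RecordsInBag s (s.var rV) (s.var rW) := by
  simp only [inBagE, RecordsInBag, neE, eval_add, eval_sub, eval_get, eval_var, eval_const]
  omega

theorem RecordsInBag.congr {xs as : List ℕ} (hs : s.AgreesOff xs as s')
    (has : aMark ∉ as ∧ aParent ∉ as := by decide) : RecordsInBag s' = RecordsInBag s := by
  funext a v
  rw [RecordsInBag, RecordsInBag, hs.arr has.1, hs.arr has.2]

theorem bagEntryP_spec (h : HoldsGraph G s) (hv : s.var rV ≤ n) (hw : s.var rW < n)
    {R : ℕ → ℕ → Prop} (hR : HoldsMatrix (s.arr aBag) n R) :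
    HoldsMatrix ((bagEntryP.run s).arr aBag) n fun a v =>
      a = s.var rV ∧ v = s.var rW ∧ RecordsInBag s a v ∨ R a v := by
  by_cases hmem : RecordsInBag s (s.var rV) (s.var rW)
  · have hrun : (bagEntryP.run s).arr aBag =
        Function.update (s.arr aBag) (s.var rV * n + s.var rW) 1 := by
      rw [bagEntryP, run_ite_of_ne fun h0 => eval_inBagE.1 h0 hmem]
      simp [h.mul _ hv]
    rw [hrun]
    exact (hR.update hw _).congr fun a v _ => by grind
  · rw [bagEntryP, run_ite_of_eq (eval_inBagE.2 hmem), run_skip]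
    exact hR.congr fun a v _ => by grind

theorem forN_bagEntryP_spec (h : HoldsGraph G s) (hv : s.var rV ≤ n) {R : ℕ → ℕ → Prop}
    (hR : HoldsMatrix (s.arr aBag) n R) :
    HoldsMatrix (((forN rW bagEntryP).run s).arr aBag) n fun a v =>
      a = s.var rV ∧ RecordsInBag s a v ∨ R a v := by
  have key := run_forN_induction (x := rW) (p := bagEntryP) s (I := fun i st =>
    HoldsMatrix (st.arr aBag) n fun a v => a = s.var rV ∧ v < i ∧ RecordsInBag s a v ∨ R a v)
    (hR.congr fun a v _ => by simp) fun i st hi hw hst hI => ?_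
  · exact key.congr fun a v hv => by simp [h.n_eq, hv]
  · rw [h.n_eq] at hi
    have hv' : st.var rV = s.var rV := hst.var (by decide)
    have step := bagEntryP_spec (h.of_agreesOff hst) (hv' ▸ hv) (hw ▸ hi) hI
    rw [hv', hw, RecordsInBag.congr hst] at step
    exact step.congr fun a v _ => by grind

theorem bagsP_spec (h : HoldsGraph G s) (hzero : ∀ x, s.arr aBag x = 0) :
    HoldsMatrix ((bagsP.run s).arr aBag) n fun a v => a ≤ n ∧ RecordsInBag s a v := by
  have key := run_forN_induction (x := rV) (p := forN rW bagEntryP) s (I := fun m st =>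
    HoldsMatrix (st.arr aBag) n fun a v => a < m ∧ RecordsInBag s a v)
    (fun a v _ => by simp [hzero]) fun m st hm hv hst hI => ?_
  · rw [h.n_eq] at key
    let st := (forN rV (forN rW bagEntryP) ;; rV ≔ var rN).run s
    have hst : s.AgreesOff _ _ st := run_agreesOff (forN rV (forN rW bagEntryP) ;; rV ≔ var rN) s
    have hv : st.var rV = n := by
      simp [st, run_var (x := rN) (p := forN rV (forN rW bagEntryP)) (by decide), h.n_eq]
    have step := forN_bagEntryP_spec (h.of_agreesOff hst) hv.le key
    rw [hv, RecordsInBag.congr hst] at step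
    exact step.congr fun a v _ => by grind
  · rw [h.n_eq] at hm
    have step := forN_bagEntryP_spec (h.of_agreesOff hst) (hv ▸ hm.le) hI
    rw [hv, RecordsInBag.congr hst] at step
    exact step.congr fun a v _ => by grind

theorem treeP_spec (h : HoldsGraph G s) (hpar : ∀ a < n, s.arr aParent a ≤ n)
    (htree : ∀ x, s.arr aTree x = 0) (hbag : ∀ x, s.arr aBag x = 0) {p : ℕ → ℕ}
    (hp : p = Function.update (s.arr aParent) n n) :
    (treeP.run s).var rKind = 2 ∧ (treeP.run s).var rNodes = n + 1 ∧
    (HoldsMatrix ((treeP.run s).arr aTree) (n + 1) fun a b => a < n ∧ b = p a ∨ b < n ∧ a = p b) ∧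
    HoldsMatrix ((treeP.run s).arr aBag) n fun a v =>
      a ≤ n ∧ (s.arr aMark v ≠ 0 ∨ v = a ∨ v = p a) := by
  let initial := store aParent (var rN) (var rN) ;; rKind ≔ const 2 ;; rNodes ≔ var rN + const 1
  let s₁ := initial.run s
  let s₂ := (forN rV treeEdgeP).run s₁
  have hs₁ : s.AgreesOff _ _ s₁ := run_agreesOff initial s
  have hs₂ : s₁.AgreesOff _ _ s₂ := run_agreesOff (forN rV treeEdgeP) s₁
  have hs₃ : s₂.AgreesOff _ _ (treeP.run s) := run_agreesOff bagsP s₂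
  have h₁ := h.of_agreesOff hs₁
  have hp₁ : s₁.arr aParent = p := by simp [s₁, initial, h.n_eq, hp]
  have hple : ∀ a < n, s₁.arr aParent a ≤ n := fun a ha => by
    simpa [hp₁, hp, ha.ne] using hpar a ha
  refine ⟨?_, ?_, ?_, ?_⟩
  · rw [hs₃.var (by decide), hs₂.var (by decide)]
    simp [s₁, initial]
  · rw [hs₃.var (by decide), hs₂.var (by decide)]
    simp [s₁, initial, h.n_eq]
  · rw [hs₃.arr (by decide), ← hp₁]
    exact forN_treeEdgeP_spec h₁ hple fun x => by rw [hs₁.arr (by decide), htree]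
  · have key := bagsP_spec (h₁.of_agreesOff hs₂) fun x => by
      rw [hs₂.arr (by decide), hs₁.arr (by decide), hbag]
    rw [RecordsInBag.congr hs₂] at key
    exact key.congr fun a v _ => by rw [RecordsInBag, hs₁.arr (by decide), hp₁]

/-- The greedy algorithm and the output of its result. -/
def mainP : ForProg :=
  greedyP ;;
  ite (var rK - var rCnt) treeP (rKind ≔ const 1)

section Output

variable {τ : Fin n → ℕ} {Z : Finset (Fin n)} {E : Fin n → Fin (n + 1)}

theorem val_nodeParent_parentOf {par : ℕ → ℕ} (hle : ∀ v < n, par v ≤ n) (a : Fin (n + 1)) :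
    (nodeParent (parentOf n par) a : ℕ) = Function.update par n n a := by
  induction a using Fin.lastCases with
  | last => simp [nodeParent_last]
  | cast v => simp [nodeParent_castSucc, val_parentOf (hle v v.2), v.2.ne]

omit [DecidableRel G.Adj] in
theorem IsParent.nodeParent_eq_self_iff (h : IsParent G τ Z E) {a : Fin (n + 1)} :
    nodeParent E a = a ↔ a = Fin.last n := by
  induction a using Fin.lastCases with
  | last => simp [nodeParent_last]
  | cast v =>
    rw [nodeParent_castSucc]
    exact iff_of_false (fun hv => (h.lt v v hv).false) (Fin.castSucc_lt_last v).ne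

omit [DecidableRel G.Adj] in
theorem IsParent.presentsTreeDecomposition (h : IsParent G τ Z E) {p mark : ℕ → ℕ}
    (hp : ∀ a, (nodeParent E a : ℕ) = p a) (hmark : ∀ v : Fin n, v ∈ Z ↔ mark v ≠ 0)
    (hkind : s.var rKind = 2) (hnodes : s.var rNodes = n + 1)
    (htree : HoldsMatrix (s.arr aTree) (n + 1) fun a b => a < n ∧ b = p a ∨ b < n ∧ a = p b)
    (hbag : HoldsMatrix (s.arr aBag) n fun a v => a ≤ n ∧ (mark v ≠ 0 ∨ v = a ∨ v = p a)) :
    s.PresentsTreeDecomposition h.treeDecomposition := by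
  classical
  have hlt (a : Fin (n + 1)) : (a : ℕ) < n ↔ nodeParent E a ≠ a := by
    rw [Ne, h.nodeParent_eq_self_iff, Fin.ext_iff, Fin.val_last]
    omega
  refine ⟨hkind, hnodes, fun a b => htree.apply_eq_ite b.2 ?_,
    fun a v => hbag.apply_eq_ite v.2 ?_⟩
  · change _ ↔ (parentGraph (nodeParent E)).Adj a b
    rw [parentGraph_adj, ← hp, ← hp, hlt, hlt, ← Fin.ext_iff, ← Fin.ext_iff]
    grind
  · change _ ↔ v ∈ Z ∨ v.castSucc = a ∨ v.castSucc = nodeParent E a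
    rw [hmark, Fin.ext_iff, Fin.ext_iff, hp, Fin.val_castSucc, and_iff_right (by omega)]

end Output

theorem add_two_le_mul_log {t k : ℕ} (ht : 0 < t) (hk : 0 < k) {x : ℝ}
    (hx : x ≤ 11000 * k * Real.log (k + 1)) :
    x * t + 2 ≤ 11004 * t * k * Real.log (k + 1) := by
  have ht' : (1 : ℝ) ≤ t := by exact_mod_cast ht
  have hk' : (1 : ℝ) ≤ k := by exact_mod_cast hk
  have hlog : 1 / 2 ≤ Real.log (k + 1) := by
    have := Real.log_two_gt_d9
    have := Real.log_le_log (by norm_num : (0 : ℝ) < 2) (by linarith : (2 : ℝ) ≤ k + 1)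
    linarith
  have hone : (1 : ℝ) ≤ t * k := one_le_mul_of_one_le_of_one_le ht' hk'
  calc x * t + 2 ≤ 11000 * k * Real.log (k + 1) * t + 4 * (t * k * Real.log (k + 1)) := by
        gcongr
        nlinarith
    _ = 11004 * t * k * Real.log (k + 1) := by ring

theorem HoldsHistory.run_treeP (h : HoldsHistory G n s) {t k : ℕ} (ht : 0 < t) (hk : 0 < k)
    (hG : ¬ (completeBipartiteGraph (Fin 1) (Fin t)).IsIndContained G) (hcnt : s.var rCnt < k)
    (htree : ∀ x, s.arr aTree x = 0) (hbag : ∀ x, s.arr aBag x = 0) :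
    ∃ D : TreeDecomposition G (Fin (n + 1)),
      (D.independenceNumber : ℝ) ≤ 11004 * t * k * Real.log (k + 1) ∧
      (treeP.run s).PresentsTreeDecomposition D := by
  obtain ⟨T, hT⟩ := h.history
  obtain ⟨X, hX, hcard⟩ := hT.exists_isDismantling
  obtain ⟨hkind, hnodes, htree', hbag'⟩ := treeP_spec h.toHoldsGraph h.parent_le htree hbag rfl
  have hbound : (#X : ℝ) ≤ 11000 * k * Real.log (k + 1) :=
    hX.card_le_mul_log hk (hcard.trans hcnt.le)
  refine ⟨hT.isParent.treeDecomposition, ?_, hT.isParent.presentsTreeDecomposition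
    (val_nodeParent_parentOf h.parent_le) (fun _ => mem_markedOf) hkind hnodes htree' hbag'⟩
  calc (hT.isParent.treeDecomposition.independenceNumber : ℝ) ≤ #X * t + 2 := by
        exact_mod_cast hT.isParent.independenceNumber_le hX ht hG
    _ ≤ 11004 * t * k * Real.log (k + 1) := add_two_le_mul_log ht hk hbound

theorem inputStore_arr_adj (t k : ℕ) {u v : ℕ} (hu : u < n) (hv : v < n) :
    (inputStore G t k).arr aAdj (u * n + v) = if (natGraph G).Adj u v then 1 else 0 := by
  have hiff : (∃ a b : Fin n, u * n + v = a * n + b ∧ G.Adj a b) ↔ (natGraph G).Adj u v := by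
    constructor
    · rintro ⟨a, b, h, hab⟩
      obtain ⟨rfl, rfl⟩ := (mul_add_inj hv b.2).1 h
      exact (natGraph_adj_val G).2 hab
    · exact fun ⟨_, _, hadj⟩ => ⟨⟨u, hu⟩, ⟨v, hv⟩, rfl, hadj⟩
  simp [inputStore, hiff]

omit [DecidableRel G.Adj] in
theorem mainP_spec {t k : ℕ} (ht : 0 < t) (hk : 0 < k)
    (hG : ¬ (completeBipartiteGraph (Fin 1) (Fin t)).IsIndContained G) :
    (∃ (root : Fin k → Fin n) (cyc : ∀ i, G.Walk (root i) (root i)),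
      IsInducedCyclePacking G root cyc ∧ (mainP.run (inputStore G t k)).PresentsCycles cyc) ∨
    ∃ (m : ℕ) (D : TreeDecomposition G (Fin m)),
      (D.independenceNumber : ℝ) ≤ 11004 * t * k * Real.log (k + 1) ∧
      (mainP.run (inputStore G t k)).PresentsTreeDecomposition D := by
  classical
  let s := greedyP.run (inputStore G t k)
  have hs : (inputStore G t k).AgreesOff _ _ s := run_agreesOff greedyP _
  have h : HoldsHistory G n s := greedyP_spec rfl (fun u hu v hv => inputStore_arr_adj t k hu hv)
    rfl fun a ha i => by simp [inputStore, ha]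
  have htest : (var rK - var rCnt : Expr).eval s = k - s.var rCnt := by
    rw [eval_sub, eval_var, eval_var, hs.var (x := rK) (by decide)]
    rfl
  rw [mainP, run_seq]
  by_cases hcnt : k ≤ s.var rCnt
  · rw [run_ite_of_eq (htest.trans (Nat.sub_eq_zero_of_le hcnt))]
    obtain ⟨T, hT⟩ := h.history
    obtain ⟨root, cyc, hpacking, hrecord⟩ := hT.exists_packing hcnt
    exact Or.inl ⟨root, cyc, hpacking, by simp, by simpa using hrecord⟩
  · rw [run_ite_of_ne (by rw [htest]; omega)]
    obtain ⟨D, hD⟩ := h.run_treeP ht hk hG (not_le.1 hcnt)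
      (fun x => by rw [hs.arr (by decide)]; simp [inputStore])
      fun x => by rw [hs.arr (by decide)]; simp [inputStore]
    exact Or.inr ⟨n + 1, D, hD⟩

end WholeProgram

end CyclePacking

theorem corollary1p2 :
    ∃ (A : Prog) (P : Polynomial ℕ) (C : ℝ),
      ∀ (n t k : ℕ) (G : SimpleGraph (Fin n)), 0 < t → 0 < k →
        ¬ (completeBipartiteGraph (Fin 1) (Fin t)).IsIndContained G →
        ∃ (time : ℕ) (s : Store),
          A.Exec (inputStore G t k) time s ∧
          time ≤ P.eval (inputSize n t k) ∧
          ((∃ (root : Fin k → Fin n) (cyc : ∀ i, G.Walk (root i) (root i)),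
              IsInducedCyclePacking G root cyc ∧ s.PresentsCycles cyc) ∨
            (∃ (m : ℕ) (D : TreeDecomposition G (Fin m)),
              (D.independenceNumber : ℝ) ≤ C * t * k * Real.log (k + 1) ∧
              s.PresentsTreeDecomposition D)) := by
  refine ⟨CyclePacking.mainP.toProg, CyclePacking.mainP.timeBound, 11004,
    fun n t k G ht hk hG => ?_⟩
  obtain ⟨time, hexec, htime⟩ :=
    ForProg.WellFormed.exec (p := CyclePacking.mainP) (by decide) (inputStore G t k)
  have hsize : n ≤ inputSize n t k := by
    unfold inputSize
    omega
  exact ⟨time, _, hexec, htime.trans (CyclePacking.eval_le_eval _ hsize),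
    CyclePacking.mainP_spec ht hk hG⟩
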